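/- **Setting.** For a vector $u\neq 0$ put $p_u(j)=|u(j)|^2/\|u\|^2$; $\|p-q\|_{\rm TV}=\frac12\sum_j|p(j)-q(j)|$. Let $A\in\mathbb{R}^{m\times n}$. *$(\varepsilon,\phi)$-approximate oversampling-and-query access* to $A$, written $\mathrm{OSQ}_{\varepsilon,\phi}(A)$, means: for some $\bar A\in\mathbb{C}^{m\times n}$ with $|\bar A(i,j)|\ge|A(i,j)|$ for all $i,j$ and $\|\bar A\|_F^2=\phi\|A\|_F^2$, one can query the entries of $A$ and of $\bar A$, query all row norms $\|\bar A(i,\cdot)\|$ and the norm $\|\bar A\|_F$, sample a row index from a distribution within total variation distance $\varepsilon$ of the distribution $i\mapsto\|\bar A(i,\cdot)\|^2/\|\bar A\|_F^2$, and, for each $i$ with $\bar A(i,\cdot)\ne0$, sample a column index from a distribution within total variation distance $\varepsilon$ of $p_{\bar A(i,\cdot)}$. An algorithm is a program of a randomized random access machine over $\mathbb{C}$ (one fixed program for all inputs) in which arithmetic on scalars, complex conjugation, square roots of nonnegative reals, comparison of real parts, addition, subtraction and comparison of indices, memory access, and tossing a coin whose bias is a stored real number cost one unit each. It is given $m,n,i,\sigma,\nu,\xi,\delta,\phi$,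 and it sees $A$ only through $\mathrm{OSQ}_{\varepsilon,\phi}(A)$, each use of which costs $\tau$. $\tilde O$ hides constants and factors polylogarithmic in $m,n$. For a function $f$ on $[0,\infty)$ with $f(0)=0$ and a singular value decomposition $A=\sum_k s_ku_kv_k^{T}$, $f(A)=\sum_k f(s_k)u_kv_k^{T}$. **Theorem.** There are an algorithm and, for all $\sigma\in(0,1]$ and $\xi\in(0,1/2]$, a function $f=f_{\sigma,\xi}$ with $$f(x)=x\ \text{ if } x\ge\sigma(1+\xi),\qquad f(x)=0\ \text{ if } 0\le x<\sigma(1-\xi),\qquad f(x)\in[0,x]\ \text{ if } \sigma(1-\xi)\le x<\sigma(1+\xi),$$ such that the following holds. Let $A\in\mathbb{R}^{m\times n}$, let $i\in\{1,\dots,m\}$, $\sigma,\nu\in(0,1]$, $\xi,\delta\in(0,1/2]$, $\phi\ge1$, $\varepsilon\ge 0$, put $K=\|A\|_F^2/\sigma^2$ and assume $K\ge1$, and write $A_{\sigma,\xi}=f_{\sigma,\xi}(A)$. Assume that $\mathrm{OSQ}_{\varepsilon,\phi}(A)$ is available at cost $\tau=\tilde O(1)$ per use, and that $$\varepsilon\le\frac{\nu\xi}{48K^2\phi}.$$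 Then there is a matrix $\hat A\in\mathbb{R}^{m\times n}$ with $\|\hat A-A_{\sigma,\xi}\|_F\le\nu\|A\|_F$ and $\hat A(i,\cdot)\neq0$ such that, if $$\varepsilon\cdot 45K\phi^2\|A(i,\cdot)\|^2\le\delta\,\|B(i,\cdot)\|^2\qquad\Big(\text{i.e. } \varepsilon\le\frac{\delta\|B(i,\cdot)\|^2}{45K\phi^2\|A(i,\cdot)\|^2}\ \text{ when } A(i,\cdot)\ne0\Big)$$ for $B=\hat A$, or more generally for some $B\in\mathbb{R}^{m\times n}$ with $\|B-A_{\sigma,\xi}\|_F\le\nu\|A\|_F$ and $B(i,\cdot)\ne0$, then the algorithm outputs a column index whose distribution is within total variation distance $\delta$ of $p_{\hat A(i,\cdot)}$, and all its runs take time $$\tilde O\left(\frac{K^{8}\phi^6\log^3(1/\delta)}{\xi^6\nu^6}+\frac{K^3\phi^6\log^2(1/\delta)}{\xi^2\nu^2}\cdot\frac{\|A(i,\cdot)\|^2}{\|B(i,\cdot)\|^2}\right).$$ -/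

import Mathlib

open scoped Matrix.Norms.Frobenius

noncomputable section

namespace RecSys

/-! ### Vectors, distributions, singular value transformation -/

/-- Euclidean norm of a coordinate vector. -/
def l2 {𝕜 : Type*} [RCLike 𝕜] {n : ℕ} (u : Fin n → 𝕜) : ℝ := ‖WithLp.toLp 2 u‖

/-- The weights `p_u(j) = |u(j)|² / ‖u‖²`; a probability distribution when `u ≠ 0`. -/
def sqDist {𝕜 : Type*} [RCLike 𝕜] {n : ℕ} (u : Fin n → 𝕜) (j : Fin n) : ℝ :=
  ‖u j‖ ^ 2 / l2 u ^ 2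

/-- Total variation distance `½ ∑ⱼ |p(j) - q(j)|`. -/
def tv {n : ℕ} (p q : Fin n → ℝ) : ℝ := (1 / 2) * ∑ j, |p j - q j|

/-- The vector of the Euclidean norms of the rows of a matrix. -/
def rowNorms {𝕜 : Type*} [RCLike 𝕜] {m n : ℕ} (A : Matrix (Fin m) (Fin n) 𝕜) : Fin m → ℝ :=
  fun i => l2 (A i)

/-- Singular value transformation of a real matrix, for `f 0 = 0`. With `v k` an orthonormal
eigenbasis of `Aᴴ * A` and `s k` the square roots of its eigenvalues (the singular values),
`A = ∑ k, s k • (u k)(v k)ᵀ` with `u k = (s k)⁻¹ • A (v k)` is a singular value decomposition (the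
terms with `s k = 0` vanish), and the transformed matrix is `∑ k, f (s k) • (u k)(v k)ᵀ`. -/
def svt (f : ℝ → ℝ) {m n : ℕ} (A : Matrix (Fin m) (Fin n) ℝ) : Matrix (Fin m) (Fin n) ℝ :=
  let hA := Matrix.isHermitian_conjTranspose_mul_self A
  let v : Fin n → Fin n → ℝ := fun k => hA.eigenvectorBasis k
  let s : Fin n → ℝ := fun k => √(hA.eigenvalues k)
  ∑ k, f (s k) • Matrix.vecMulVec ((s k)⁻¹ • A.mulVec (v k)) (v k)

/-- The conditions on the soft threshold function at level `σ` with relative width `ξ`. -/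
structure IsSoftThreshold (σ ξ : ℝ) (f : ℝ → ℝ) : Prop where
  above : ∀ x, σ * (1 + ξ) ≤ x → f x = x
  below : ∀ x, 0 ≤ x → x < σ * (1 - ξ) → f x = 0
  between : ∀ x, σ * (1 - ξ) ≤ x → x < σ * (1 + ξ) → 0 ≤ f x ∧ f x ≤ x

/-! ### Approximate oversampling-and-query access -/

/-- The objects behind `(ε, φ)`-approximate oversampling-and-query access to `A`: a matrix `bar`
dominating `A` entrywise with `‖bar‖_F² = φ ‖A‖_F²`, and the distributions from which one can
sample, `ε`-close to the one given by the row norms of `bar` and to those given by the nonzero rows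
of `bar`. (For a zero row of `bar` the sampler is arbitrary.) -/
structure OSQ (ε φ : ℝ) {m n : ℕ} (A : Matrix (Fin m) (Fin n) ℂ) where
  bar : Matrix (Fin m) (Fin n) ℂ
  norm_le_bar : ∀ i j, ‖A i j‖ ≤ ‖bar i j‖
  norm_bar_sq : ‖bar‖ ^ 2 = φ * ‖A‖ ^ 2
  rowSampler : PMF (Fin m)
  rowSampler_close : tv (fun i => (rowSampler i).toReal) (sqDist (rowNorms bar)) ≤ ε
  colSampler : Fin m → PMF (Fin n)
  colSampler_close : ∀ i, bar i ≠ 0 → tv (fun j => (colSampler i j).toReal) (sqDist (bar i)) ≤ ε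

/-! ### Machine model: a randomized random access machine over `ℂ` with oracle access -/

/-- Memory: an array of indices (natural numbers) and an array of scalars. -/
structure Mem where
  nat : ℕ → ℕ
  num : ℕ → ℂ

def Mem.setNat (s : Mem) (d x : ℕ) : Mem := { s with nat := Function.update s.nat d x }

def Mem.setNum (s : Mem) (d : ℕ) (x : ℂ) : Mem := { s with num := Function.update s.num d x }

/-- Elementary instructions; `d`, `a`, `b` are addresses. -/
inductive Instr
  | natConst (d c : ℕ)
  | natAdd (d a b : ℕ)
  | natSub (d a b : ℕ)
  | natLoad (d a : ℕ)
  | natStore (a b : ℕ)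
  | numOfNat (d a : ℕ)
  | numAdd (d a b : ℕ)
  | numSub (d a b : ℕ)
  | numMul (d a b : ℕ)
  | numDiv (d a b : ℕ)
  | numConj (d a : ℕ)
  | numSqrt (d a : ℕ)
  | numLoad (d a : ℕ)
  | numStore (a b : ℕ)
  | flip (d a : ℕ)
  | queryEntry (d a b : ℕ)
  | queryBar (d a b : ℕ)
  | queryRowNorm (d a : ℕ)
  | queryNorm (d : ℕ)
  | sampleRow (d : ℕ)
  | sampleCol (d a : ℕ)

/-- The instructions that use the access to the input matrix. -/
def Instr.isAccess : Instr → Bool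
  | .queryEntry .. | .queryBar .. | .queryRowNorm .. | .queryNorm .. | .sampleRow ..
  | .sampleCol .. => true
  | _ => false

/-- The bit that is `1` with probability `p` (truncated to `[0, 1]`) and `0` otherwise. -/
def coin (p : ℝ) : PMF ℕ :=
  (PMF.ofFintype (fun b : Bool => cond b (min (ENNReal.ofReal p) 1) (1 - min (ENNReal.ofReal p) 1))
    (by simp)).map (fun b => cond b 1 0)

/-- Entry of a matrix at natural number indices, `0` out of range. -/
def entry {m n : ℕ} (M : Matrix (Fin m) (Fin n) ℂ) (i j : ℕ) : ℂ :=
  if h : i < m ∧ j < n then M ⟨i, h.1⟩ ⟨j, h.2⟩ else 0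

variable {ε φ : ℝ} {m n : ℕ} {A : Matrix (Fin m) (Fin n) ℂ}

/-- Effect of an instruction on the memory. -/
def Instr.exec (O : OSQ ε φ A) (s : Mem) : Instr → PMF Mem
  | .natConst d c => PMF.pure (s.setNat d c)
  | .natAdd d a b => PMF.pure (s.setNat d (s.nat a + s.nat b))
  | .natSub d a b => PMF.pure (s.setNat d (s.nat a - s.nat b))
  | .natLoad d a => PMF.pure (s.setNat d (s.nat (s.nat a)))
  | .natStore a b => PMF.pure (s.setNat (s.nat a) (s.nat b))
  | .numOfNat d a => PMF.pure (s.setNum d (s.nat a))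
  | .numAdd d a b => PMF.pure (s.setNum d (s.num a + s.num b))
  | .numSub d a b => PMF.pure (s.setNum d (s.num a - s.num b))
  | .numMul d a b => PMF.pure (s.setNum d (s.num a * s.num b))
  | .numDiv d a b => PMF.pure (s.setNum d (s.num a / s.num b))
  | .numConj d a => PMF.pure (s.setNum d (star (s.num a)))
  | .numSqrt d a => PMF.pure (s.setNum d (√(s.num a).re : ℝ))
  | .numLoad d a => PMF.pure (s.setNum d (s.num (s.nat a)))
  | .numStore a b => PMF.pure (s.setNum (s.nat a) (s.num b))
  | .flip d a => (coin (s.num a).re).map (s.setNat d)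
  | .queryEntry d a b => PMF.pure (s.setNum d (entry A (s.nat a) (s.nat b)))
  | .queryBar d a b => PMF.pure (s.setNum d (entry O.bar (s.nat a) (s.nat b)))
  | .queryRowNorm d a => PMF.pure (s.setNum d
      (if h : s.nat a < m then ((rowNorms O.bar ⟨s.nat a, h⟩ : ℝ) : ℂ) else 0))
  | .queryNorm d => PMF.pure (s.setNum d ((l2 (rowNorms O.bar) : ℝ) : ℂ))
  | .sampleRow d => O.rowSampler.map (fun i => s.setNat d i)
  | .sampleCol d a =>
      if h : s.nat a < m then (O.colSampler ⟨s.nat a, h⟩).map (fun j => s.setNat d j)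
      else PMF.pure s

/-- Tests: comparison of indices, comparison of the real parts of scalars. -/
inductive Test
  | natLt (a b : ℕ)
  | numLe (a b : ℕ)

def Test.Holds (s : Mem) : Test → Prop
  | .natLt a b => s.nat a < s.nat b
  | .numLe a b => (s.num a).re ≤ (s.num b).re

/-- Programs. -/
inductive Prog
  | instr (I : Instr)
  | seq (p q : Prog)
  | branch (t : Test) (p q : Prog)
  | loop (t : Test) (p : Prog)

/-- Configuration of a running program: the stack of programs still to be executed, the memory, and
the cost so far. -/
structure Config where
  todo : List Prog
  mem : Mem
  cost : ℕ

open Classical in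
/-- One step of the computation, when every access to the input matrix costs `τ` and every other
operation costs `1`. The configurations with nothing left to do are final. -/
def step (O : OSQ ε φ A) (τ : ℕ) (c : Config) : PMF Config :=
  match c.todo with
  | [] => PMF.pure c
  | .instr I :: rest =>
      (I.exec O c.mem).map fun s => ⟨rest, s, c.cost + if I.isAccess then τ else 1⟩
  | .seq p q :: rest => PMF.pure ⟨p :: q :: rest, c.mem, c.cost + 1⟩
  | .branch t p q :: rest =>
      PMF.pure ⟨(if t.Holds c.mem then p else q) :: rest, c.mem, c.cost + 1⟩
  | .loop t p :: rest =>
      PMF.pure ⟨if t.Holds c.mem then p :: .loop t p :: rest else rest, c.mem, c.cost + 1⟩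

/-- Law of the configuration after `T` steps. -/
def law (O : OSQ ε φ A) (τ : ℕ) (c : Config) : ℕ → PMF Config
  | 0 => PMF.pure c
  | T + 1 => (law O τ c T).bind (step O τ)

/-- Initial memory: the dimensions, the (zero-based) row index, and the real parameters. -/
def inputMem (m n i : ℕ) (σ ν ξ δ φ : ℝ) : Mem where
  nat := fun k => [m, n, i].getD k 0
  num := fun k => (([σ, ν, ξ, δ, φ].getD k 0 : ℝ) : ℂ)

/-- Every run of `p` on the input memory `s` ends, at cost at most `b`, after at most `T` steps,
with an index below `n` in the output cell (the index cell `0`). -/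
def EndsBy (O : OSQ ε φ A) (τ : ℕ) (p : Prog) (s : Mem) (T : ℕ) (b : ℝ) : Prop :=
  ∀ c ∈ (law O τ ⟨[p], s, 0⟩ T).support, c.todo = [] ∧ (c.cost : ℝ) ≤ b ∧ c.mem.nat 0 < n

/-- Distribution of the output cell after `T` steps. -/
def outDist (O : OSQ ε φ A) (τ : ℕ) (p : Prog) (s : Mem) (T : ℕ) (j : Fin n) : ℝ :=
  (((law O τ ⟨[p], s, 0⟩ T).map fun c => c.mem.nat 0) j).toReal

/-! ### Parameters -/

/-- `K = ‖A‖_F² / σ²`. -/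
def ratioK {m n : ℕ} (A : Matrix (Fin m) (Fin n) ℝ) (σ : ℝ) : ℝ := ‖A‖ ^ 2 / σ ^ 2

/-- `1 + log (m n)`; the hidden factors of `Õ` are of the form `C * logDim m n ^ C`. -/
def logDim (m n : ℕ) : ℝ := 1 + Real.log (m * n)

/-- The expression under `Õ`, for a row of norm `a` of the input and a row of norm `b` of the
approximation. -/
def timeBound (K φ ξ ν δ a b : ℝ) : ℝ :=
  K ^ 8 * φ ^ 6 * Real.log (1 / δ) ^ 3 / (ξ ^ 6 * ν ^ 6) +
    K ^ 3 * φ ^ 6 * Real.log (1 / δ) ^ 2 / (ξ ^ 2 * ν ^ 2) * (a ^ 2 / b ^ 2)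

end RecSys

end

open scoped Matrix.Norms.Frobenius

noncomputable section

namespace RecSys

/-! ### Big-step reasoning about programs -/

section Semantics

variable {ε φ : ℝ} {m n : ℕ} {A : Matrix (Fin m) (Fin n) ℂ}

/-! With `g = ramp σ ξ`, take `f x = x * g (x ^ 2)`. Then the transformed matrix is `A g(AᵀA)`
(`svt_eq_mul_specFun`), and its row `i` is `x = Aᵢ g(AᵀA)`. The program samples approximately from
the squares of `x`, and it needs neither an eigenvalue computation nor a matrix inverse.

Let `b = ‖bar‖_F`. Sample `S ≈ 10⁴ (b²/(σ²ξν))²` rows, rescale them, and put the row `i` itself,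
unscaled, on top; call the result `R`. Since `RᵀR` is a nearly unbiased estimate of `AᵀA` and
Lipschitz functions are Lipschitz in Frobenius norm (`frobSq_specFun_sub_le`), `x ≈ Aᵢ g(RᵀR) = e₀ᵀ
R g(RᵀR) = (g(RRᵀ) e₀)ᵀ R` (`row_vecMul_specFun`). So `x` is nearly a combination of the rows of `R`
with coefficient vector `z = g(RRᵀ) e₀`. Sampling `S` columns of `R` gives a square-size matrix `F`
with `2b² FFᵀ ≈ RRᵀ` and always `‖F‖_F ≤ 1` (`frobSq_subsketch_le`). On `[0, 1]` the function `g(2b²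
·)` is approximated by its Bernstein polynomial of degree `S`, which a Horner-like recursion
evaluates at `FFᵀ` on `e₀` (`hornerVec_eq`). This produces the computed coefficients `w`, and
rejection sampling draws a column from the squares of `y = wᵀR`. The acceptance rate is bounded
below because `σ² g(t)² ≤ t` forces `σ²‖z‖² ≤ ‖Aᵢ‖²` (`mul_sq_specFun_single_le`).

No event of failure is ever isolated; all errors are controlled in mean square. For every outcome of
the sketch, `exists_ideal_law` gives a distribution `D` within `δ` of the conditional output law,
such that `‖x‖ √D` is close to `|x|` up to a multiple of the sketching errors. If the sketch is bad,
`D` is the conditional law itself and the trivial bound `2‖x‖²` is already below the error. By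
concavity of the square root the estimate survives averaging over sketches
(`sum_sub_abs_sq_expect_le`). The row `i` of the approximating matrix is then defined from the
averaged `D` as `sign(x) ‖x‖ √D`: its squared entries are exactly proportional to `D`, and its
distance to `x` is the mean square error, at most `ν ‖A‖_F` (`exists_output_law`). Thus `δ` only has
to absorb the bias `ε` of the samplers, amplified by the inverse acceptance rate. If `x` is shorter
than `ν ‖A‖_F`, any law whatsoever is realised by an admissible row.

The program makes `O(S³)` steps on every run, which is of order `(φK/(ξν))⁶` and hence below the
first term of the time bound (`cost_le`). On the machine side, `Spec` couples the final memory with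
a random value of known law, and loop invariants lead to `spec_mainProg`. -/

theorem bind_congr_support {α β : Type*} (p : PMF α) {f g : α → PMF β}
    (h : ∀ a ∈ p.support, f a = g a) : p.bind f = p.bind g := by
  ext b
  simp only [PMF.bind_apply]
  refine tsum_congr fun a => ?_
  by_cases ha : a ∈ p.support
  · rw [h a ha]
  · rw [(PMF.apply_eq_zero_iff p a).2 ha, zero_mul, zero_mul]

theorem law_succ' (O : OSQ ε φ A) (τ : ℕ) (c : Config) (T : ℕ) :
    law O τ c (T + 1) = (step O τ c).bind fun c' => law O τ c' T := by
  induction T with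
  | zero => simp [law]
  | succ T ih =>
    rw [law, ih, PMF.bind_bind]
    rfl

theorem step_cost_le (O : OSQ ε φ A) (τ : ℕ) (c : Config) :
    ∀ c' ∈ (step O τ c).support, c'.cost ≤ c.cost + (τ + 1) := by
  intro c' hc'
  unfold step at hc'
  split at hc'
  · rw [PMF.mem_support_pure_iff] at hc'; subst hc'; omega
  · rw [PMF.mem_support_map_iff] at hc'
    obtain ⟨s, -, rfl⟩ := hc'
    dsimp only
    split <;> omega
  all_goals (rw [PMF.mem_support_pure_iff] at hc'; subst hc'; dsimp only; omega)

theorem law_cost_le (O : OSQ ε φ A) (τ : ℕ) (c : Config) (T : ℕ) :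
    ∀ c' ∈ (law O τ c T).support, c'.cost ≤ c.cost + T * (τ + 1) := by
  induction T with
  | zero => intro c' hc'; rw [law, PMF.mem_support_pure_iff] at hc'; subst hc'; omega
  | succ T ih =>
    intro c' hc'
    rw [law, PMF.mem_support_bind_iff] at hc'
    obtain ⟨c1, h1, h2⟩ := hc'
    have := ih c1 h1
    have := step_cost_le O τ c1 c' h2
    rw [Nat.succ_mul]; omega

/-- From the stack `L` and the memory `s` the computation is over after `t` steps, and the final
memory has law `μ`. -/
def Halts (O : OSQ ε φ A) (τ : ℕ) (L : List Prog) (s : Mem) (μ : PMF Mem) (t : ℕ) : Prop :=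
  ∀ c₀ T, t ≤ T →
    (law O τ ⟨L, s, c₀⟩ T).map (fun c => (c.todo, c.mem)) = μ.map fun s' => ([], s')

theorem Halts.nil (O : OSQ ε φ A) (τ : ℕ) (s : Mem) (t : ℕ) : Halts O τ [] s (PMF.pure s) t := by
  intro c₀ T _
  have h : ∀ T, law O τ ⟨[], s, c₀⟩ T = PMF.pure ⟨[], s, c₀⟩ := by
    intro T
    induction T with
    | zero => rfl
    | succ T ih => rw [law_succ']; simpa only [step, PMF.pure_bind] using ih
  rw [h, PMF.pure_map, PMF.pure_map]

theorem Halts.mono {O : OSQ ε φ A} {τ : ℕ} {L : List Prog} {s : Mem} {μ : PMF Mem} {t t' : ℕ}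
    (h : Halts O τ L s μ t) (ht : t ≤ t') : Halts O τ L s μ t' :=
  fun c₀ T hT => h c₀ T (ht.trans hT)

/-- Running `p` on the memory `s` takes at most `t` steps and leaves a memory of law `μ`, whatever
comes after `p`. -/
def Exec (O : OSQ ε φ A) (τ : ℕ) (p : Prog) (s : Mem) (μ : PMF Mem) (t : ℕ) : Prop :=
  ∀ L (κ : Mem → PMF Mem) t₂, (∀ s' ∈ μ.support, Halts O τ L s' (κ s') t₂) →
    Halts O τ (p :: L) s (μ.bind κ) (t + t₂)

theorem Exec.halts {O : OSQ ε φ A} {τ : ℕ} {p : Prog} {s : Mem} {μ : PMF Mem} {t : ℕ}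
    (h : Exec O τ p s μ t) : Halts O τ [p] s μ t := by
  have := h [] PMF.pure 0 fun s' _ => Halts.nil O τ s' 0
  simpa using this

theorem Exec.mono {O : OSQ ε φ A} {τ : ℕ} {p : Prog} {s : Mem} {μ : PMF Mem} {t t' : ℕ}
    (h : Exec O τ p s μ t) (ht : t ≤ t') : Exec O τ p s μ t' :=
  fun L κ t₂ hL => (h L κ t₂ hL).mono (by omega)

/-- One step that only changes the stack. -/
theorem Halts.of_step {O : OSQ ε φ A} {τ : ℕ} {L L' : List Prog} {s : Mem} {μ : PMF Mem} {t : ℕ}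
    (hs : ∀ c₀, step O τ ⟨L, s, c₀⟩ = PMF.pure ⟨L', s, c₀ + 1⟩) (h : Halts O τ L' s μ t) :
    Halts O τ L s μ (t + 1) := by
  intro c₀ T hT
  obtain ⟨T, rfl⟩ : ∃ T', T = T' + 1 := ⟨T - 1, by omega⟩
  rw [law_succ', hs, PMF.pure_bind]
  exact h _ T (by omega)

theorem Exec.instr (O : OSQ ε φ A) (τ : ℕ) (I : Instr) (s : Mem) :
    Exec O τ (.instr I) s (I.exec O s) 1 := by
  intro L κ t₂ hL c₀ T hT
  obtain ⟨T, rfl⟩ : ∃ T', T = T' + 1 := ⟨T - 1, by omega⟩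
  rw [law_succ']
  simp only [step]
  rw [PMF.bind_map, PMF.map_bind, PMF.map_bind]
  exact bind_congr_support _ fun s' hs' => hL s' hs' _ T (by omega)

theorem Exec.seq {O : OSQ ε φ A} {τ : ℕ} {p q : Prog} {s : Mem} {μ : PMF Mem} {κ : Mem → PMF Mem}
    {t₁ t₂ : ℕ} (hp : Exec O τ p s μ t₁) (hq : ∀ s' ∈ μ.support, Exec O τ q s' (κ s') t₂) :
    Exec O τ (.seq p q) s (μ.bind κ) (t₁ + t₂ + 1) := by
  intro L κ' t₃ hL
  have h := hp (q :: L) (fun s' => (κ s').bind κ') (t₂ + t₃) fun s' hs' =>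
    hq s' hs' L κ' t₃ fun s'' hs'' => hL s'' ((PMF.mem_support_bind_iff _ _ _).2 ⟨s', hs', hs''⟩)
  rw [PMF.bind_bind]
  exact (Halts.of_step (fun c₀ => rfl) h).mono (by omega)

open Classical in
theorem Exec.branch {O : OSQ ε φ A} {τ : ℕ} {b : Test} {p q : Prog} {s : Mem} {μ : PMF Mem} {t : ℕ}
    (h : Exec O τ (if b.Holds s then p else q) s μ t) : Exec O τ (.branch b p q) s μ (t + 1) := by
  intro L κ t₂ hL
  exact (Halts.of_step (fun c₀ => rfl) (h L κ t₂ hL)).mono (by omega)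

theorem Exec.loop_done (O : OSQ ε φ A) (τ : ℕ) {b : Test} (p : Prog) {s : Mem} (hb : ¬ b.Holds s) :
    Exec O τ (.loop b p) s (PMF.pure s) 1 := by
  intro L κ t₂ hL
  rw [PMF.pure_bind]
  refine (Halts.of_step (fun c₀ => ?_) (hL s (by simp))).mono (by omega)
  simp [step, hb]

theorem Exec.loop_step {O : OSQ ε φ A} {τ : ℕ} {b : Test} {p : Prog} {s : Mem} {μ : PMF Mem}
    {κ : Mem → PMF Mem} {t₁ t₂ : ℕ} (hb : b.Holds s) (hp : Exec O τ p s μ t₁)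
    (hq : ∀ s' ∈ μ.support, Exec O τ (.loop b p) s' (κ s') t₂) :
    Exec O τ (.loop b p) s (μ.bind κ) (t₁ + t₂ + 1) := by
  intro L κ' t₃ hL
  have h := hp (.loop b p :: L) (fun s' => (κ s').bind κ') (t₂ + t₃) fun s' hs' =>
    hq s' hs' L κ' t₃ fun s'' hs'' => hL s'' ((PMF.mem_support_bind_iff _ _ _).2 ⟨s', hs', hs''⟩)
  rw [PMF.bind_bind]
  exact (Halts.of_step (fun c₀ => by simp [step, hb]) h).mono (by omega)

/-! ### Specifications -/

/-- Running `p` on `s` takes at most `t` steps, and its effect is described by a random value of law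
`P` that the final memory represents in the sense of `Q`. -/
def Spec (O : OSQ ε φ A) (τ : ℕ) {Ω : Type} (p : Prog) (s : Mem) (P : PMF Ω) (Q : Ω → Mem → Prop)
    (t : ℕ) : Prop :=
  ∃ μ : PMF (Ω × Mem), μ.map Prod.fst = P ∧ (∀ x ∈ μ.support, Q x.1 x.2) ∧
    Exec O τ p s (μ.map Prod.snd) t

theorem Spec.conseq {O : OSQ ε φ A} {τ : ℕ} {Ω : Type} {p : Prog} {s : Mem} {P : PMF Ω}
    {Q Q' : Ω → Mem → Prop} {t t' : ℕ} (h : Spec O τ p s P Q t) (hQ : ∀ ω s', Q ω s' → Q' ω s')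
    (ht : t ≤ t') : Spec O τ p s P Q' t' := by
  obtain ⟨μ, h1, h2, h3⟩ := h
  exact ⟨μ, h1, fun x hx => hQ _ _ (h2 x hx), h3.mono ht⟩

theorem Spec.map {O : OSQ ε φ A} {τ : ℕ} {Ω Ω' : Type} {p : Prog} {s : Mem} {P : PMF Ω}
    {Q : Ω → Mem → Prop} {Q' : Ω' → Mem → Prop} {t : ℕ} (h : Spec O τ p s P Q t) (g : Ω → Ω')
    (hQ : ∀ ω s', Q ω s' → Q' (g ω) s') : Spec O τ p s (P.map g) Q' t := by
  obtain ⟨μ, rfl, h2, h3⟩ := h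
  refine ⟨μ.map (Prod.map g id), ?_, ?_, ?_⟩
  · rw [PMF.map_comp, PMF.map_comp]; rfl
  · intro x hx
    rw [PMF.mem_support_map_iff] at hx
    obtain ⟨y, hy, rfl⟩ := hx
    exact hQ _ _ (h2 y hy)
  · rw [PMF.map_comp]; exact h3

theorem pmf_map_injective {α β : Type*} {f : α → β} (hf : Function.Injective f) :
    Function.Injective (PMF.map f) := by
  intro p q h
  have key : ∀ (r : PMF α) a, (r.map f) (f a) = r a := by
    intro r a
    rw [PMF.map_apply, tsum_eq_single a]
    · simp
    · intro b hb
      rw [if_neg fun h => hb (hf h).symm]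
  ext a
  rw [← key p, ← key q, h]

/-- With an empty continuation both laws are read off from the machine at one common late time. This
is what makes the law after a program a function of the memory alone. -/
theorem Exec.unique {O : OSQ ε φ A} {τ : ℕ} {p : Prog} {s : Mem} {μ μ' : PMF Mem} {t t' : ℕ}
    (h : Exec O τ p s μ t) (h' : Exec O τ p s μ' t') : μ = μ' := by
  have h1 := h.halts 0 (max t t') (le_max_left _ _)
  have h2 := h'.halts 0 (max t t') (le_max_right _ _)
  exact pmf_map_injective (f := fun s' : Mem => (([] : List Prog), s'))
    (fun a b hab => (Prod.mk.inj hab).2) (h1.symm.trans h2)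

/-- Sequential composition of couplings whose second marginals are executions. -/
theorem exists_bind_coupling {O : OSQ ε φ A} {τ : ℕ} {q : Prog} {t : ℕ} {Ω Ω' : Type}
    (μ : PMF (Ω × Mem)) (P' : Ω → PMF Ω') (Q' : Ω' → Mem → Prop)
    (h : ∀ x ∈ μ.support, Spec O τ q x.2 (P' x.1) Q' t) :
    ∃ (ν : PMF (Ω' × Mem)) (κ : Mem → PMF Mem), ν.map Prod.fst = (μ.map Prod.fst).bind P' ∧
      (∀ y ∈ ν.support, Q' y.1 y.2) ∧
      (∀ s' ∈ (μ.map Prod.snd).support, Exec O τ q s' (κ s') t) ∧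
      ν.map Prod.snd = (μ.map Prod.snd).bind κ := by
  classical
  obtain ⟨x₀, hx₀⟩ := μ.support_nonempty
  have : Nonempty (PMF (Ω' × Mem)) := ⟨(h x₀ hx₀).choose⟩
  choose! ν hν1 hν2 hν3 using h
  -- The same memory may be coupled with several values `ω`, whereas an execution kernel may depend
  -- only on the memory. One kernel per memory is chosen here, and `Exec.unique` identifies it with
  -- each of the coupled ones.
  have hex : ∀ s' ∈ (μ.map Prod.snd).support, ∃ κ, Exec O τ q s' κ t := by
    intro s' hs'
    rw [PMF.mem_support_map_iff] at hs'
    obtain ⟨x, hx, rfl⟩ := hs'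
    exact ⟨_, hν3 x hx⟩
  have : Nonempty (PMF Mem) := ⟨PMF.pure ⟨0, 0⟩⟩
  choose! κ hκ using hex
  refine ⟨μ.bind ν, κ, ?_, ?_, hκ, ?_⟩
  · rw [PMF.map_bind, PMF.bind_map]
    exact bind_congr_support _ fun x hx => hν1 x hx
  · intro y hy
    rw [PMF.mem_support_bind_iff] at hy
    obtain ⟨x, hx, hy⟩ := hy
    exact hν2 x hx y hy
  · rw [PMF.map_bind, PMF.bind_map]
    refine bind_congr_support _ fun x hx => ?_
    exact (hν3 x hx).unique (hκ _ ((PMF.mem_support_map_iff _ _ _).2 ⟨x, hx, rfl⟩))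

theorem Spec.seq {O : OSQ ε φ A} {τ : ℕ} {Ω Ω' : Type} {p q : Prog} {s : Mem} {P : PMF Ω}
    {P' : Ω → PMF Ω'} {Q : Ω → Mem → Prop} {Q' : Ω' → Mem → Prop} {t₁ t₂ : ℕ}
    (hp : Spec O τ p s P Q t₁) (hq : ∀ ω s', Q ω s' → Spec O τ q s' (P' ω) Q' t₂) :
    Spec O τ (.seq p q) s (P.bind P') Q' (t₁ + t₂ + 1) := by
  obtain ⟨μ, rfl, h2, h3⟩ := hp
  obtain ⟨ν, κ, k1, k2, k3, k4⟩ :=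
    exists_bind_coupling μ P' Q' fun x hx => hq x.1 x.2 (h2 x hx)
  exact ⟨ν, k1, k2, k4 ▸ Exec.seq h3 k3⟩

open Classical in
theorem Spec.branch {O : OSQ ε φ A} {τ : ℕ} {Ω : Type} {b : Test} {p q : Prog} {s : Mem} {P : PMF Ω}
    {Q : Ω → Mem → Prop} {t : ℕ} (hp : b.Holds s → Spec O τ p s P Q t)
    (hq : ¬ b.Holds s → Spec O τ q s P Q t) : Spec O τ (.branch b p q) s P Q (t + 1) := by
  have : Spec O τ (if b.Holds s then p else q) s P Q t := by
    split
    · exact hp ‹_›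
    · exact hq ‹_›
  obtain ⟨μ, h1, h2, h3⟩ := this
  exact ⟨μ, h1, h2, h3.branch⟩

theorem Spec.pure {O : OSQ ε φ A} {τ : ℕ} {Ω : Type} {p : Prog} {s s' : Mem}
    {Q : Ω → Mem → Prop} {t : ℕ} (h : Exec O τ p s (PMF.pure s') t) {ω : Ω} (hQ : Q ω s') :
    Spec O τ p s (PMF.pure ω) Q t := by
  refine ⟨PMF.pure (ω, s'), by simp [PMF.pure_map], ?_, by simpa [PMF.pure_map] using h⟩
  intro x hx
  rw [PMF.mem_support_pure_iff] at hx
  subst hx; exact hQ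

/-- In the sampling instructions the coercion from `Fin` to `ℕ` is elaborated as a monadic lift of
the whole law; this turns it back into a plain `map`. -/
theorem map_lift {α β γ : Type} (P : PMF α) (c : α → β) (f : β → γ) :
    PMF.map f (do let a ← P; Pure.pure (c a)) = P.map fun a => f (c a) := by
  change PMF.map f (P.bind fun a => PMF.pure (c a)) = _
  rw [PMF.map_bind]
  simp only [PMF.pure_map]
  rfl

theorem Spec.flip (O : OSQ ε φ A) (τ d a : ℕ) (s : Mem) :
    Spec O τ (.instr (.flip d a)) s (coin (s.num a).re)
      (fun b s' => b ≤ 1 ∧ s' = s.setNat d b) 1 := by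
  refine ⟨(coin (s.num a).re).map fun b => (b, s.setNat d b), ?_, ?_, ?_⟩
  · rw [PMF.map_comp]; exact PMF.map_id _
  · intro x hx
    rw [PMF.mem_support_map_iff] at hx
    obtain ⟨b, hb, rfl⟩ := hx
    refine ⟨?_, rfl⟩
    rw [coin, PMF.mem_support_map_iff] at hb
    obtain ⟨c, -, rfl⟩ := hb
    cases c <;> simp
  · rw [PMF.map_comp]; exact Exec.instr O τ _ s

theorem Spec.sampleRow (O : OSQ ε φ A) (τ d : ℕ) (s : Mem) :
    Spec O τ (.instr (.sampleRow d)) s O.rowSampler (fun r s' => s' = s.setNat d r) 1 := by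
  refine ⟨O.rowSampler.map fun b => (b, s.setNat d b), ?_, ?_, ?_⟩
  · rw [PMF.map_comp]; exact PMF.map_id _
  · intro x hx
    rw [PMF.mem_support_map_iff] at hx
    obtain ⟨b, hb, rfl⟩ := hx
    rfl
  · rw [PMF.map_comp]
    have := Exec.instr O τ (.sampleRow d) s
    rwa [Instr.exec, map_lift] at this

theorem Spec.sampleCol (O : OSQ ε φ A) (τ d a : ℕ) (s : Mem) (r : Fin m) (hr : s.nat a = r) :
    Spec O τ (.instr (.sampleCol d a)) s (O.colSampler r) (fun j s' => s' = s.setNat d j) 1 := by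
  refine ⟨(O.colSampler r).map fun b => (b, s.setNat d b), ?_, ?_, ?_⟩
  · rw [PMF.map_comp]; exact PMF.map_id _
  · intro x hx
    rw [PMF.mem_support_map_iff] at hx
    obtain ⟨b, hb, rfl⟩ := hx
    rfl
  · rw [PMF.map_comp]
    have := Exec.instr O τ (.sampleCol d a) s
    simp only [Instr.exec, hr, Fin.is_lt, dite_true, Fin.eta] at this
    rwa [map_lift] at this

/-- The steps `κ k, κ (k + 1), …, κ (k + r - 1)` in sequence. -/
def chain {Ω : Type} (κ : ℕ → Ω → PMF Ω) : ℕ → ℕ → Ω → PMF Ω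
  | _, 0, ω => PMF.pure ω
  | k, r + 1, ω => (κ k ω).bind (chain κ (k + 1) r)

theorem chain_succ {Ω : Type} (κ : ℕ → Ω → PMF Ω) (k r : ℕ) (ω : Ω) :
    chain κ k (r + 1) ω = (chain κ k r ω).bind (κ (k + r)) := by
  induction r generalizing k ω with
  | zero => simp [chain]
  | succ r ih =>
    rw [chain, chain, PMF.bind_bind]
    congr 1
    funext ω'
    rw [ih, show k + 1 + r = k + (r + 1) by ring]

/-- The number `N` of iterations is fixed, and the invariant `R k ω` carries the random state, so
the loop has the law of a Markov chain with time-dependent steps. -/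
theorem Spec.loop {O : OSQ ε φ A} {τ : ℕ} {Ω : Type} {b : Test} {p : Prog}
    {R : ℕ → Ω → Mem → Prop} {κ : ℕ → Ω → PMF Ω} {N t : ℕ}
    (hb : ∀ k ω s, k < N → R k ω s → b.Holds s)
    (hp : ∀ k ω s, k < N → R k ω s → Spec O τ p s (κ k ω) (R (k + 1)) t)
    (hN : ∀ ω s, R N ω s → ¬ b.Holds s) (r k : ℕ) (hk : k + r = N) (ω : Ω) (s : Mem)
    (hs : R k ω s) :
    Spec O τ (.loop b p) s (chain κ k r ω) (R N) (r * (t + 1) + 1) := by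
  induction r generalizing k ω s with
  | zero =>
    obtain rfl : k = N := by omega
    simpa [chain] using Spec.pure (Exec.loop_done O τ p (hN ω s hs)) hs
  | succ r ih =>
    obtain ⟨μ, h1, h2, h3⟩ := hp k ω s (by omega) hs
    obtain ⟨ν, κ', k1, k2, k3, k4⟩ := exists_bind_coupling (q := .loop b p) μ
      (chain κ (k + 1) r) (R N) fun x hx => ih (k + 1) (by omega) x.1 x.2 (h2 x hx)
    refine ⟨ν, by rw [k1, h1]; rfl, k2, ?_⟩
    rw [k4]
    refine (Exec.loop_step (hb k ω s (by omega) hs) h3 k3).mono ?_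
    rw [Nat.succ_mul]; omega

/-- Running `p` on `s` is deterministic, takes at most `t` steps and leads to a memory with `Q`. -/
def Det (O : OSQ ε φ A) (τ : ℕ) (p : Prog) (s : Mem) (Q : Mem → Prop) (t : ℕ) : Prop :=
  ∃ s', Q s' ∧ Exec O τ p s (PMF.pure s') t

theorem Det.conseq {O : OSQ ε φ A} {τ : ℕ} {p : Prog} {s : Mem} {Q Q' : Mem → Prop} {t t' : ℕ}
    (h : Det O τ p s Q t) (hQ : ∀ s', Q s' → Q' s') (ht : t ≤ t') : Det O τ p s Q' t' := by
  obtain ⟨s', h1, h2⟩ := h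
  exact ⟨s', hQ _ h1, h2.mono ht⟩

theorem Det.spec {O : OSQ ε φ A} {τ : ℕ} {p : Prog} {s : Mem} {Q : Mem → Prop} {t : ℕ}
    (h : Det O τ p s Q t) {Ω : Type} (ω : Ω) :
    Spec O τ p s (PMF.pure ω) (fun ω' s' => ω' = ω ∧ Q s') t := by
  obtain ⟨s', h1, h2⟩ := h
  exact Spec.pure h2 ⟨rfl, h1⟩

theorem Det.seq {O : OSQ ε φ A} {τ : ℕ} {p q : Prog} {s : Mem} {Q Q' : Mem → Prop} {t₁ t₂ : ℕ}
    (hp : Det O τ p s Q t₁) (hq : ∀ s', Q s' → Det O τ q s' Q' t₂) :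
    Det O τ (.seq p q) s Q' (t₁ + t₂ + 1) := by
  obtain ⟨s', h1, h2⟩ := hp
  obtain ⟨s'', k1, k2⟩ := hq s' h1
  refine ⟨s'', k1, ?_⟩
  have := Exec.seq (κ := fun _ => PMF.pure s'') (q := q) (t₂ := t₂) h2 (by
    intro x hx
    rw [PMF.mem_support_pure_iff] at hx
    subst hx; exact k2)
  rwa [PMF.pure_bind] at this

theorem Det.seq_spec {O : OSQ ε φ A} {τ : ℕ} {Ω : Type} {p q : Prog} {s : Mem} {Q : Mem → Prop}
    {P : PMF Ω} {Q' : Ω → Mem → Prop} {t₁ t₂ : ℕ} (hp : Det O τ p s Q t₁)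
    (hq : ∀ s', Q s' → Spec O τ q s' P Q' t₂) : Spec O τ (.seq p q) s P Q' (t₁ + t₂ + 1) := by
  have := (hp.spec ()).seq (P' := fun _ => P) fun _ s' h => hq s' h.2
  rwa [PMF.pure_bind] at this

theorem Spec.seq_det {O : OSQ ε φ A} {τ : ℕ} {Ω : Type} {p q : Prog} {s : Mem}
    {P : PMF Ω} {Q Q' : Ω → Mem → Prop} {t₁ t₂ : ℕ} (hp : Spec O τ p s P Q t₁)
    (hq : ∀ ω s', Q ω s' → Det O τ q s' (Q' ω) t₂) :
    Spec O τ (.seq p q) s P Q' (t₁ + t₂ + 1) := by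
  have := hp.seq (P' := PMF.pure) fun ω s' h =>
    ((hq ω s' h).spec ω).conseq (Q' := Q') (by rintro _ _ ⟨rfl, h⟩; exact h) le_rfl
  rwa [PMF.bind_pure] at this

theorem Det.branch {O : OSQ ε φ A} {τ : ℕ} {b : Test} {p q : Prog} {s : Mem}
    {Q : Mem → Prop} {t : ℕ} (hp : b.Holds s → Det O τ p s Q t)
    (hq : ¬ b.Holds s → Det O τ q s Q t) : Det O τ (.branch b p q) s Q (t + 1) := by
  classical
  have : Det O τ (if b.Holds s then p else q) s Q t := by
    split
    · exact hp ‹_›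
    · exact hq ‹_›
  obtain ⟨s', h1, h2⟩ := this
  exact ⟨s', h1, h2.branch⟩

theorem Det.loop {O : OSQ ε φ A} {τ : ℕ} {b : Test} {p : Prog} {R : ℕ → Mem → Prop} {N t : ℕ}
    (hb : ∀ k s, k < N → R k s → b.Holds s)
    (hp : ∀ k s, k < N → R k s → Det O τ p s (R (k + 1)) t)
    (hN : ∀ s, R N s → ¬ b.Holds s) (s : Mem) (hs : R 0 s) :
    Det O τ (.loop b p) s (R N) (N * (t + 1) + 1) := by
  suffices H : ∀ r k s, k + r = N → R k s → Det O τ (.loop b p) s (R N) (r * (t + 1) + 1) from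
    H N 0 s (by omega) hs
  intro r
  induction r with
  | zero =>
    intro k s hk hs
    obtain rfl : k = N := by omega
    exact ⟨s, hs, by simpa using Exec.loop_done O τ p (hN s hs)⟩
  | succ r ih =>
    intro k s hk hs
    obtain ⟨s', h1, h2⟩ := hp k s (by omega) hs
    obtain ⟨s'', k1, k2⟩ := ih (k + 1) s' (by omega) h1
    refine ⟨s'', k1, ?_⟩
    have := Exec.loop_step (κ := fun _ => PMF.pure s'') (t₂ := r * (t + 1) + 1)
      (hb k s (by omega) hs) h2 (by
        intro x hx
        rw [PMF.mem_support_pure_iff] at hx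
        subst hx; exact k2)
    rw [PMF.pure_bind] at this
    refine this.mono ?_
    rw [Nat.succ_mul]; omega

/-! ### Blocks of deterministic instructions -/

/-- Effect of a deterministic instruction (sampling instructions are ignored). -/
def Instr.eff (O : OSQ ε φ A) (s : Mem) : Instr → Mem
  | .natConst d c => s.setNat d c
  | .natAdd d a b => s.setNat d (s.nat a + s.nat b)
  | .natSub d a b => s.setNat d (s.nat a - s.nat b)
  | .natLoad d a => s.setNat d (s.nat (s.nat a))
  | .natStore a b => s.setNat (s.nat a) (s.nat b)
  | .numOfNat d a => s.setNum d (s.nat a)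
  | .numAdd d a b => s.setNum d (s.num a + s.num b)
  | .numSub d a b => s.setNum d (s.num a - s.num b)
  | .numMul d a b => s.setNum d (s.num a * s.num b)
  | .numDiv d a b => s.setNum d (s.num a / s.num b)
  | .numConj d a => s.setNum d (star (s.num a))
  | .numSqrt d a => s.setNum d (√(s.num a).re : ℝ)
  | .numLoad d a => s.setNum d (s.num (s.nat a))
  | .numStore a b => s.setNum (s.nat a) (s.num b)
  | .queryEntry d a b => s.setNum d (entry A (s.nat a) (s.nat b))
  | .queryBar d a b => s.setNum d (entry O.bar (s.nat a) (s.nat b))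
  | .queryRowNorm d a => s.setNum d
      (if h : s.nat a < m then ((rowNorms O.bar ⟨s.nat a, h⟩ : ℝ) : ℂ) else 0)
  | .queryNorm d => s.setNum d ((l2 (rowNorms O.bar) : ℝ) : ℂ)
  | .flip .. | .sampleRow .. | .sampleCol .. => s

/-- The instructions without random effects. -/
def Instr.isDet : Instr → Bool
  | .flip .. | .sampleRow .. | .sampleCol .. => false
  | _ => true

theorem Instr.exec_of_isDet (O : OSQ ε φ A) (s : Mem) (I : Instr) (hI : I.isDet = true) :
    I.exec O s = PMF.pure (I.eff O s) := by
  cases I <;> first | rfl | simp [Instr.isDet] at hI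

/-- A block of instructions; the index cell `63` is overwritten at the end. -/
def block : List Instr → Prog
  | [] => .instr (.natConst 63 0)
  | I :: l => .seq (.instr I) (block l)

/-- Effect of a block. -/
def effs (O : OSQ ε φ A) (s : Mem) : List Instr → Mem
  | [] => s.setNat 63 0
  | I :: l => effs O (I.eff O s) l

theorem Exec.block (O : OSQ ε φ A) (τ : ℕ) (l : List Instr) (hl : l.all Instr.isDet = true)
    (s : Mem) : Exec O τ (block l) s (PMF.pure (effs O s l)) (2 * l.length + 1) := by
  induction l generalizing s with
  | nil => exact Exec.instr O τ _ s
  | cons I l ih =>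
    rw [List.all_cons, Bool.and_eq_true] at hl
    have h1 := Exec.instr O τ I s
    rw [I.exec_of_isDet O s hl.1] at h1
    have := Exec.seq (q := RecSys.block l) (κ := fun s' => PMF.pure (effs O s' l)) h1
      fun s' _ => ih hl.2 s'
    rw [PMF.pure_bind] at this
    exact this.mono (by rw [List.length_cons]; omega)

theorem Det.block (O : OSQ ε φ A) (τ : ℕ) (l : List Instr) (hl : l.all Instr.isDet = true)
    (s : Mem) {Q : Mem → Prop} (hQ : Q (effs O s l)) :
    Det O τ (block l) s Q (2 * l.length + 1) :=
  ⟨_, hQ, Exec.block O τ l hl s⟩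

end Semantics

end RecSys

end

noncomputable section

namespace RecSys

/-! ### The program: memory layout and building blocks

Cells below `20` hold parameters and outer loop counters, the cells `20, …, 63` are scratch, and from
cell `64` on there are eight interleaved arrays. -/

section Layout

variable {ε φ : ℝ} {m n : ℕ} {A : Matrix (Fin m) (Fin n) ℂ}

/-- Address of the entry `k` of the array `f`. -/
def ad (k f : ℕ) : ℕ := f + (64 + (k + k + (k + k) + (k + k + (k + k))))

theorem ad_eq_iff {k f k' f' : ℕ} (hf : f < 8) (hf' : f' < 8) :
    ad k f = ad k' f' ↔ k = k' ∧ f = f' := by unfold ad; omega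

theorem ad_eq_small {k f x : ℕ} (hx : x < 64) : (ad k f = x) = False := by
  rw [eq_iff_iff, iff_false]; unfold ad; omega

theorem small_eq_ad {k f x : ℕ} (hx : x < 64) : (x = ad k f) = False := by
  rw [eq_iff_iff, iff_false]; unfold ad; omega

theorem le_ad (k f : ℕ) : 64 ≤ ad k f := by unfold ad; omega

theorem Mem.setNat_nat (s : Mem) (d x a : ℕ) :
    (s.setNat d x).nat a = if a = d then x else s.nat a := Function.update_apply ..

theorem Mem.setNat_num (s : Mem) (d x : ℕ) : (s.setNat d x).num = s.num := rfl

theorem Mem.setNum_nat (s : Mem) (d : ℕ) (x : ℂ) : (s.setNum d x).nat = s.nat := rfl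

theorem Mem.setNum_num (s : Mem) (d : ℕ) (x : ℂ) (a : ℕ) :
    (s.setNum d x).num a = if a = d then x else s.num a := Function.update_apply ..

/-- Puts the address of the entry `nat kr` of the array `f` into the index cell `22`. -/
def ptr (kr f : ℕ) : List Instr :=
  [.natAdd 22 kr kr, .natAdd 22 22 22, .natAdd 22 22 22, .natConst 23 64, .natAdd 22 23 22,
    .natConst 23 f, .natAdd 22 23 22]

theorem effs_append (O : OSQ ε φ A) (s : Mem) (l l' : List Instr) :
    effs O s (l ++ l') = effs O (l.foldl (Instr.eff O) s) l' := by
  induction l generalizing s with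
  | nil => rfl
  | cons I l ih => exact ih _

def getNum (d kr f : ℕ) : List Instr := ptr kr f ++ [.numLoad d 22]
def getNat (d kr f : ℕ) : List Instr := ptr kr f ++ [.natLoad d 22]
def putNum (kr f a : ℕ) : List Instr := ptr kr f ++ [.numStore 22 a]
def putNat (kr f a : ℕ) : List Instr := ptr kr f ++ [.natStore 22 a]

theorem foldl_ptr (O : OSQ ε φ A) (s : Mem) (kr f : ℕ) :
    (ptr kr f).foldl (Instr.eff O) s = (s.setNat 23 f).setNat 22 (ad (s.nat kr) f) := by
  unfold ptr ad
  simp only [List.foldl, Instr.eff, Mem.setNat, Function.update_self]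
  congr 1
  funext a
  simp only [Function.update_apply]
  split_ifs <;> simp_all

theorem effs_getNum (O : OSQ ε φ A) (s : Mem) (d kr f : ℕ) (l : List Instr) :
    effs O s (getNum d kr f ++ l) =
      effs O (((s.setNat 23 f).setNat 22 (ad (s.nat kr) f)).setNum d (s.num (ad (s.nat kr) f))) l := by
  rw [effs_append, getNum, List.foldl_append, foldl_ptr]
  simp [Instr.eff, Mem.setNat]

theorem effs_getNat (O : OSQ ε φ A) (s : Mem) (d kr f : ℕ) (l : List Instr) :
    effs O s (getNat d kr f ++ l) =
      effs O (((s.setNat 23 f).setNat 22 (ad (s.nat kr) f)).setNat d (s.nat (ad (s.nat kr) f))) l := by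
  rw [effs_append, getNat, List.foldl_append, foldl_ptr]
  simp [Instr.eff, Mem.setNat_nat, ad_eq_small]

theorem effs_putNum (O : OSQ ε φ A) (s : Mem) (kr f a : ℕ) (l : List Instr) :
    effs O s (putNum kr f a ++ l) =
      effs O (((s.setNat 23 f).setNat 22 (ad (s.nat kr) f)).setNum (ad (s.nat kr) f) (s.num a)) l := by
  rw [effs_append, putNum, List.foldl_append, foldl_ptr]
  simp [Instr.eff, Mem.setNat]

/-- The address computation uses the index cells `22` and `23`, so the stored value must not live
there. -/
theorem effs_putNat (O : OSQ ε φ A) (s : Mem) (kr f a : ℕ) (ha : a ≠ 22) (ha' : a ≠ 23)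
    (l : List Instr) :
    effs O s (putNat kr f a ++ l) =
      effs O (((s.setNat 23 f).setNat 22 (ad (s.nat kr) f)).setNat (ad (s.nat kr) f) (s.nat a)) l := by
  rw [effs_append, putNat, List.foldl_append, foldl_ptr]
  simp [Instr.eff, Mem.setNat_nat, ha, ha']

theorem effs_cons (O : OSQ ε φ A) (s : Mem) (I : Instr) (l : List Instr) :
    effs O s (I :: l) = effs O (I.eff O s) l := rfl

theorem effs_nil (O : OSQ ε φ A) (s : Mem) : effs O s [] = s.setNat 63 0 := rfl

/-- Only scratch cells differ. -/
structure Frame (s s' : Mem) : Prop where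
  nat : ∀ a, a < 20 ∨ 64 ≤ a → s'.nat a = s.nat a
  num : ∀ a, a < 20 ∨ 64 ≤ a → s'.num a = s.num a

theorem Frame.refl (s : Mem) : Frame s s := ⟨fun _ _ => rfl, fun _ _ => rfl⟩

theorem Frame.trans {s s' s'' : Mem} (h : Frame s s') (h' : Frame s' s'') : Frame s s'' :=
  ⟨fun a ha => (h'.nat a ha).trans (h.nat a ha), fun a ha => (h'.num a ha).trans (h.num a ha)⟩

theorem Frame.setNat (s : Mem) {d : ℕ} (x : ℕ) (hd : 20 ≤ d ∧ d < 64) : Frame s (s.setNat d x) :=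
  ⟨fun a ha => by rw [Mem.setNat_nat, if_neg (by omega)], fun _ _ => rfl⟩

theorem Frame.setNum (s : Mem) {d : ℕ} (x : ℂ) (hd : 20 ≤ d ∧ d < 64) : Frame s (s.setNum d x) :=
  ⟨fun _ _ => rfl, fun a ha => by rw [Mem.setNum_num, if_neg (by omega)]⟩

/-- The instructions that write to a fixed scratch cell. -/
def Instr.isLocal : Instr → Bool
  | .natConst d _ | .natAdd d _ _ | .natSub d _ _ | .natLoad d _ | .numOfNat d _
  | .numAdd d _ _ | .numSub d _ _ | .numMul d _ _ | .numDiv d _ _ | .numConj d _ | .numSqrt d _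
  | .numLoad d _ | .queryEntry d _ _ | .queryBar d _ _ | .queryRowNorm d _ | .queryNorm d =>
    decide (20 ≤ d ∧ d < 64)
  | _ => false

theorem frame_effs (O : OSQ ε φ A) (s : Mem) (l : List Instr) (hl : l.all Instr.isLocal = true) :
    Frame s (effs O s l) := by
  induction l generalizing s with
  | nil => exact Frame.setNat s 0 (by omega)
  | cons I l ih =>
    rw [List.all_cons, Bool.and_eq_true] at hl
    refine Frame.trans ?_ (ih _ hl.2)
    have h := hl.1
    cases I <;> simp only [Instr.isLocal, decide_eq_true_eq, Bool.false_eq_true] at h <;>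
      first | exact Frame.setNat s _ h | exact Frame.setNum s _ h

attribute [simp] effs_getNum effs_getNat effs_putNum effs_putNat effs_cons effs_nil Instr.eff
  Mem.setNat_nat Mem.setNat_num Mem.setNum_nat Mem.setNum_num ad_eq_small small_eq_ad ad_eq_iff

/-! ### Choosing an index and a column -/

/-- Choice of the index `k` with probability proportional to `w k ^ 2`. -/
def pickBody : Prog :=
  .seq (block (getNum 24 20 2 ++ [.numMul 24 24 24, .numAdd 20 20 24, .numDiv 25 24 20]))
    (.seq (.instr (.flip 24 25))
      (block [.natConst 25 30, .natAdd 25 25 24, .natStore 25 20, .natAdd 20 20 5]))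

/-- Contribution of the index `k` to the density of the sampled column and to the linear
combination of the rows. -/
def densBody : Prog :=
  block (getNat 33 20 0 ++ ([.queryRowNorm 24 33, .queryBar 25 33 32, .queryEntry 26 33 32] ++
    (getNum 27 20 2 ++ (getNum 28 20 0 ++
    [.numConj 29 25, .numMul 25 25 29, .numMul 24 24 24, .numDiv 25 25 24, .numMul 29 27 27,
      .numMul 25 29 25, .numAdd 21 21 25, .numMul 27 27 28, .numMul 27 27 26, .numAdd 22 22 27,
      .natAdd 20 20 5]))))

/-- Sampling of a column from the rows mixed according to `w`. -/
def sampleProg : Prog :=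
  .seq (block [.natConst 20 0, .natConst 31 0, .numOfNat 20 20])
    (.seq (.loop (.natLt 20 4) pickBody)
      (.seq (block (getNat 33 31 0 ++ []))
        (.seq (.instr (.sampleCol 32 33))
          (.seq (block [.natConst 20 0, .numOfNat 21 20, .numOfNat 22 20])
            (.loop (.natLt 20 4) densBody)))))

/-- One step of the weighted choice. -/
def pickStep (w : ℕ → ℝ) (k pick : ℕ) : PMF ℕ :=
  (coin (w k ^ 2 / ∑ k' ∈ Finset.range (k + 1), w k' ^ 2)).map fun b => if b = 1 then k else pick

/-- Law of the index chosen among `0, …, S`. -/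
def pickLaw (S : ℕ) (w : ℕ → ℝ) : PMF ℕ := chain (pickStep w) 0 (S + 1) 0

/-- Law of the sampled column. -/
def colLaw (O : OSQ ε φ A) (S : ℕ) (r : ℕ → Fin m) (w : ℕ → ℝ) : PMF (Fin n) :=
  (pickLaw S w).bind fun k => O.colSampler (r k)

/-- Density of the sampled column, up to the factor `∑ w k ^ 2`. -/
def dens (O : OSQ ε φ A) (S : ℕ) (r : ℕ → Fin m) (w : ℕ → ℝ) (j : Fin n) : ℝ :=
  ∑ k ∈ Finset.range (S + 1), w k ^ 2 * (‖O.bar (r k) j‖ ^ 2 / rowNorms O.bar (r k) ^ 2)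

/-- Entry of a linear combination of scaled rows. -/
def comb (A : Matrix (Fin m) (Fin n) ℝ) (S : ℕ) (r : ℕ → Fin m) (α w : ℕ → ℝ) (j : Fin n) : ℝ :=
  ∑ k ∈ Finset.range (S + 1), w k * α k * A (r k) j

/-- The memory holds the sizes, the scaled rows and the coefficient vector `w`. -/
structure Holds (S : ℕ) (r : ℕ → Fin m) (α w : ℕ → ℝ) (s : Mem) : Prop where
  size : s.nat 4 = S + 1
  one : s.nat 5 = 1
  row : ∀ k ≤ S, s.nat (ad k 0) = r k
  scale : ∀ k ≤ S, s.num (ad k 0) = (α k : ℝ)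
  coeff : ∀ k ≤ S, s.num (ad k 2) = (w k : ℝ)

theorem Holds.frame {S : ℕ} {r : ℕ → Fin m} {α w : ℕ → ℝ} {s s' : Mem} (h : Holds S r α w s)
    (hf : Frame s s') : Holds S r α w s' where
  size := (hf.nat 4 (by omega)).trans h.size
  one := (hf.nat 5 (by omega)).trans h.one
  row k hk := (hf.nat _ (.inr (le_ad _ _))).trans (h.row k hk)
  scale k hk := (hf.num _ (.inr (le_ad _ _))).trans (h.scale k hk)
  coeff k hk := (hf.num _ (.inr (le_ad _ _))).trans (h.coeff k hk)

/-- State of the choice before step `k`. -/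
structure PickInv (S : ℕ) (w : ℕ → ℝ) (s₀ : Mem) (k pick : ℕ) (s : Mem) : Prop where
  frame : Frame s₀ s
  ctr : s.nat 20 = k
  cur : s.nat 31 = pick
  cur_le : pick ≤ S
  tot : s.num 20 = ((∑ k' ∈ Finset.range k, w k' ^ 2 : ℝ) : ℂ)

/-- Reservoir sampling without a branch: the coin `b` selects the target address `30 + b`, so the
current choice in cell `31` is replaced by `k` exactly when `b = 1`, and cell `30` is a dump. -/
theorem spec_pickBody (O : OSQ ε φ A) (τ S : ℕ) (r : ℕ → Fin m) (α w : ℕ → ℝ) (s₀ s : Mem)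
    (h₀ : Holds S r α w s₀) (k pick : ℕ) (hk : k < S + 1) (h : PickInv S w s₀ k pick s) :
    Spec O τ pickBody s (pickStep w k pick) (PickInv S w s₀ (k + 1)) 40 := by
  have hs := h₀.frame h.frame
  have hw := hs.coeff k (by omega)
  have h1 : Det O τ (block (getNum 24 20 2 ++ [.numMul 24 24 24, .numAdd 20 20 24, .numDiv 25 24 20]))
      s (fun s' => Frame s s' ∧ s'.nat 20 = k ∧ s'.nat 31 = pick ∧
        s'.num 20 = ((∑ k' ∈ Finset.range (k + 1), w k' ^ 2 : ℝ) : ℂ) ∧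
        s'.num 25 = ((w k ^ 2 / ∑ k' ∈ Finset.range (k + 1), w k' ^ 2 : ℝ) : ℂ)) 23 := by
    refine Det.block O τ _ rfl s ⟨frame_effs O s _ rfl, ?_⟩
    simp [h.ctr, h.cur, hw, h.tot, Finset.sum_range_succ]
    ring_nf
    simp
  refine (h1.seq_spec (t₂ := 11) fun s1 ⟨f1, a1, a2, a3, a4⟩ => ?_).conseq (fun _ _ h => h) (by omega)
  have hflip := Spec.flip O τ 24 25 s1
  rw [a4, Complex.ofReal_re] at hflip
  refine ((hflip.seq_det (t₂ := 9) (Q' := fun b s' => PickInv S w s₀ (k + 1)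
    (if b = 1 then k else pick) s') ?_).map _ fun _ _ h => h).conseq (fun _ _ h => h) (by omega)
  rintro b s2 ⟨hb, rfl⟩
  have h5 := hs.one
  have h51 : s1.nat 5 = 1 := (f1.nat 5 (by omega)).trans h5
  refine Det.block O τ _ rfl _ ?_
  have hb' : b = 0 ∨ b = 1 := by omega
  refine ⟨(h.frame.trans f1).trans ⟨?_, ?_⟩, ?_, ?_, ?_, ?_⟩
  · intro a ha
    rcases hb' with rfl | rfl <;>
    simp [a1] <;> grind
  · intro a ha
    rcases hb' with rfl | rfl <;>
    simp
  · rcases hb' with rfl | rfl <;>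
    simp [a1, h51]
  · rcases hb' with rfl | rfl <;>
    simp [a1, a2]
  · have := h.cur_le
    split <;> omega
  · simpa using a3

end Layout

end RecSys

end

noncomputable section

namespace RecSys

/-! ### Drawing a column from a mixture of rows, and rounding -/

section Sampling

variable {ε φ : ℝ} {m n : ℕ} {A : Matrix (Fin m) (Fin n) ℝ}

theorem entry_coe (M : Matrix (Fin m) (Fin n) ℂ) (i : Fin m) (j : Fin n) : entry M i j = M i j := by
  simp [entry]

theorem entry_map (i : Fin m) (j : Fin n) :
    entry (A.map ((↑) : ℝ → ℂ)) i j = ((A i j : ℝ) : ℂ) := by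
  simp [entry]

/-- State of the evaluation of the density before index `k`. -/
structure DensInv (O : OSQ ε φ (A.map ((↑) : ℝ → ℂ))) (r : ℕ → Fin m) (α w : ℕ → ℝ)
    (j : Fin n) (s₀ : Mem) (k : ℕ) (s : Mem) : Prop where
  frame : Frame s₀ s
  ctr : s.nat 20 = k
  col : s.nat 32 = j
  tot : s.num 20 = s₀.num 20
  dens : s.num 21 = ((∑ k' ∈ Finset.range k,
    w k' ^ 2 * (‖O.bar (r k') j‖ ^ 2 / rowNorms O.bar (r k') ^ 2) : ℝ) : ℂ)
  comb : s.num 22 = ((∑ k' ∈ Finset.range k, w k' * α k' * A (r k') j : ℝ) : ℂ)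

theorem det_densBody (O : OSQ ε φ (A.map ((↑) : ℝ → ℂ))) (τ S : ℕ) (r : ℕ → Fin m) (α w : ℕ → ℝ)
    (j : Fin n) (s₀ s : Mem) (h₀ : Holds S r α w s₀) (k : ℕ) (hk : k < S + 1)
    (h : DensInv O r α w j s₀ k s) :
    Det O τ densBody s (DensInv O r α w j s₀ (k + 1)) 80 := by
  have hs := h₀.frame h.frame
  have hw := hs.coeff k (by omega)
  have hα := hs.scale k (by omega)
  have hr := hs.row k (by omega)
  have hone := hs.one
  -- `bar` is complex, and its squared modulus is available only as a product with the conjugate.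
  have hb : O.bar (r k) j * (starRingEnd ℂ) (O.bar (r k) j) = ((‖O.bar (r k) j‖ ^ 2 : ℝ) : ℂ) := by
    rw [RCLike.mul_conj]; simp
  refine (Det.block O τ _ rfl s ⟨h.frame.trans (frame_effs O s _ rfl), ?_, ?_, ?_, ?_, ?_⟩).conseq
    (fun _ h => h) (t' := 80) (by simp [getNum, getNat, ptr])
  · simp [h.ctr, hone]
  · simp [h.ctr, h.col]
  · simp [h.tot]
  · simp [h.ctr, hr, h.col, hw, h.dens, entry_coe, hb, Finset.sum_range_succ]
    ring
  · simp [h.ctr, hr, h.col, hw, hα, h.comb, entry_map, Finset.sum_range_succ]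

/-- Outcome of `sampleProg` when the column `j` is sampled. -/
structure Sampled (O : OSQ ε φ (A.map ((↑) : ℝ → ℂ))) (S : ℕ) (r : ℕ → Fin m) (α w : ℕ → ℝ)
    (s₀ : Mem) (j : Fin n) (s : Mem) : Prop where
  frame : Frame s₀ s
  col : s.nat 32 = j
  tot : s.num 20 = ((∑ k ∈ Finset.range (S + 1), w k ^ 2 : ℝ) : ℂ)
  dens : s.num 21 = (dens O S r w j : ℝ)
  comb : s.num 22 = (comb A S r α w j : ℝ)

/-- One pass over the rows selects `k`, one column is drawn from the row `r k`, and a second pass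
evaluates at that column the density of the whole mixture, not just of the selected row, together
with the entry of the linear combination. Importance weights and acceptance probabilities both need
the mixture density. -/
theorem spec_sampleProg (O : OSQ ε φ (A.map ((↑) : ℝ → ℂ))) (τ S : ℕ) (r : ℕ → Fin m)
    (α w : ℕ → ℝ) (s : Mem) (h : Holds S r α w s) :
    Spec O τ sampleProg s (colLaw O S r w) (Sampled O S r α w s) (200 * (S + 1)) := by
  have h1 : Det O τ (block [.natConst 20 0, .natConst 31 0, .numOfNat 20 20]) s
      (PickInv S w s 0 0) 7 := by
    refine Det.block O τ _ rfl s ⟨frame_effs O s _ rfl, ?_, ?_, Nat.zero_le _, ?_⟩ <;>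
    simp
  have h2 : ∀ s', PickInv S w s 0 0 s' → Spec O τ (.loop (.natLt 20 4) pickBody) s'
      (pickLaw S w) (PickInv S w s (S + 1)) ((S + 1) * 41 + 1) := by
    intro s' hs'
    refine Spec.loop (b := .natLt 20 4) (N := S + 1) (t := 40) ?_ ?_ ?_ (S + 1) 0 (by omega) 0 s' hs'
    · intro k pick s1 hk h1
      simp only [Test.Holds, h1.ctr, (h.frame h1.frame).size]; exact hk
    · intro k pick s1 hk h1
      exact spec_pickBody O τ S r α w s s1 h k pick hk h1
    · intro pick s1 h1
      simp [Test.Holds, h1.ctr, (h.frame h1.frame).size]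
  have h3 : ∀ pick s', PickInv S w s (S + 1) pick s' → Spec O τ
      (.seq (block (getNat 33 31 0 ++ []))
        (.seq (.instr (.sampleCol 32 33))
          (.seq (block [.natConst 20 0, .numOfNat 21 20, .numOfNat 22 20])
            (.loop (.natLt 20 4) densBody)))) s' (O.colSampler (r pick)) (Sampled O S r α w s)
      (17 + (1 + (7 + ((S + 1) * 81 + 1) + 1) + 1) + 1) := by
    intro pick s' hs'
    have d1 : Det O τ (block (getNat 33 31 0 ++ [])) s' (fun s1 => Frame s s1 ∧
        s1.nat 33 = r pick ∧ s1.num 20 = s'.num 20) 17 := by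
      refine Det.block O τ _ rfl s' ⟨hs'.frame.trans (frame_effs O s' _ rfl), ?_, ?_⟩
      · rw [effs_getNat]
        simp [hs'.cur, (h.frame hs'.frame).row pick hs'.cur_le]
      · rw [effs_getNat]
        simp
    refine d1.seq_spec fun s1 ⟨f1, a1, a2⟩ => ?_
    refine (Spec.sampleCol O τ 32 33 s1 (r pick) a1).seq_det fun j s2 hs2 => ?_
    have f2 : Frame s s2 := f1.trans (hs2 ▸ Frame.setNat s1 _ (by omega))
    have d2 : Det O τ (block [.natConst 20 0, .numOfNat 21 20, .numOfNat 22 20]) s2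
        (DensInv O r α w j s2 0) 7 := by
      refine Det.block O τ _ rfl s2 ⟨frame_effs O s2 _ rfl, ?_, ?_, ?_, ?_, ?_⟩ <;>
      simp [hs2]
    refine d2.seq fun s3 hs3 => ?_
    refine (Det.loop (b := .natLt 20 4) (N := S + 1) (t := 80) (R := DensInv O r α w j s2)
      ?_ ?_ ?_ s3 hs3).conseq ?_ le_rfl
    · intro k s4 hk h4
      simp only [Test.Holds, h4.ctr, ((h.frame f2).frame h4.frame).size]; exact hk
    · intro k s4 hk h4
      exact det_densBody O τ S r α w j s2 s4 (h.frame f2) k hk h4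
    · intro s4 h4
      simp [Test.Holds, h4.ctr, ((h.frame f2).frame h4.frame).size]
    · intro s4 h4
      refine ⟨f2.trans h4.frame, h4.col, ?_, h4.dens, h4.comb⟩
      rw [h4.tot, hs2, Mem.setNat_num, a2, hs'.tot]
  exact (h1.seq_spec fun s' hs' => (h2 s' hs').seq h3).conseq (fun _ _ h => h) (by omega)

/-! ### Rounding -/

/-- Puts the integer part plus one of the real scalar in cell `20` into the index cell `20`. -/
def ceilProg : Prog :=
  .seq (block [.natConst 20 0, .numOfNat 21 20])
    (.loop (.numLe 21 20) (block [.natAdd 20 20 5, .numOfNat 21 20]))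

/-- Rounding counts upwards in unit steps. This is affordable because it is applied only to numbers
of size about `S` and `S²`. -/
theorem det_ceilProg {A : Matrix (Fin m) (Fin n) ℂ} (O : OSQ ε φ A) (τ : ℕ) (s : Mem) (x : ℝ)
    (hx : 0 ≤ x) (h20 : s.num 20 = x) (h5 : s.nat 5 = 1) :
    Det O τ ceilProg s (fun s' => Frame s s' ∧ s'.nat 20 = ⌊x⌋₊ + 1) (7 * (⌊x⌋₊ + 1) + 7) := by
  have h1 : Det O τ (block [.natConst 20 0, .numOfNat 21 20]) s (fun s' => Frame s s' ∧
      s'.nat 20 = 0 ∧ s'.num 21 = ((0 : ℕ) : ℂ) ∧ s'.num 20 = x) 5 := by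
    refine Det.block O τ _ rfl s ⟨frame_effs O s _ rfl, ?_⟩
    simp [h20]
  refine (h1.seq (t₂ := (⌊x⌋₊ + 1) * (5 + 1) + 1) fun s1 hs1 => ?_).conseq (fun _ h => h) (by omega)
  refine (Det.loop (b := .numLe 21 20) (N := ⌊x⌋₊ + 1) (t := 5)
    (R := fun k s' => Frame s s' ∧ s'.nat 20 = k ∧ s'.num 21 = (k : ℂ) ∧ s'.num 20 = x)
    ?_ ?_ ?_ s1 hs1).conseq (fun s' h => ⟨h.1, h.2.1⟩) le_rfl
  · rintro k s2 hk ⟨-, -, a2, a3⟩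
    simp only [Test.Holds, a2, a3, Complex.natCast_re, Complex.ofReal_re]
    exact (Nat.le_floor_iff hx).1 (by omega)
  · rintro k s2 hk ⟨f2, a1, a2, a3⟩
    have h52 : s2.nat 5 = 1 := (f2.nat 5 (by omega)).trans h5
    refine Det.block O τ _ rfl s2 ⟨f2.trans (frame_effs O s2 _ rfl), ?_⟩
    simp [a1, a3, h52]
  · rintro s2 ⟨-, -, a2, a3⟩
    simp only [Test.Holds, a2, a3, Complex.natCast_re, Complex.ofReal_re, not_le]
    exact_mod_cast Nat.lt_floor_add_one x

end Sampling

end RecSys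

end

noncomputable section

namespace RecSys

/-! ### Preserved memory, and products with the sketched Gram matrix -/

section Horner

variable {ε φ : ℝ} {m n : ℕ} {A : Matrix (Fin m) (Fin n) ℝ}

/-- Only scratch cells and the scalar arrays in `F` differ. -/
structure Mod (F : List ℕ) (s s' : Mem) : Prop where
  nat : ∀ a, a < 20 ∨ 64 ≤ a → s'.nat a = s.nat a
  num : ∀ a, a < 20 → s'.num a = s.num a
  arr : ∀ k f, f < 8 → f ∉ F → s'.num (ad k f) = s.num (ad k f)

theorem Frame.mod {s s' : Mem} (h : Frame s s') (F : List ℕ) : Mod F s s' :=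
  ⟨h.nat, fun a ha => h.num a (.inl ha), fun _ _ _ _ => h.num _ (.inr (le_ad _ _))⟩

theorem Mod.refl (F : List ℕ) (s : Mem) : Mod F s s := (Frame.refl s).mod F

theorem Mod.trans {F : List ℕ} {s s' s'' : Mem} (h : Mod F s s') (h' : Mod F s' s'') :
    Mod F s s'' :=
  ⟨fun a ha => (h'.nat a ha).trans (h.nat a ha), fun a ha => (h'.num a ha).trans (h.num a ha),
    fun k f hf hF => (h'.arr k f hf hF).trans (h.arr k f hf hF)⟩

theorem Mod.mono {F F' : List ℕ} {s s' : Mem} (h : Mod F s s') (hF : F ⊆ F') : Mod F' s s' :=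
  ⟨h.nat, h.num, fun k f hf hf' => h.arr k f hf fun h => hf' (hF h)⟩

theorem Mod.effs_local {A : Matrix (Fin m) (Fin n) ℂ} (O : OSQ ε φ A) {F : List ℕ} {s₀ s : Mem}
    {l l' : List Instr} (h : Mod F s₀ s) (hl : l.all Instr.isLocal = true)
    (h' : ∀ s', Mod F s₀ s' → Mod F s₀ (effs O s' l')) : Mod F s₀ (effs O s (l ++ l')) := by
  induction l generalizing s with
  | nil => exact h' s h
  | cons I l ih =>
    rw [List.all_cons, Bool.and_eq_true] at hl
    refine ih (h.trans (Frame.mod ?_ F)) hl.2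
    have h := hl.1
    cases I <;> simp only [Instr.isLocal, decide_eq_true_eq, Bool.false_eq_true] at h <;>
      first | exact Frame.setNat s _ h | exact Frame.setNum s _ h

theorem Mod.effs_put {A : Matrix (Fin m) (Fin n) ℂ} (O : OSQ ε φ A) {F : List ℕ} {s₀ s : Mem}
    {l' : List Instr} (h : Mod F s₀ s) (kr f a : ℕ) (hf : f < 8) (hF : f ∈ F)
    (h' : ∀ s', Mod F s₀ s' → Mod F s₀ (effs O s' l')) :
    Mod F s₀ (effs O s (putNum kr f a ++ l')) := by
  rw [effs_putNum]
  refine h' _ (h.trans (Mod.trans (((Frame.setNat s f (d := 23) (by omega)).trans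
    (Frame.setNat _ _ (d := 22) (by omega))).mod F) ⟨fun _ _ => rfl, fun a ha => ?_, ?_⟩))
  · rw [Mem.setNum_num, if_neg]
    have := le_ad (s.nat kr) f
    omega
  · intro k f' hf' hF'
    rw [Mem.setNum_num, if_neg]
    rw [ad_eq_iff hf' hf]
    rintro ⟨-, rfl⟩
    exact hF' hF

theorem Mod.effs_end {A : Matrix (Fin m) (Fin n) ℂ} (O : OSQ ε φ A) {F : List ℕ} {s₀ s : Mem}
    {l : List Instr} (h : Mod F s₀ s) (hl : l.all Instr.isLocal = true) :
    Mod F s₀ (effs O s l) := h.trans ((frame_effs O s l hl).mod F)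

/-- Values of the constant cells. -/
structure Consts (i S N : ℕ) (σ ξ b : ℝ) (s : Mem) : Prop where
  idx : s.nat 2 = i
  cols : s.nat 3 = S
  size : s.nat 4 = S + 1
  one : s.nat 5 = 1
  trials : s.nat 8 = N
  sig : s.num 0 = σ
  xi : s.num 2 = ξ
  nrm : s.num 5 = b
  sizeR : s.num 6 = S
  bound : s.num 7 = ((2 * b ^ 2 : ℝ) : ℂ)
  root : s.num 8 = (√S : ℝ)
  zero : s.num 9 = 0

/-- The index cells `0` and `1` are left out on purpose: the rejection loop overwrites them. -/
theorem Consts.low {i S N : ℕ} {σ ξ b : ℝ} {s s' : Mem} (h : Consts i S N σ ξ b s)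
    (hn : ∀ a, 2 ≤ a → a < 10 → s'.nat a = s.nat a) (hx : ∀ a < 10, s'.num a = s.num a) :
    Consts i S N σ ξ b s' := by
  obtain ⟨h1, h2, h3, h4, h5, h6, h7, h8, h9, h10, h11, h12⟩ := h
  constructor <;> first
    | (rw [hn _ (by omega) (by omega)]; assumption) | (rw [hx _ (by omega)]; assumption)

theorem Consts.mod {i S N : ℕ} {σ ξ b : ℝ} {F : List ℕ} {s s' : Mem} (h : Consts i S N σ ξ b s)
    (hm : Mod F s s') : Consts i S N σ ξ b s' :=
  h.low (fun a _ ha => hm.nat a (by omega)) fun a ha => hm.num a (by omega)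

/-- The memory holds the sampled rows with their scales and the sampled columns with their
weights. -/
structure Sketch (S : ℕ) (r : ℕ → Fin m) (α : ℕ → ℝ) (c : ℕ → Fin n) (β : ℕ → ℝ) (s : Mem) :
    Prop where
  row : ∀ k ≤ S, s.nat (ad k 0) = r k
  scale : ∀ k ≤ S, s.num (ad k 0) = (α k : ℝ)
  col : ∀ l < S, s.nat (ad l 1) = c l
  weight : ∀ l < S, s.num (ad l 5) = (β l : ℝ)

theorem Sketch.mod {S : ℕ} {r : ℕ → Fin m} {α : ℕ → ℝ} {c : ℕ → Fin n} {β : ℕ → ℝ} {F : List ℕ}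
    {s s' : Mem} (h : Sketch S r α c β s) (hm : Mod F s s') (h0 : 0 ∉ F) (h5 : 5 ∉ F) :
    Sketch S r α c β s' where
  row k hk := (hm.nat _ (.inr (le_ad _ _))).trans (h.row k hk)
  scale k hk := (hm.arr _ _ (by omega) h0).trans (h.scale k hk)
  col l hl := (hm.nat _ (.inr (le_ad _ _))).trans (h.col l hl)
  weight l hl := (hm.arr _ _ (by omega) h5).trans (h.weight l hl)

/-- The array `f` holds the vector `v`. -/
def Arr (S f : ℕ) (v : ℕ → ℝ) (s : Mem) : Prop := ∀ k ≤ S, s.num (ad k f) = (v k : ℝ)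

theorem Arr.mod {S f : ℕ} {v : ℕ → ℝ} {F : List ℕ} {s s' : Mem} (h : Arr S f v s) (hm : Mod F s s')
    (hf : f < 8) (hF : f ∉ F) : Arr S f v s' :=
  fun k hk => (hm.arr _ _ hf hF).trans (h k hk)

/-! ### Application of the sketched Gram matrix -/

def gatherBody : Prog :=
  block (getNat 33 20 0 ++ ([.queryEntry 24 33 32] ++ (getNum 25 20 0 ++ ([.numMul 24 25 24] ++
    (getNum 25 20 1 ++ (getNum 26 20 2 ++
    [.numMul 25 24 25, .numMul 26 24 26, .numAdd 20 20 25, .numAdd 21 21 26, .natAdd 20 20 5]))))))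

def scatterBody : Prog :=
  block ((getNat 33 20 0 ++ ([.queryEntry 24 33 32] ++ (getNum 25 20 0 ++ ([.numMul 24 25 24] ++
    (getNum 25 20 3 ++ ([.numMul 26 24 20, .numAdd 25 25 26] ++ (getNum 27 20 4 ++
    [.numMul 26 24 21, .numAdd 27 27 26]))))))) ++ (putNum 20 3 25 ++ (putNum 20 4 27 ++
      [.natAdd 20 20 5])))

def columnBody : Prog :=
  .seq (block (getNat 32 10 1 ++ [.numAdd 20 9 9, .numAdd 21 9 9, .natConst 20 0]))
    (.seq (.loop (.natLt 20 4) gatherBody)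
      (.seq (block (getNum 24 10 5 ++ [.numMul 20 20 24, .numMul 21 21 24, .natConst 20 0]))
        (.seq (.loop (.natLt 20 4) scatterBody) (block [.natAdd 10 10 5]))))

/-- Inner product of a vector with a column of the scaled rows. -/
def gather (A : Matrix (Fin m) (Fin n) ℝ) (r : ℕ → Fin m) (α : ℕ → ℝ) (j : Fin n) (u : ℕ → ℝ)
    (K : ℕ) : ℝ := ∑ k ∈ Finset.range K, α k * A (r k) j * u k

/-- The first `L` terms of the product of the sketched Gram matrix with a vector. -/
def gram (A : Matrix (Fin m) (Fin n) ℝ) (S : ℕ) (r : ℕ → Fin m) (α : ℕ → ℝ) (c : ℕ → Fin n)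
    (β : ℕ → ℝ) (L : ℕ) (u : ℕ → ℝ) (k : ℕ) : ℝ :=
  ∑ l ∈ Finset.range L, α k * A (r k) (c l) * (gather A r α (c l) u (S + 1) * β l)

variable {i S N : ℕ} {σ ξ b : ℝ} {r : ℕ → Fin m} {α : ℕ → ℝ} {c : ℕ → Fin n} {β : ℕ → ℝ}

theorem det_gatherBody (O : OSQ ε φ (A.map ((↑) : ℝ → ℂ))) (τ : ℕ) (s₀ s : Mem) (u w : ℕ → ℝ)
    (j : Fin n) (k : ℕ) (hk : k < S + 1) (hc : Consts i S N σ ξ b s₀) (hs : Sketch S r α c β s₀)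
    (hu : Arr S 1 u s₀) (hw : Arr S 2 w s₀)
    (h : Frame s₀ s ∧ s.nat 20 = k ∧ s.nat 32 = j ∧ s.num 20 = (gather A r α j u k : ℝ) ∧
      s.num 21 = (gather A r α j w k : ℝ)) :
    Det O τ gatherBody s (fun s => Frame s₀ s ∧ s.nat 20 = k + 1 ∧ s.nat 32 = j ∧
      s.num 20 = (gather A r α j u (k + 1) : ℝ) ∧ s.num 21 = (gather A r α j w (k + 1) : ℝ)) 80 := by
  obtain ⟨hf, h1, h2, h3, h4⟩ := h
  have hm := hf.mod []
  have hr := (hs.mod hm (by simp) (by simp)).row k (by omega)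
  have hα := (hs.mod hm (by simp) (by simp)).scale k (by omega)
  have hu' := hu.mod hm (by omega) (by simp) k (by omega)
  have hw' := hw.mod hm (by omega) (by simp) k (by omega)
  have hone := (hc.mod hm).one
  refine (Det.block O τ _ rfl s ⟨hf.trans (frame_effs O s _ rfl), ?_, ?_, ?_, ?_⟩).conseq
    (fun _ h => h) (t' := 80) (by simp [getNum, getNat, ptr])
  · simp [h1, hone]
  · simp [h1, h2]
  · simp [h1, hr, hα, hu', h2, h3, entry_map, gather, Finset.sum_range_succ]
  · simp [h1, hr, hα, hw', h2, h4, entry_map, gather, Finset.sum_range_succ]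

theorem det_scatterBody (O : OSQ ε φ (A.map ((↑) : ℝ → ℂ))) (τ : ℕ) (s₀ s : Mem) (y y' : ℕ → ℝ)
    (p q : ℝ) (j : Fin n) (k : ℕ) (hk : k < S + 1) (hc : Consts i S N σ ξ b s₀)
    (hs : Sketch S r α c β s₀) (hy : Arr S 3 y s₀) (hy' : Arr S 4 y' s₀)
    (h : Mod [3, 4] s₀ s ∧ s.nat 20 = k ∧ s.nat 32 = j ∧ s.num 20 = p ∧ s.num 21 = q ∧
      (∀ k' < k, s.num (ad k' 3) = (y k' + α k' * A (r k') j * p : ℝ) ∧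
        s.num (ad k' 4) = (y' k' + α k' * A (r k') j * q : ℝ)) ∧
      ∀ k' ≥ k, s.num (ad k' 3) = s₀.num (ad k' 3) ∧ s.num (ad k' 4) = s₀.num (ad k' 4)) :
    Det O τ scatterBody s (fun s => Mod [3, 4] s₀ s ∧ s.nat 20 = k + 1 ∧ s.nat 32 = j ∧
      s.num 20 = p ∧ s.num 21 = q ∧
      (∀ k' < k + 1, s.num (ad k' 3) = (y k' + α k' * A (r k') j * p : ℝ) ∧
        s.num (ad k' 4) = (y' k' + α k' * A (r k') j * q : ℝ)) ∧
      ∀ k' ≥ k + 1, s.num (ad k' 3) = s₀.num (ad k' 3) ∧ s.num (ad k' 4) = s₀.num (ad k' 4))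
      112 := by
  obtain ⟨hm, h1, h2, h3, h4, h5, h6⟩ := h
  have hr := (hs.mod hm (by simp) (by simp)).row k (by omega)
  have hα := (hs.mod hm (by simp) (by simp)).scale k (by omega)
  have hy1 := (h6 k le_rfl).1.trans (hy k (by omega))
  have hy2 := (h6 k le_rfl).2.trans (hy' k (by omega))
  have hone := (hc.mod hm).one
  refine (Det.block O τ _ rfl s ⟨?_, ?_, ?_, ?_, ?_, ?_, ?_⟩).conseq
    (fun _ h => h) (t' := 112) (by simp [getNum, getNat, putNum, ptr])
  · exact hm.effs_local O rfl fun _ h => h.effs_put O _ _ _ (by omega) (by simp) fun _ h =>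
      h.effs_put O _ _ _ (by omega) (by simp) fun _ h => h.effs_end O rfl
  · simp [h1, hone]
  · simp [h1, h2]
  · simp [h3]
  · simp [h4]
  · intro k' hk'
    rcases eq_or_ne k' k with rfl | hne
    · simp [h1, hr, hα, hy1, hy2, h2, h3, h4, entry_map]
    · simpa [h1, hne] using h5 k' (by omega)
  · intro k' hk'
    have hne : k' ≠ k := by omega
    simpa [h1, hne] using h6 k' (by omega)

/-- `FFᵀu` is a sum of rank-one terms over the sampled columns, so one column is handled by an inner
product followed by an update, in time `O(S)`. `F` is never stored, and the square roots of the
weights are never needed. Two vectors `u`, `w` share the pass because the recursion multiplies two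
vectors by the matrix in each step. -/
theorem det_columnBody (O : OSQ ε φ (A.map ((↑) : ℝ → ℂ))) (τ : ℕ) (s : Mem) (u w : ℕ → ℝ)
    (l : ℕ) (hl : l < S) (hc : Consts i S N σ ξ b s) (hs : Sketch S r α c β s)
    (hu : Arr S 1 u s) (hw : Arr S 2 w s) (h3 : Arr S 3 (gram A S r α c β l u) s)
    (h4 : Arr S 4 (gram A S r α c β l w) s) (hctr : s.nat 10 = l) :
    Det O τ columnBody s (fun s' => (∀ a, a ≠ 10 → a < 20 ∨ 64 ≤ a → s'.nat a = s.nat a) ∧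
      (∀ a < 20, s'.num a = s.num a) ∧
      (∀ k f, f < 8 → f ∉ [3, 4] → s'.num (ad k f) = s.num (ad k f)) ∧ s'.nat 10 = l + 1 ∧
      Arr S 3 (gram A S r α c β (l + 1) u) s' ∧ Arr S 4 (gram A S r α c β (l + 1) w) s')
      (300 * (S + 1)) := by
  have hcol := hs.col l hl
  have hwt := hs.weight l hl
  have d1 : Det O τ (block (getNat 32 10 1 ++ [.numAdd 20 9 9, .numAdd 21 9 9, .natConst 20 0])) s
      (fun s' => Frame s s' ∧ s'.nat 20 = 0 ∧ s'.nat 32 = c l ∧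
        s'.num 20 = (gather A r α (c l) u 0 : ℝ) ∧ s'.num 21 = (gather A r α (c l) w 0 : ℝ)) 23 := by
    refine Det.block O τ _ rfl s ⟨frame_effs O s _ rfl, ?_⟩
    simp [hctr, hcol, hc.zero, gather]
  have d2 : ∀ s', (Frame s s' ∧ s'.nat 20 = 0 ∧ s'.nat 32 = c l ∧
        s'.num 20 = (gather A r α (c l) u 0 : ℝ) ∧ s'.num 21 = (gather A r α (c l) w 0 : ℝ)) →
      Det O τ (.loop (.natLt 20 4) gatherBody) s' (fun s' => Frame s s' ∧ s'.nat 20 = S + 1 ∧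
        s'.nat 32 = c l ∧ s'.num 20 = (gather A r α (c l) u (S + 1) : ℝ) ∧
        s'.num 21 = (gather A r α (c l) w (S + 1) : ℝ)) ((S + 1) * 81 + 1) := by
    intro s' h'
    refine Det.loop (b := .natLt 20 4) (N := S + 1) (t := 80) (R := fun k s' => Frame s s' ∧
      s'.nat 20 = k ∧ s'.nat 32 = c l ∧ s'.num 20 = (gather A r α (c l) u k : ℝ) ∧
        s'.num 21 = (gather A r α (c l) w k : ℝ)) ?_ ?_ ?_ s' h'
    · rintro k s1 hk ⟨f1, a1, -⟩
      simpa only [Test.Holds, a1, (hc.mod (f1.mod [])).size] using hk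
    · rintro k s1 hk h1
      exact det_gatherBody O τ s s1 u w (c l) k hk hc hs hu hw h1
    · rintro s1 ⟨f1, a1, -⟩
      simp [Test.Holds, a1, (hc.mod (f1.mod [])).size]
  have d3 : ∀ s', (Frame s s' ∧ s'.nat 20 = S + 1 ∧ s'.nat 32 = c l ∧
        s'.num 20 = (gather A r α (c l) u (S + 1) : ℝ) ∧
        s'.num 21 = (gather A r α (c l) w (S + 1) : ℝ)) →
      Det O τ (block (getNum 24 10 5 ++ [.numMul 20 20 24, .numMul 21 21 24, .natConst 20 0])) s'
        (fun s' => Frame s s' ∧ s'.nat 20 = 0 ∧ s'.nat 32 = c l ∧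
          s'.num 20 = (gather A r α (c l) u (S + 1) * β l : ℝ) ∧
          s'.num 21 = (gather A r α (c l) w (S + 1) * β l : ℝ)) 23 := by
    rintro s' ⟨f, a1, a2, a3, a4⟩
    have e1 : s'.nat 10 = l := (f.nat 10 (by omega)).trans hctr
    have e2 : s'.num (ad l 5) = β l := (hs.mod (f.mod []) (by simp) (by simp)).weight l hl
    refine Det.block O τ _ rfl s' ⟨f.trans (frame_effs O s' _ rfl), ?_⟩
    simp [e1, e2, a2, a3, a4]
  have d4 : ∀ s', (Frame s s' ∧ s'.nat 20 = 0 ∧ s'.nat 32 = c l ∧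
          s'.num 20 = (gather A r α (c l) u (S + 1) * β l : ℝ) ∧
          s'.num 21 = (gather A r α (c l) w (S + 1) * β l : ℝ)) →
      Det O τ (.loop (.natLt 20 4) scatterBody) s' (fun s' => Mod [3, 4] s s' ∧
        Arr S 3 (gram A S r α c β (l + 1) u) s' ∧ Arr S 4 (gram A S r α c β (l + 1) w) s')
        ((S + 1) * 113 + 1) := by
    rintro s' ⟨f, a1, a2, a3, a4⟩
    refine (Det.loop (b := .natLt 20 4) (N := S + 1) (t := 112) (R := fun k t => Mod [3, 4] s t ∧
      t.nat 20 = k ∧ t.nat 32 = c l ∧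
      t.num 20 = (gather A r α (c l) u (S + 1) * β l : ℝ) ∧
      t.num 21 = (gather A r α (c l) w (S + 1) * β l : ℝ) ∧
      (∀ k' < k, t.num (ad k' 3) = (gram A S r α c β l u k' +
        α k' * A (r k') (c l) * (gather A r α (c l) u (S + 1) * β l) : ℝ) ∧
        t.num (ad k' 4) = (gram A S r α c β l w k' +
        α k' * A (r k') (c l) * (gather A r α (c l) w (S + 1) * β l) : ℝ)) ∧
      ∀ k' ≥ k, t.num (ad k' 3) = s.num (ad k' 3) ∧ t.num (ad k' 4) = s.num (ad k' 4))
      ?_ ?_ ?_ s' ?_).conseq ?_ le_rfl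
    · rintro k s1 hk ⟨f1, a1, -⟩
      simpa only [Test.Holds, a1, (hc.mod f1).size] using hk
    · rintro k s1 hk h1
      exact det_scatterBody O τ s s1 _ _ _ _ (c l) k hk hc hs h3 h4 h1
    · rintro s1 ⟨f1, a1, -⟩
      simp [Test.Holds, a1, (hc.mod f1).size]
    · refine ⟨f.mod _, a1, a2, a3, a4, fun k' hk' => absurd hk' (Nat.not_lt_zero _), fun k' _ => ?_⟩
      exact ⟨f.num _ (.inr (le_ad _ _)), f.num _ (.inr (le_ad _ _))⟩
    · rintro s1 ⟨f1, -, -, -, -, b5, -⟩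
      refine ⟨f1, fun k hk => ?_, fun k hk => ?_⟩
      · rw [(b5 k (by omega)).1, gram, gram, Finset.sum_range_succ]
      · rw [(b5 k (by omega)).2, gram, gram, Finset.sum_range_succ]
  have d5 : ∀ s', (Mod [3, 4] s s' ∧
        Arr S 3 (gram A S r α c β (l + 1) u) s' ∧ Arr S 4 (gram A S r α c β (l + 1) w) s') →
      Det O τ (block [.natAdd 10 10 5]) s' (fun s' =>
        (∀ a, a ≠ 10 → a < 20 ∨ 64 ≤ a → s'.nat a = s.nat a) ∧ (∀ a < 20, s'.num a = s.num a) ∧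
        (∀ k f, f < 8 → f ∉ [3, 4] → s'.num (ad k f) = s.num (ad k f)) ∧ s'.nat 10 = l + 1 ∧
        Arr S 3 (gram A S r α c β (l + 1) u) s' ∧ Arr S 4 (gram A S r α c β (l + 1) w) s') 3 := by
    rintro s' ⟨f, a1, a2⟩
    have e1 : s'.nat 10 = l := (f.nat 10 (by omega)).trans hctr
    have hone := (hc.mod f).one
    refine Det.block O τ _ rfl s' ⟨?_, ?_, ?_, ?_, ?_, ?_⟩
    · intro a ha ha'
      have : a ≠ 63 := by omega
      simpa [ha, this] using f.nat a ha'
    · simpa using f.num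
    · simpa using f.arr
    · simp [e1, hone]
    · intro k hk; simpa using a1 k hk
    · intro k hk; simpa using a2 k hk
  exact (d1.seq fun s1 h1 => (d2 s1 h1).seq fun s2 h2 => (d3 s2 h2).seq fun s3 h3 =>
    (d4 s3 h3).seq d5).conseq (fun _ h => h) (by omega)

end Horner

end RecSys

end

noncomputable section

namespace RecSys

/-! ### Evaluation of the Bernstein polynomial of the ramp -/

section Bernstein

variable {ε φ : ℝ} {m n : ℕ} {A : Matrix (Fin m) (Fin n) ℝ}

/-- The piecewise linear function of `y` that increases from `0` at `σ²` to `1` at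
`σ² (1 + 2 ξ)`. -/
def ramp (σ ξ y : ℝ) : ℝ :=
  (|(y / σ ^ 2 - 1) / (2 * ξ)| - |(y / σ ^ 2 - 1) / (2 * ξ) - 1| + 1) / 2

/-- Coefficients of the Bernstein polynomial of degree `S` of the ramp on `[0, 2 b²]`. -/
def bernCoeff (S : ℕ) (σ ξ b : ℝ) (t : ℕ) : ℝ := ramp σ ξ (t * (2 * b ^ 2) / S) * S.choose t

def unitVec (k : ℕ) : ℝ := if k = 0 then 1 else 0

/-- The vectors `Yᵗ e₀`. -/
def powVec (Y : (ℕ → ℝ) → ℕ → ℝ) : ℕ → ℕ → ℝ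
  | 0 => unitVec
  | t + 1 => Y (powVec Y t)

/-- The partial sums `∑_{t' ≤ t} c t' Y ^ t' (1 - Y) ^ (t - t') e₀`. -/
def hornerVec (Y : (ℕ → ℝ) → ℕ → ℝ) (c : ℕ → ℝ) : ℕ → ℕ → ℝ
  | 0 => fun k => c 0 * unitVec k
  | t + 1 => fun k => hornerVec Y c t k - Y (hornerVec Y c t) k + c (t + 1) * powVec Y (t + 1) k

/-- Weights of the indices for the choice of the columns. -/
def initVec (S k : ℕ) : ℝ := if k = 0 then √S else 1

/-- Absolute values in the ramp are computed as square roots of squares, and the binomial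
coefficient is updated by `C(S, t+1) = C(S, t) (S - t) / (t + 1)`. Adding the zero cell `9` moves
the two results out of scratch memory. -/
def coeffProg : Prog :=
  .seq (block [.numOfNat 24 11, .numMul 25 24 7, .numDiv 25 25 6, .numMul 26 0 0, .numDiv 25 25 26,
      .numOfNat 27 5, .numSub 25 25 27, .numAdd 28 2 2, .numDiv 25 25 28, .numMul 26 25 25,
      .numSqrt 26 26, .numSub 28 25 27, .numMul 28 28 28, .numSqrt 28 28, .numSub 26 26 28,
      .numAdd 26 26 27, .numAdd 28 27 27, .numDiv 26 26 28, .numMul 34 26 10, .numSub 28 6 24,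
      .numMul 35 10 28, .numAdd 28 24 27, .numDiv 35 35 28])
    (block [.numAdd 11 34 9, .numAdd 10 35 9, .natConst 20 0])

def updateBody : Prog :=
  block ((getNum 24 20 2 ++ (getNum 25 20 3 ++ (getNum 26 20 4 ++ [.numSub 24 24 26,
    .numMul 27 11 25, .numAdd 24 24 27]))) ++ (putNum 20 1 25 ++ (putNum 20 2 24 ++
      (putNum 20 3 9 ++ (putNum 20 4 9 ++ [.natAdd 20 20 5])))))

def hornerBody : Prog :=
  .seq coeffProg (.seq (.loop (.natLt 20 4) updateBody) (.seq (block [.natConst 10 0])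
    (.seq (.loop (.natLt 10 3) columnBody) (block [.natAdd 11 11 5]))))

def hornerProg : Prog :=
  .seq (block [.natConst 11 0, .numOfNat 10 5]) (.loop (.natLt 11 4) hornerBody)

variable {i S N : ℕ} {σ ξ b : ℝ} {r : ℕ → Fin m} {α : ℕ → ℝ} {c : ℕ → Fin n} {β : ℕ → ℝ}

theorem choose_step {S t : ℕ} (ht : t ≤ S) :
    ((S.choose t : ℝ) * (S - t)) / (t + 1) = S.choose (t + 1) := by
  have h := Nat.choose_succ_right_eq S t
  have h' : (S.choose (t + 1) : ℝ) * (t + 1) = S.choose t * (S - t) := by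
    rw [← Nat.cast_sub ht]; exact_mod_cast h
  rw [← h', mul_div_assoc, div_self (by positivity), mul_one]

/-- State of the evaluation of the polynomial before step `t`. -/
structure HornerInv (A : Matrix (Fin m) (Fin n) ℝ) (i S N : ℕ) (σ ξ b : ℝ) (r : ℕ → Fin m)
    (α : ℕ → ℝ) (c : ℕ → Fin n) (β : ℕ → ℝ) (t : ℕ) (s : Mem) : Prop where
  consts : Consts i S N σ ξ b s
  sketch : Sketch S r α c β s
  ctr : s.nat 11 = t
  binom : s.num 10 = (S.choose t : ℝ)
  pow : Arr S 3 (powVec (gram A S r α c β S) t) s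
  cur : ∃ w y : ℕ → ℝ, Arr S 2 w s ∧ Arr S 4 y s ∧
    (∀ k, w k - y k + bernCoeff S σ ξ b t * powVec (gram A S r α c β S) t k =
      hornerVec (gram A S r α c β S) (bernCoeff S σ ξ b) t k) ∧
    ∀ t', t = t' + 1 → w = hornerVec (gram A S r α c β S) (bernCoeff S σ ξ b) t'

theorem det_coeffProg {A : Matrix (Fin m) (Fin n) ℂ} (O : OSQ ε φ A) (τ : ℕ) (s : Mem) (t : ℕ)
    (ht : t ≤ S)
    (hc : Consts i S N σ ξ b s) (h11 : s.nat 11 = t) (h10 : s.num 10 = (S.choose t : ℝ)) :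
    Det O τ coeffProg s (fun s' => (∀ a, a < 20 ∨ 64 ≤ a → s'.nat a = s.nat a) ∧
      (∀ a, a ≠ 10 → a ≠ 11 → a < 20 ∨ 64 ≤ a → s'.num a = s.num a) ∧ s'.nat 20 = 0 ∧
      s'.num 10 = (S.choose (t + 1) : ℝ) ∧ s'.num 11 = (bernCoeff S σ ξ b t : ℝ)) 60 := by
  refine (Det.seq (t₁ := 47) (t₂ := 7) (Q := fun s' => Frame s s' ∧
    s'.num 34 = (bernCoeff S σ ξ b t : ℝ) ∧ s'.num 35 = (S.choose (t + 1) : ℝ)) ?_ ?_).conseq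
    (fun _ h => h) (by omega)
  · refine Det.block O τ _ rfl s ⟨frame_effs O s _ rfl, ?_, ?_⟩
    · obtain ⟨x, hx⟩ : ∃ x : ℝ, x = (t * (2 * b ^ 2) / S / σ ^ 2 - 1) / (2 * ξ) := ⟨_, rfl⟩
      have e : (((t : ℂ) * (2 * (b : ℂ) ^ 2) / S / (σ * σ) - 1) / (ξ + ξ)) = x := by
        rw [hx]; push_cast; ring
      rw [bernCoeff, ramp, ← hx]
      simp [h11, h10, hc.one, hc.bound, hc.sizeR, hc.sig, hc.xi, e, Real.sqrt_mul_self_eq_abs]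
      left
      ring
    · rw [← choose_step ht]
      simp [h11, h10, hc.one, hc.sizeR]
  · rintro s1 ⟨f1, a1, a2⟩
    have h9 : s1.num 9 = 0 := (f1.num 9 (by omega)).trans hc.zero
    refine Det.block O τ _ rfl s1 ⟨?_, ?_, ?_, ?_, ?_⟩
    · intro a ha
      have h1 : a ≠ 63 := by omega
      have h2 : a ≠ 20 := by omega
      simpa [h1, h2] using f1.nat a ha
    · intro a h1 h2 ha
      simpa [h1, h2] using f1.num a ha
    · simp
    · simp [a2, h9]
    · simp [a1, h9]

theorem det_updateLoop (O : OSQ ε φ (A.map ((↑) : ℝ → ℂ))) (τ : ℕ) (s : Mem) (w y y' : ℕ → ℝ)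
    (q : ℝ) (hc : Consts i S N σ ξ b s) (h20 : s.nat 20 = 0) (h11 : s.num 11 = q)
    (hw : Arr S 2 w s) (hy : Arr S 3 y s) (hy' : Arr S 4 y' s) :
    Det O τ (.loop (.natLt 20 4) updateBody) s (fun s' => Mod [1, 2, 3, 4] s s' ∧ Arr S 1 y s' ∧
      Arr S 2 (fun k => w k - y' k + q * y k) s' ∧ Arr S 3 (fun _ => 0) s' ∧
      Arr S 4 (fun _ => 0) s') (140 * (S + 1)) := by
  refine (Det.loop (b := .natLt 20 4) (N := S + 1) (t := 123) (R := fun k s' =>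
    Mod [1, 2, 3, 4] s s' ∧ s'.nat 20 = k ∧ (∀ k' < k, s'.num (ad k' 1) = y k' ∧
      s'.num (ad k' 2) = (w k' - y' k' + q * y k' : ℝ) ∧ s'.num (ad k' 3) = 0 ∧
      s'.num (ad k' 4) = 0) ∧ ∀ k' ≥ k, s'.num (ad k' 2) = s.num (ad k' 2) ∧
      s'.num (ad k' 3) = s.num (ad k' 3) ∧ s'.num (ad k' 4) = s.num (ad k' 4))
      ?_ ?_ ?_ s ?_).conseq ?_ (t' := 140 * (S + 1)) (by omega)
  · rintro k s1 hk ⟨f1, a1, -⟩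
    simpa only [Test.Holds, a1, (hc.mod f1).size] using hk
  · rintro k s1 hk ⟨f1, a1, a2, a3⟩
    have hone := (hc.mod f1).one
    have hzero := (hc.mod f1).zero
    have e11 : s1.num 11 = q := (f1.num 11 (by omega)).trans h11
    obtain ⟨e2, e3, e4⟩ := a3 k le_rfl
    rw [hw k (by omega)] at e2
    rw [hy k (by omega)] at e3
    rw [hy' k (by omega)] at e4
    refine (Det.block O τ _ rfl s1 ⟨?_, ?_, ?_, ?_⟩).conseq
      (fun _ h => h) (t' := 123) (by simp [getNum, putNum, ptr])
    · exact f1.effs_local O rfl fun _ h => h.effs_put O _ _ _ (by omega) (by simp) fun _ h =>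
        h.effs_put O _ _ _ (by omega) (by simp) fun _ h =>
        h.effs_put O _ _ _ (by omega) (by simp) fun _ h =>
        h.effs_put O _ _ _ (by omega) (by simp) fun _ h => h.effs_end O rfl
    · simp [a1, hone]
    · intro k' hk'
      rcases eq_or_ne k' k with rfl | hne
      · simp [a1, e2, e3, e4, e11, hzero]
      · simpa [a1, hne] using a2 k' (by omega)
    · intro k' hk'
      have hne : k' ≠ k := by omega
      simpa [a1, hne] using a3 k' (by omega)
  · rintro s1 ⟨f1, a1, -⟩
    simp [Test.Holds, a1, (hc.mod f1).size]
  · exact ⟨Mod.refl _ _, h20, fun k' hk' => absurd hk' (Nat.not_lt_zero _), fun _ _ => ⟨rfl, rfl, rfl⟩⟩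
  · rintro s1 ⟨f1, -, a2, -⟩
    refine ⟨f1, fun k hk => (a2 k (by omega)).1, fun k hk => (a2 k (by omega)).2.1, fun k hk => ?_,
      fun k hk => ?_⟩
    · simpa using (a2 k (by omega)).2.2.1
    · simpa using (a2 k (by omega)).2.2.2

/-- The product of the matrix with the running value is formed one step before it is used: array `2`
holds the previous value `h`, array `4` holds `Yh` and array `3` the current power vector, so `h -
Yh + cₜYᵗe₀` is the next value. The matrix is then applied to this new value and to the power vector
at once. -/
theorem det_hornerBody (O : OSQ ε φ (A.map ((↑) : ℝ → ℂ))) (τ : ℕ) (s : Mem) (t : ℕ) (ht : t < S + 1)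
    (h : HornerInv A i S N σ ξ b r α c β t s) :
    Det O τ hornerBody s (HornerInv A i S N σ ξ b r α c β (t + 1)) (600 * (S + 1) * (S + 1)) := by
  obtain ⟨w, y, hw, hy, hwy, -⟩ := h.cur
  set Y := gram A S r α c β S with hY
  set C := bernCoeff S σ ξ b with hC
  have d1 := det_coeffProg O τ s t (by omega) h.consts h.ctr h.binom
  have d2 : ∀ s1 : Mem, ((∀ a, a < 20 ∨ 64 ≤ a → s1.nat a = s.nat a) ∧
      (∀ a, a ≠ 10 → a ≠ 11 → a < 20 ∨ 64 ≤ a → s1.num a = s.num a) ∧ s1.nat 20 = 0 ∧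
      s1.num 10 = (S.choose (t + 1) : ℝ) ∧ s1.num 11 = (C t : ℝ)) →
      Det O τ (.loop (.natLt 20 4) updateBody) s1 (fun s2 => Consts i S N σ ξ b s2 ∧
        Sketch S r α c β s2 ∧ s2.nat 11 = t ∧ s2.num 10 = (S.choose (t + 1) : ℝ) ∧
        Arr S 1 (powVec Y t) s2 ∧ Arr S 2 (hornerVec Y C t) s2 ∧
        Arr S 3 (gram A S r α c β 0 (powVec Y t)) s2 ∧
        Arr S 4 (gram A S r α c β 0 (hornerVec Y C t)) s2) (140 * (S + 1)) := by
    rintro s1 ⟨a1, a2, a3, a4, a5⟩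
    have hc1 : Consts i S N σ ξ b s1 := h.consts.low (fun a _ ha => a1 a (by omega))
      fun a ha => a2 a (by omega) (by omega) (by omega)
    have harr : ∀ k f, s1.num (ad k f) = s.num (ad k f) := fun k f =>
      a2 _ (by have := le_ad k f; omega) (by have := le_ad k f; omega) (.inr (le_ad _ _))
    have hs1 : Sketch S r α c β s1 := ⟨fun k hk => (a1 _ (.inr (le_ad _ _))).trans (h.sketch.row k hk),
      fun k hk => (harr _ _).trans (h.sketch.scale k hk),
      fun k hk => (a1 _ (.inr (le_ad _ _))).trans (h.sketch.col k hk),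
      fun k hk => (harr _ _).trans (h.sketch.weight k hk)⟩
    refine (det_updateLoop O τ s1 w (powVec Y t) y (C t) hc1 a3 a5
      (fun k hk => (harr _ _).trans (hw k hk)) (fun k hk => (harr _ _).trans (h.pow k hk))
      (fun k hk => (harr _ _).trans (hy k hk))).conseq ?_ le_rfl
    rintro s2 ⟨f2, b1, b2, b3, b4⟩
    refine ⟨hc1.mod f2, hs1.mod f2 (by simp) (by simp), ?_, ?_, b1, ?_, ?_, ?_⟩
    · rw [f2.nat 11 (by omega), a1 11 (by omega), h.ctr]
    · rw [f2.num 10 (by omega), a4]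
    · intro k hk
      rw [b2 k hk]
      exact congrArg _ (hwy k)
    · intro k hk; rw [b3 k hk]; simp [gram]
    · intro k hk; rw [b4 k hk]; simp [gram]
  let R : ℕ → Mem → Prop := fun l s2 => Consts i S N σ ξ b s2 ∧
        Sketch S r α c β s2 ∧ s2.nat 11 = t ∧ s2.num 10 = (S.choose (t + 1) : ℝ) ∧
        Arr S 1 (powVec Y t) s2 ∧ Arr S 2 (hornerVec Y C t) s2 ∧
        Arr S 3 (gram A S r α c β l (powVec Y t)) s2 ∧
        Arr S 4 (gram A S r α c β l (hornerVec Y C t)) s2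
  have d3 : ∀ s1, R 0 s1 → Det O τ (block [.natConst 10 0]) s1
      (fun s2 => s2.nat 10 = 0 ∧ R 0 s2) 3 := by
    rintro s1 ⟨a1, a2, a3, a4, a5, a6, a7, a8⟩
    refine Det.block O τ _ rfl s1 ⟨by simp, ?_, ?_, ?_, ?_, ?_, ?_, ?_, ?_⟩
    · refine a1.low (fun a _ ha => ?_) fun a _ => by simp
      have h1 : a ≠ 63 := by omega
      have h2 : a ≠ 10 := by omega
      simp [h1, h2]
    · exact ⟨by simpa using a2.row, by simpa using a2.scale, by simpa using a2.col,
        by simpa using a2.weight⟩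
    all_goals simpa [Arr]
  have d4 : ∀ s1, (s1.nat 10 = 0 ∧ R 0 s1) → Det O τ (.loop (.natLt 10 3) columnBody) s1
      (fun s2 => s2.nat 10 = S ∧ R S s2) (S * (300 * (S + 1) + 1) + 1) := by
    intro s1 h1
    refine Det.loop (b := .natLt 10 3) (N := S) (t := 300 * (S + 1))
      (R := fun l s2 => s2.nat 10 = l ∧ R l s2) ?_ ?_ ?_ s1 h1
    · rintro l s2 hl ⟨b0, b1, -⟩
      simpa only [Test.Holds, b0, b1.cols] using hl
    · rintro l s2 hl ⟨b0, b1, b2, b3, b4, b5, b6, b7, b8⟩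
      refine (det_columnBody O τ s2 _ _ l hl b1 b2 b5 b6 b7 b8 b0).conseq ?_ le_rfl
      rintro s3 ⟨e1, e2, e3, e4, e5, e6⟩
      refine ⟨e4, b1.low (fun a _ ha => e1 a (by omega) (by omega)) (fun a ha => e2 a (by omega)),
        ⟨fun k hk => ?_, fun k hk => ?_, fun k hk => ?_, fun k hk => ?_⟩, ?_, ?_, fun k hk => ?_,
        fun k hk => ?_, e5, e6⟩
      · rw [e1 _ (by have := le_ad k 0; omega) (.inr (le_ad _ _)), b2.row k hk]
      · rw [e3 _ _ (by omega) (by simp), b2.scale k hk]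
      · rw [e1 _ (by have := le_ad k 1; omega) (.inr (le_ad _ _)), b2.col k hk]
      · rw [e3 _ _ (by omega) (by simp), b2.weight k hk]
      · rw [e1 11 (by omega) (by omega), b3]
      · rw [e2 10 (by omega), b4]
      · rw [e3 _ _ (by omega) (by simp), b5 k hk]
      · rw [e3 _ _ (by omega) (by simp), b6 k hk]
    · rintro s2 ⟨b0, b1, -⟩
      simp [Test.Holds, b0, b1.cols]
  have d5 : ∀ s1, (s1.nat 10 = S ∧ R S s1) → Det O τ (block [.natAdd 11 11 5]) s1
      (HornerInv A i S N σ ξ b r α c β (t + 1)) 3 := by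
    rintro s1 ⟨-, a1, a2, a3, a4, a5, a6, a7, a8⟩
    have hone := a1.one
    refine Det.block O τ _ rfl s1 ⟨?_, ?_, ?_, ?_, ?_, ?_⟩
    · refine a1.low (fun a _ ha => ?_) fun a _ => by simp
      have h1 : a ≠ 63 := by omega
      have h2 : a ≠ 11 := by omega
      simp [h1, h2]
    · exact ⟨by simpa using a2.row, by simpa using a2.scale, by simpa using a2.col,
        by simpa using a2.weight⟩
    · simp [a3, hone]
    · simpa using a4
    · intro k hk; simp; exact a7 k hk
    · refine ⟨hornerVec Y C t, gram A S r α c β S (hornerVec Y C t), ?_, ?_, fun k => rfl, ?_⟩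
      · intro k hk; simpa using a6 k hk
      · intro k hk; simpa using a8 k hk
      · intro t' ht'
        obtain rfl : t = t' := by omega
        rfl
  have d := d1.seq fun s1 h1 => (d2 s1 h1).seq fun s2 h2 => (d3 s2 h2).seq fun s3 h3 =>
    (d4 s3 h3).seq d5
  refine d.conseq (fun _ h => h) ?_
  have h1 : S * (300 * (S + 1) + 1) ≤ (S + 1) * (300 * (S + 1) + 1) :=
    Nat.mul_le_mul_right _ (Nat.le_succ S)
  have h2 : S + 1 ≤ (S + 1) * (S + 1) := Nat.le_mul_self _
  have h3 : (S + 1) * (300 * (S + 1) + 1) = 300 * ((S + 1) * (S + 1)) + (S + 1) := by ring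
  have h4 : 600 * (S + 1) * (S + 1) = 600 * ((S + 1) * (S + 1)) := by ring
  have h5 : 1 ≤ S + 1 := by omega
  omega

theorem det_hornerProg (O : OSQ ε φ (A.map ((↑) : ℝ → ℂ))) (τ : ℕ) (s : Mem)
    (hc : Consts i S N σ ξ b s) (hs : Sketch S r α c β s) (h2 : Arr S 2 (initVec S) s)
    (h3 : Arr S 3 unitVec s) (h4 : Arr S 4 (initVec S) s) :
    Det O τ hornerProg s (fun s' => Consts i S N σ ξ b s' ∧ Sketch S r α c β s' ∧
      Arr S 2 (hornerVec (gram A S r α c β S) (bernCoeff S σ ξ b) S) s')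
      (700 * ((S + 1) * (S + 1) * (S + 1))) := by
  have hone := hc.one
  have d1 : Det O τ (block [.natConst 11 0, .numOfNat 10 5]) s
      (HornerInv A i S N σ ξ b r α c β 0) 5 := by
    refine Det.block O τ _ rfl s ⟨?_, ?_, ?_, ?_, ?_, ?_⟩
    · refine hc.low (fun a _ ha => ?_) fun a ha => ?_
      · have h1 : a ≠ 63 := by omega
        have h2 : a ≠ 11 := by omega
        simp [h1, h2]
      · have h1 : a ≠ 10 := by omega
        simp [h1]
    · exact ⟨by simpa using hs.row, by simpa using hs.scale, by simpa using hs.col,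
        by simpa using hs.weight⟩
    · simp
    · simp [hone]
    · intro k hk; simpa [powVec] using h3 k hk
    -- Arrays `2` and `4` still contain the same column sampling weights. Their difference vanishes,
    -- so the recursion starts from `c₀ e₀` without clearing them.
    · refine ⟨initVec S, initVec S, ?_, ?_, fun k => ?_, fun t' ht' => absurd ht' (by omega)⟩
      · intro k hk; simpa using h2 k hk
      · intro k hk; simpa using h4 k hk
      · simp [hornerVec, powVec]
  refine (d1.seq (t₂ := (S + 1) * (600 * (S + 1) * (S + 1) + 1) + 1) fun s1 hs1 => ?_).conseq
    (fun _ h => h) ?_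
  · refine (Det.loop (b := .natLt 11 4) (N := S + 1) (t := 600 * (S + 1) * (S + 1))
      (R := HornerInv A i S N σ ξ b r α c β) ?_ ?_ ?_ s1 hs1).conseq ?_ le_rfl
    · intro t s2 ht h2
      simpa only [Test.Holds, h2.ctr, h2.consts.size] using ht
    · intro t s2 ht h2
      exact det_hornerBody O τ s2 t ht h2
    · intro s2 h2
      simp [Test.Holds, h2.ctr, h2.consts.size]
    · intro s2 h2
      obtain ⟨w, y, hw, -, -, hw'⟩ := h2.cur
      rw [hw' S rfl] at hw
      exact ⟨h2.consts, h2.sketch, hw⟩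
  · have : 0 < S + 1 := by omega
    nlinarith [Nat.mul_pos this this, Nat.mul_pos (Nat.mul_pos this this) this]

end Bernstein

end RecSys

end

noncomputable section

namespace RecSys

/-! ### Sampling the sketch, and one attempt of the rejection sampling -/

section MainProgram

variable {ε φ : ℝ} {m n : ℕ} {A : Matrix (Fin m) (Fin n) ℝ}

/-- Replacement of entry `k` of a vector by a sample from `P`. -/
def iidStep {α : Type} (P : PMF α) (S k : ℕ) (v : Fin S → α) : PMF (Fin S → α) :=
  if h : k < S then P.map fun x => Function.update v ⟨k, h⟩ x else PMF.pure v

/-- Independent samples from `P`. -/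
def iid {α : Type} (P : PMF α) (S : ℕ) (v : Fin S → α) : PMF (Fin S → α) :=
  chain (iidStep P S) 0 S v

/-- A sampled row is useless if it is the row `i` or a zero row. -/
def IsVoid {A : Matrix (Fin m) (Fin n) ℂ} (O : OSQ ε φ A) (i x : Fin m) : Prop :=
  x = i ∨ rowNorms O.bar x = 0

open Classical in
/-- The rows of the sketch: the row `i`, followed by the sampled rows. -/
def rowIdx {A : Matrix (Fin m) (Fin n) ℂ} (O : OSQ ε φ A) (i : Fin m) {S : ℕ} (v : Fin S → Fin m) :
    ℕ → Fin m
  | 0 => i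
  | k + 1 => if h : k < S then (if IsVoid O i (v ⟨k, h⟩) then i else v ⟨k, h⟩) else i

open Classical in
/-- The scales of the rows of the sketch. -/
def rowScale {A : Matrix (Fin m) (Fin n) ℂ} (O : OSQ ε φ A) (i : Fin m) {S : ℕ}
    (v : Fin S → Fin m) : ℕ → ℝ
  | 0 => 1
  | k + 1 => if h : k < S then (if IsVoid O i (v ⟨k, h⟩) then 0 else
      l2 (rowNorms O.bar) / (√S * rowNorms O.bar (v ⟨k, h⟩))) else 0

def firstRowProg : Prog :=
  block ([.natConst 20 0, .numOfNat 20 5] ++ (putNat 20 0 2 ++ (putNum 20 0 20 ++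
    (putNum 20 3 20 ++ (putNum 20 2 8 ++ (putNum 20 4 8 ++ [.natAdd 20 20 5]))))))

/-- Truncated subtraction in both directions gives `|x - i|`, so `|x - i|` times the row norm is
nonpositive exactly for a void sample. A void sample becomes a copy of the row `i` with scale `0`,
so every row of the sketch has a valid index and a nonzero row of `bar` as soon as the row `i` does.
-/
def rowBody : Prog :=
  .seq (.instr (.sampleRow 33))
    (.seq (block [.queryRowNorm 20 33, .natSub 24 33 2, .natSub 25 2 33, .natAdd 24 24 25,
        .numOfNat 21 24, .numMul 21 21 20])
      (.seq (.branch (.numLe 21 9)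
          (block [.natConst 24 0, .natAdd 33 2 24, .numAdd 22 9 9])
          (block [.numMul 22 8 20, .numDiv 22 5 22]))
        (block ([.numOfNat 23 5] ++ (putNat 20 0 33 ++ (putNum 20 0 22 ++ (putNum 20 2 23 ++
          (putNum 20 4 23 ++ [.natAdd 20 20 5]))))))))

variable {S N : ℕ} {σ ξ b : ℝ}

/-- State of the sampling of the rows before sample `k`. -/
structure RowInv {A : Matrix (Fin m) (Fin n) ℂ} (O : OSQ ε φ A) (i : Fin m) (S N : ℕ) (σ ξ : ℝ)
    (k : ℕ) (v : Fin S → Fin m) (s : Mem) : Prop where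
  consts : Consts i S N σ ξ (l2 (rowNorms O.bar)) s
  ctr : s.nat 20 = k + 1
  row : ∀ k' ≤ k, s.nat (ad k' 0) = rowIdx O i v k'
  scale : ∀ k' ≤ k, s.num (ad k' 0) = (rowScale O i v k' : ℝ)
  coeff : ∀ k' ≤ k, s.num (ad k' 2) = (initVec S k' : ℝ) ∧ s.num (ad k' 4) = (initVec S k' : ℝ)
  unit : ∀ k', s.num (ad k' 3) = (unitVec k' : ℝ)

/-- No sample has been drawn yet, so `v` is arbitrary. Array `3` is initially zero, hence writing
its entry `0` produces `e₀`. -/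
theorem det_firstRowProg {A : Matrix (Fin m) (Fin n) ℂ} (O : OSQ ε φ A) (τ : ℕ) (i : Fin m)
    (s : Mem) (v : Fin S → Fin m)
    (hc : Consts i S N σ ξ (l2 (rowNorms O.bar)) s) (h3 : ∀ k, s.num (ad k 3) = 0) :
    Det O τ firstRowProg s (RowInv O i S N σ ξ 0 v) 87 := by
  have h1 := hc.one
  have h2 := hc.idx
  have h8 := hc.root
  refine Det.block O τ _ rfl s ⟨?_, ?_, ?_, ?_, ?_, ?_⟩
  · refine hc.low (fun a _ ha => ?_) fun a ha => ?_
    · have e1 : a ≠ 63 := by omega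
      have e2 : a ≠ 20 := by omega
      have e3 : a ≠ 22 := by omega
      have e4 : a ≠ 23 := by omega
      have e5 : a < 64 := by omega
      simp [e1, e2, e3, e4, e5]
    · have e2 : a ≠ 20 := by omega
      have e5 : a < 64 := by omega
      simp [e2, e5]
  · simp [h1]
  · intro k hk
    obtain rfl : k = 0 := by omega
    simp [h2, rowIdx]
  · intro k hk
    obtain rfl : k = 0 := by omega
    simp [h1, rowScale]
  · intro k hk
    obtain rfl : k = 0 := by omega
    simp [h8, initVec]
  · intro k
    rcases eq_or_ne k 0 with rfl | hk
    · simp [h1, unitVec]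
    · simp [h3, hk, unitVec]

theorem rowIdx_update {A : Matrix (Fin m) (Fin n) ℂ} (O : OSQ ε φ A) (i : Fin m)
    (v : Fin S → Fin m) (k : ℕ) (hk : k < S) (x : Fin m) (k' : ℕ) (hk' : k' ≤ k) :
    rowIdx O i (Function.update v ⟨k, hk⟩ x) k' = rowIdx O i v k' := by
  cases k' with
  | zero => rfl
  | succ k' =>
    have e : ∀ h', Function.update v ⟨k, hk⟩ x ⟨k', h'⟩ = v ⟨k', h'⟩ := fun h' =>
      Function.update_of_ne (by simp; omega) _ _
    by_cases h : k' < S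
    · simp only [rowIdx, h, dite_true]
      rw [e h]
    · simp only [rowIdx, h, dite_false]

theorem rowScale_update {A : Matrix (Fin m) (Fin n) ℂ} (O : OSQ ε φ A) (i : Fin m)
    (v : Fin S → Fin m) (k : ℕ) (hk : k < S) (x : Fin m) (k' : ℕ) (hk' : k' ≤ k) :
    rowScale O i (Function.update v ⟨k, hk⟩ x) k' = rowScale O i v k' := by
  cases k' with
  | zero => rfl
  | succ k' =>
    have e : ∀ h', Function.update v ⟨k, hk⟩ x ⟨k', h'⟩ = v ⟨k', h'⟩ := fun h' =>
      Function.update_of_ne (by simp; omega) _ _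
    by_cases h : k' < S
    · simp only [rowScale, h, dite_true]
      rw [e h]
    · simp only [rowScale, h, dite_false]

theorem spec_rowBody {A : Matrix (Fin m) (Fin n) ℂ} (O : OSQ ε φ A) (τ : ℕ) (i : Fin m)
    (s : Mem) (k : ℕ) (hk : k < S) (v : Fin S → Fin m) (h : RowInv O i S N σ ξ k v s) :
    Spec O τ rowBody s (iidStep O.rowSampler S k v) (RowInv O i S N σ ξ (k + 1)) 200 := by
  have hc := h.consts
  rw [iidStep, dif_pos hk]
  refine ((((Spec.sampleRow O τ 33 s).seq_det (t₂ := 150) (Q' := fun x s' => RowInv O i S N σ ξ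
    (k + 1) (Function.update v ⟨k, hk⟩ x) s') fun x s1 hs1 => ?_).map
    (fun x => Function.update v ⟨k, hk⟩ x) fun _ _ h => h)).conseq (fun _ _ h => h) (by omega)
  set v' := Function.update v ⟨k, hk⟩ x with hv'
  have hvk : v' ⟨k, hk⟩ = x := Function.update_self ..
  have f1 : Frame s s1 := hs1 ▸ Frame.setNat s _ (by omega)
  have hc1 := hc.mod (f1.mod [])
  have h33 : s1.nat 33 = x := by simp [hs1]
  have d1 : Det O τ (block [.queryRowNorm 20 33, .natSub 24 33 2, .natSub 25 2 33,
      .natAdd 24 24 25, .numOfNat 21 24, .numMul 21 21 20]) s1 (fun s2 => Frame s s2 ∧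
        s2.nat 20 = k + 1 ∧ s2.nat 33 = x ∧ s2.num 20 = (rowNorms O.bar x : ℝ) ∧
        s2.num 21 = (((((x : ℕ) - (i : ℕ) + ((i : ℕ) - (x : ℕ)) : ℕ) : ℝ) *
          rowNorms O.bar x : ℝ) : ℂ)) 13 := by
    refine Det.block O τ _ rfl s1 ⟨f1.trans (frame_effs O s1 _ rfl), ?_, ?_, ?_, ?_⟩
    · simp [hs1, h.ctr]
    · simp [h33]
    · simp [h33]
    · simp [h33, hc1.idx]
  have d2 : ∀ s2, (Frame s s2 ∧
        s2.nat 20 = k + 1 ∧ s2.nat 33 = x ∧ s2.num 20 = (rowNorms O.bar x : ℝ) ∧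
        s2.num 21 = (((((x : ℕ) - (i : ℕ) + ((i : ℕ) - (x : ℕ)) : ℕ) : ℝ) *
          rowNorms O.bar x : ℝ) : ℂ)) →
      Det O τ (.branch (.numLe 21 9)
          (block [.natConst 24 0, .natAdd 33 2 24, .numAdd 22 9 9])
          (block [.numMul 22 8 20, .numDiv 22 5 22])) s2 (fun s3 => Frame s s3 ∧
        s3.nat 20 = k + 1 ∧ s3.nat 33 = rowIdx O i v' (k + 1) ∧
        s3.num 22 = (rowScale O i v' (k + 1) : ℝ)) 8 := by
    rintro s2 ⟨f2, a1, a2, a3, a4⟩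
    have hc2 := hc.mod (f2.mod [])
    have hrn : 0 ≤ rowNorms O.bar x := norm_nonneg _
    have hiff : (Test.numLe 21 9).Holds s2 ↔ IsVoid O i x := by
      simp only [Test.Holds, a4, hc2.zero, Complex.ofReal_re, Complex.zero_re, IsVoid]
      rw [Fin.ext_iff]
      constructor
      · intro hle
        rcases eq_or_lt_of_le hrn with h0 | h0
        · exact .inr h0.symm
        · left
          have : (((x : ℕ) - (i : ℕ) + ((i : ℕ) - (x : ℕ)) : ℕ) : ℝ) ≤ 0 := by
            by_contra hlt
            exact absurd hle (not_le.2 (mul_pos (not_le.1 hlt) h0))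
          have : (x : ℕ) - (i : ℕ) + ((i : ℕ) - (x : ℕ)) ≤ 0 := by exact_mod_cast this
          omega
      · rintro (h0 | h0)
        · simp [h0]
        · simp [h0]
    refine Det.branch (t := 7) (fun hv => ?_) fun hv => ?_
    · rw [hiff] at hv
      refine Det.block O τ _ rfl s2 ⟨f2.trans (frame_effs O s2 _ rfl), ?_, ?_, ?_⟩
      · simp [a1]
      · simp [hc2.idx, rowIdx, hk, hvk, hv]
      · simp [hc2.zero, rowScale, hk, hvk, hv]
    · rw [hiff] at hv
      refine (Det.block O τ _ rfl s2 ⟨f2.trans (frame_effs O s2 _ rfl), ?_, ?_, ?_⟩).conseq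
        (fun _ h => h) (t' := 7) (by simp)
      · simp [a1]
      · simp [a2, rowIdx, hk, hvk, hv]
      · simp [hc2.root, hc2.nrm, a3, rowScale, hk, hvk, hv]
  have d3 : ∀ s3, (Frame s s3 ∧
        s3.nat 20 = k + 1 ∧ s3.nat 33 = rowIdx O i v' (k + 1) ∧
        s3.num 22 = (rowScale O i v' (k + 1) : ℝ)) →
      Det O τ (block ([.numOfNat 23 5] ++ (putNat 20 0 33 ++ (putNum 20 0 22 ++ (putNum 20 2 23 ++
          (putNum 20 4 23 ++ [.natAdd 20 20 5])))))) s3 (RowInv O i S N σ ξ (k + 1) v') 69 := by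
    rintro s3 ⟨f3, a1, a2, a3⟩
    have hc3 := hc.mod (f3.mod [])
    have h1 := hc3.one
    have hnum : ∀ k' f, s3.num (ad k' f) = s.num (ad k' f) := fun k' f => f3.num _ (.inr (le_ad _ _))
    have hnat : ∀ k' f, s3.nat (ad k' f) = s.nat (ad k' f) := fun k' f => f3.nat _ (.inr (le_ad _ _))
    refine Det.block O τ _ rfl s3 ⟨?_, ?_, ?_, ?_, ?_, ?_⟩
    · refine hc3.low (fun a _ ha => ?_) fun a ha => ?_
      · have e1 : a ≠ 63 := by omega
        have e2 : a ≠ 20 := by omega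
        have e3 : a ≠ 22 := by omega
        have e4 : a ≠ 23 := by omega
        have e5 : a < 64 := by omega
        simp [e1, e2, e3, e4, e5]
      · have e2 : a ≠ 23 := by omega
        have e5 : a < 64 := by omega
        simp [e2, e5]
    · simp [a1, h1]
    · intro k' hk'
      rcases eq_or_ne k' (k + 1) with rfl | hne
      · simp [a1, a2]
      · rw [hv', rowIdx_update O i v k hk x k' (by omega), ← h.row k' (by omega)]
        simp [a1, hne, hnat]
    · intro k' hk'
      rcases eq_or_ne k' (k + 1) with rfl | hne
      · simp [a1, a3]
      · rw [hv', rowScale_update O i v k hk x k' (by omega), ← h.scale k' (by omega)]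
        simp [a1, hne, hnum]
    · intro k' hk'
      rcases eq_or_ne k' (k + 1) with rfl | hne
      · simp [a1, h1, initVec]
      · rw [← (h.coeff k' (by omega)).1]
        have := h.coeff k' (by omega)
        simp [a1, hne, hnum, this]
    · intro k'
      rw [← h.unit k']
      simp [hnum]
  exact (d1.seq fun s2 h2 => (d2 s2 h2).seq d3).conseq (fun _ h => h) (by omega)

def columnsBody : Prog :=
  .seq sampleProg (block ([.numMul 24 6 7, .numMul 24 24 21, .numDiv 24 20 24] ++
    (putNum 10 5 24 ++ (putNat 10 1 32 ++ [.natAdd 10 10 5]))))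

/-- Square of the scale of the column `j` in the sketch, relative to the norm bound. -/
def colWeight {A : Matrix (Fin m) (Fin n) ℂ} (O : OSQ ε φ A) (S : ℕ) (r : ℕ → Fin m) (j : Fin n) :
    ℝ :=
  (∑ k ∈ Finset.range (S + 1), initVec S k ^ 2) /
    (S * (2 * l2 (rowNorms O.bar) ^ 2) * dens O S r (initVec S) j)

/-- The sampled columns as a sequence. -/
def colIdx [NeZero n] {S : ℕ} (c : Fin S → Fin n) (l : ℕ) : Fin n :=
  if h : l < S then c ⟨l, h⟩ else 0

/-- State of the sampling of the columns before sample `l`. -/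
structure ColInv [NeZero n] (O : OSQ ε φ (A.map ((↑) : ℝ → ℂ))) (i S N : ℕ) (σ ξ : ℝ)
    (r : ℕ → Fin m) (α : ℕ → ℝ) (l : ℕ) (c : Fin S → Fin n) (s : Mem) : Prop where
  consts : Consts i S N σ ξ (l2 (rowNorms O.bar)) s
  ctr : s.nat 10 = l
  row : ∀ k ≤ S, s.nat (ad k 0) = r k
  scale : Arr S 0 α s
  coeff : Arr S 2 (initVec S) s
  unit : Arr S 3 unitVec s
  coeff' : Arr S 4 (initVec S) s
  col : ∀ l' < l, s.nat (ad l' 1) = colIdx c l'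
  weight : ∀ l' < l, s.num (ad l' 5) = (colWeight O S r (colIdx c l') : ℝ)

theorem spec_columnsBody [NeZero n] (O : OSQ ε φ (A.map ((↑) : ℝ → ℂ))) (τ : ℕ) (i : ℕ)
    (r : ℕ → Fin m) (α : ℕ → ℝ)
    (s : Mem) (l : ℕ) (hl : l < S) (c : Fin S → Fin n) (h : ColInv O i S N σ ξ r α l c s) :
    Spec O τ columnsBody s (iidStep (colLaw O S r (initVec S)) S l c)
      (ColInv O i S N σ ξ r α (l + 1)) (250 * (S + 1)) := by
  have hc := h.consts
  rw [iidStep, dif_pos hl]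
  refine (((spec_sampleProg O τ S r α (initVec S) s
    ⟨hc.size, hc.one, h.row, h.scale, h.coeff⟩).seq_det (t₂ := 41) (Q' := fun x s' =>
      ColInv O i S N σ ξ r α (l + 1) (Function.update c ⟨l, hl⟩ x) s') fun x s1 hs1 => ?_).map
    (fun x => Function.update c ⟨l, hl⟩ x) fun _ _ h => h).conseq (fun _ _ h => h) (by omega)
  have hc1 := hc.mod (hs1.frame.mod [])
  have h10 : s1.nat 10 = l := (hs1.frame.nat 10 (by omega)).trans h.ctr
  have hnum : ∀ k' f, s1.num (ad k' f) = s.num (ad k' f) := fun k' f =>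
    hs1.frame.num _ (.inr (le_ad _ _))
  have hnat : ∀ k' f, s1.nat (ad k' f) = s.nat (ad k' f) := fun k' f =>
    hs1.frame.nat _ (.inr (le_ad _ _))
  have hone := hc1.one
  have hcol : colIdx (Function.update c ⟨l, hl⟩ x) l = x := by simp [colIdx, hl]
  have hcol' : ∀ l' < l, colIdx (Function.update c ⟨l, hl⟩ x) l' = colIdx c l' := by
    intro l' hl'
    simp only [colIdx, show l' < S by omega, dite_true]
    exact Function.update_of_ne (by simp; omega) _ _
  refine (Det.block O τ _ rfl s1 ⟨?_, ?_, ?_, ?_, ?_, ?_, ?_, ?_, ?_⟩).conseq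
    (fun _ h => h) (t' := 41) (by simp [putNum, putNat, ptr])
  · refine hc1.low (fun a _ ha => ?_) fun a ha => ?_
    · have e1 : a ≠ 63 := by omega
      have e2 : a ≠ 10 := by omega
      have e3 : a ≠ 22 := by omega
      have e4 : a ≠ 23 := by omega
      have e5 : a < 64 := by omega
      simp [e1, e2, e3, e4, e5]
    · have e2 : a ≠ 24 := by omega
      have e5 : a < 64 := by omega
      simp [e2, e5]
  · simp [h10, hone]
  · intro k hk; simpa [hnat] using h.row k hk
  · intro k hk; simpa [hnum] using h.scale k hk
  · intro k hk; simpa [hnum] using h.coeff k hk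
  · intro k hk; simpa [hnum] using h.unit k hk
  · intro k hk; simpa [hnum] using h.coeff' k hk
  · intro l' hl'
    rcases eq_or_ne l' l with rfl | hne
    · simp [h10, hs1.col, hcol]
    · rw [hcol' l' (by omega)]
      simpa [h10, hne, hnat] using h.col l' (by omega)
  · intro l' hl'
    rcases eq_or_ne l' l with rfl | hne
    · simp [h10, hs1.tot, hs1.dens, hc1.sizeR, hc1.bound, hcol, colWeight]
    · rw [hcol' l' (by omega)]
      simpa [h10, hne, hnum] using h.weight l' (by omega)

/-- The column is stored at the address `1 - x` for the coin `x`: acceptance writes to the output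
cell `0`, rejection to cell `1`. The loop always runs its full length, so the last accepted column
survives. -/
def trialBody : Prog :=
  .seq sampleProg (.seq (block [.numMul 26 22 22, .numMul 27 7 21, .numDiv 25 26 27])
    (.seq (.instr (.flip 24 25)) (block [.natSub 25 5 24, .natStore 25 32, .natAdd 12 12 5])))

/-- One attempt at sampling from the linear combination of the rows: the sampled column replaces the
current output if it is accepted. -/
def trialStep (O : OSQ ε φ (A.map ((↑) : ℝ → ℂ))) (S : ℕ) (r : ℕ → Fin m) (α w : ℕ → ℝ) (o : Fin n) :
    PMF (Fin n) :=
  (colLaw O S r w).bind fun j =>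
    (coin (comb A S r α w j ^ 2 / (2 * l2 (rowNorms O.bar) ^ 2 * dens O S r w j))).map
      fun x => if x = 1 then j else o

/-- State of the rejection sampling before attempt `t`. -/
structure TrialInv (O : OSQ ε φ (A.map ((↑) : ℝ → ℂ))) (i S N : ℕ) (σ ξ : ℝ)
    (r : ℕ → Fin m) (α w : ℕ → ℝ) (t : ℕ) (o : Fin n) (s : Mem) : Prop where
  consts : Consts i S N σ ξ (l2 (rowNorms O.bar)) s
  holds : Holds S r α w s
  ctr : s.nat 12 = t
  out : s.nat 0 = o

theorem spec_trialBody (O : OSQ ε φ (A.map ((↑) : ℝ → ℂ))) (τ : ℕ) (i : ℕ)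
    (r : ℕ → Fin m) (α w : ℕ → ℝ) (s : Mem) (t : ℕ) (o : Fin n)
    (h : TrialInv O i S N σ ξ r α w t o s) :
    Spec O τ trialBody s (trialStep O S r α w o) (TrialInv O i S N σ ξ r α w (t + 1))
      (250 * (S + 1)) := by
  refine ((spec_sampleProg O τ S r α w s h.holds).seq (t₂ := 18) fun j s1 hs1 => ?_).conseq
    (fun _ _ h => h) (by omega)
  have hc1 := h.consts.mod (hs1.frame.mod [])
  have d1 : Det O τ (block [.numMul 26 22 22, .numMul 27 7 21, .numDiv 25 26 27]) s1 (fun s2 =>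
      Frame s s2 ∧ s2.nat 32 = j ∧ s2.num 25 = ((comb A S r α w j ^ 2 /
        (2 * l2 (rowNorms O.bar) ^ 2 * dens O S r w j) : ℝ) : ℂ)) 7 := by
    refine Det.block O τ _ rfl s1 ⟨hs1.frame.trans (frame_effs O s1 _ rfl), ?_, ?_⟩
    · simp [hs1.col]
    · simp [hs1.comb, hs1.dens, hc1.bound]
      ring
  refine (d1.seq_spec (t₂ := 9) fun s2 ⟨f2, a1, a2⟩ => ?_).conseq (fun _ _ h => h) (by omega)
  have hflip := Spec.flip O τ 24 25 s2
  rw [a2, Complex.ofReal_re] at hflip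
  refine (hflip.seq_det (t₂ := 7) (Q' := fun x s' => TrialInv O i S N σ ξ r α w (t + 1)
    (if x = 1 then j else o) s') ?_).map _ fun _ _ h => h
  rintro x s3 ⟨hx, rfl⟩
  have hc2 := h.consts.mod (f2.mod [])
  have h5 := hc2.one
  have h12 : s2.nat 12 = t := (f2.nat 12 (by omega)).trans h.ctr
  have h0 : s2.nat 0 = o := (f2.nat 0 (by omega)).trans h.out
  have hH := h.holds.frame f2
  have hx' : x = 0 ∨ x = 1 := by omega
  have key : ∀ a, a ≠ 0 → a ≠ 1 → a ≠ 12 → a ≠ 24 → a ≠ 25 → a ≠ 63 →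
      (effs O (s2.setNat 24 x) [.natSub 25 5 24, .natStore 25 32, .natAdd 12 12 5]).nat a =
        s2.nat a := by
    intro a e0 e1 e2 e3 e4 e5
    rcases hx' with rfl | rfl <;> simp [h5, e0, e1, e2, e3, e4, e5]
  refine Det.block O τ _ rfl _ ⟨?_, ⟨?_, ?_, ?_, ?_, ?_⟩, ?_, ?_⟩
  · refine hc2.low (fun a _ ha => key a (by omega) (by omega) (by omega) (by omega) (by omega)
      (by omega)) fun a ha => by simp
  · rw [key 4 (by omega) (by omega) (by omega) (by omega) (by omega) (by omega), hH.size]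
  · rw [key 5 (by omega) (by omega) (by omega) (by omega) (by omega) (by omega), hH.one]
  · intro k hk
    have := le_ad k 0
    rw [key _ (by omega) (by omega) (by omega) (by omega) (by omega) (by omega), hH.row k hk]
  · intro k hk; simpa using hH.scale k hk
  · intro k hk; simpa using hH.coeff k hk
  · rcases hx' with rfl | rfl <;> simp [h5, h12]
  · rcases hx' with rfl | rfl <;> simp [h5, h0, a1]

end MainProgram

end RecSys

end

noncomputable section

namespace RecSys

/-! ### The whole program and the law of its output -/

section MainSpec

variable {ε φ : ℝ} {m n : ℕ} {A : Matrix (Fin m) (Fin n) ℝ}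

/-- The sampling parameter. -/
def sampleSize (b σ ν ξ : ℝ) : ℕ := ⌊(10000 : ℕ) * (b ^ 2 / (σ ^ 2 * ξ * ν)) ^ 2⌋₊ + 1

/-- There is no multiplication of indices, so both `S` and the number `S ^ 2 + 1` of attempts are
computed as scalars and then rounded. The rounding routine returns the integer part plus one, whence
the two summands `1`. -/
def preludeProg : Prog :=
  .seq (block [.natConst 5 1, .queryNorm 5, .numMul 7 5 5, .numAdd 7 7 7, .numMul 21 5 5,
      .numMul 22 0 0, .numMul 22 22 2, .numMul 22 22 1, .numDiv 21 21 22, .numMul 21 21 21,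
      .natConst 20 10000, .numOfNat 22 20, .numMul 20 22 21])
    (.seq ceilProg (.seq (block [.natConst 21 0, .natAdd 3 20 21, .natAdd 4 20 5, .numOfNat 6 3,
        .numSqrt 8 6, .numMul 20 6 6])
      (.seq ceilProg (block [.natConst 21 0, .natAdd 8 20 21]))))

/-- The columns take `O(S²)` steps, the polynomial `S + 1` matrix-vector products of `O(S²)` steps
each, and the rejection sampling `S ^ 2 + 1` attempts of `O(S)` steps each, so the total is `O(S³)`
on every run. -/
def mainProg : Prog :=
  .seq preludeProg (.seq firstRowProg (.seq (.loop (.natLt 20 4) rowBody)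
    (.seq (block [.natConst 10 0]) (.seq (.loop (.natLt 10 3) columnsBody)
      (.seq hornerProg (.seq (block [.natConst 0 0, .natConst 12 0])
        (.loop (.natLt 12 8) trialBody)))))))

/-- The coefficients of the output as a linear combination of the rows of the sketch. -/
def coeffVec [NeZero n] (O : OSQ ε φ (A.map ((↑) : ℝ → ℂ))) (i : Fin m) (S : ℕ) (σ ξ : ℝ)
    (v : Fin S → Fin m) (c : Fin S → Fin n) : ℕ → ℝ :=
  hornerVec (gram A S (rowIdx O i v) (rowScale O i v) (colIdx c)
    (fun l => colWeight O S (rowIdx O i v) (colIdx c l)) S)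
    (bernCoeff S σ ξ (l2 (rowNorms O.bar))) S

/-- Law of the output for a given sketch. -/
def trialsLaw [NeZero n] (O : OSQ ε φ (A.map ((↑) : ℝ → ℂ))) (S : ℕ) (r : ℕ → Fin m)
    (α w : ℕ → ℝ) : PMF (Fin n) :=
  chain (fun _ => trialStep O S r α w) 0 (S ^ 2 + 1) 0

/-- Law of the sampled columns for given rows. -/
def colsLaw [NeZero n] (O : OSQ ε φ (A.map ((↑) : ℝ → ℂ))) (i : Fin m) (S : ℕ)
    (v : Fin S → Fin m) : PMF (Fin S → Fin n) :=
  iid (colLaw O S (rowIdx O i v) (initVec S)) S fun _ => 0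

/-- Law of the output. -/
def outLaw [NeZero n] (O : OSQ ε φ (A.map ((↑) : ℝ → ℂ))) (i : Fin m) (S : ℕ) (σ ξ : ℝ) :
    PMF (Fin n) :=
  (iid O.rowSampler S fun _ => i).bind fun v => (colsLaw O i S v).bind fun c =>
    trialsLaw O S (rowIdx O i v) (rowScale O i v) (coeffVec O i S σ ξ v c)

theorem det_preludeProg (O : OSQ ε φ (A.map ((↑) : ℝ → ℂ))) (τ : ℕ) (i : Fin m) (S : ℕ)
    (σ ν ξ δ : ℝ) (hS : S = sampleSize (l2 (rowNorms O.bar)) σ ν ξ) :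
    Det O τ preludeProg (inputMem m n i σ ν ξ δ φ) (fun s =>
      Consts i S (S ^ 2 + 1) σ ξ (l2 (rowNorms O.bar)) s ∧ ∀ k, s.num (ad k 3) = 0)
      (100 * (S + 1) ^ 2) := by
  set b := l2 (rowNorms O.bar) with hb
  set s₀ := inputMem m n i σ ν ξ δ φ with hs₀
  have i2 : s₀.nat 2 = i := rfl
  have x0 : s₀.num 0 = σ := rfl
  have x1 : s₀.num 1 = ν := rfl
  have x2 : s₀.num 2 = ξ := rfl
  have x9 : s₀.num 9 = 0 := by simp [hs₀, inputMem]
  have xa : ∀ k, s₀.num (ad k 3) = 0 := by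
    intro k
    simp only [hs₀, inputMem]
    rw [List.getD_eq_default _ _ (by have := le_ad k 3; simp; omega)]
    simp
  have d1 : Det O τ (block [.natConst 5 1, .queryNorm 5, .numMul 7 5 5, .numAdd 7 7 7,
      .numMul 21 5 5, .numMul 22 0 0, .numMul 22 22 2, .numMul 22 22 1, .numDiv 21 21 22,
      .numMul 21 21 21, .natConst 20 10000, .numOfNat 22 20, .numMul 20 22 21]) s₀
      (fun s => s.nat 2 = i ∧ s.nat 5 = 1 ∧ s.num 0 = σ ∧ s.num 2 = ξ ∧ s.num 5 = b ∧
        s.num 7 = ((2 * b ^ 2 : ℝ) : ℂ) ∧ s.num 9 = 0 ∧ (∀ k, s.num (ad k 3) = 0) ∧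
        s.num 20 = (((10000 : ℕ) * (b ^ 2 / (σ ^ 2 * ξ * ν)) ^ 2 : ℝ) : ℂ)) 27 := by
    refine Det.block O τ _ rfl s₀ ⟨?_, ?_, ?_, ?_, ?_, ?_, ?_, ?_, ?_⟩
    · simp [i2]
    · simp
    · simp [x0]
    · simp [x2]
    · simp [hb]
    · simp [hb]; ring
    · simp [x9]
    · simp [xa]
    · simp [x0, x1, x2, hb]; ring
  have d2 : ∀ s : Mem, (s.nat 2 = i ∧ s.nat 5 = 1 ∧ s.num 0 = σ ∧ s.num 2 = ξ ∧ s.num 5 = b ∧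
        s.num 7 = ((2 * b ^ 2 : ℝ) : ℂ) ∧ s.num 9 = 0 ∧ (∀ k, s.num (ad k 3) = 0) ∧
        s.num 20 = (((10000 : ℕ) * (b ^ 2 / (σ ^ 2 * ξ * ν)) ^ 2 : ℝ) : ℂ)) →
      Det O τ ceilProg s (fun s => s.nat 2 = i ∧ s.nat 5 = 1 ∧ s.num 0 = σ ∧ s.num 2 = ξ ∧
        s.num 5 = b ∧ s.num 7 = ((2 * b ^ 2 : ℝ) : ℂ) ∧ s.num 9 = 0 ∧
        (∀ k, s.num (ad k 3) = 0) ∧ s.nat 20 = S) (7 * S + 7) := by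
    rintro s ⟨a1, a2, a3, a4, a5, a6, a7, a8, a9⟩
    refine (det_ceilProg O τ s _ (by positivity) a9 a2).conseq ?_ (by rw [hS, sampleSize])
    rintro s' ⟨f, h⟩
    refine ⟨?_, ?_, ?_, ?_, ?_, ?_, ?_, ?_, by rw [h, hS, sampleSize]⟩
    · rw [f.nat 2 (by omega), a1]
    · rw [f.nat 5 (by omega), a2]
    · rw [f.num 0 (by omega), a3]
    · rw [f.num 2 (by omega), a4]
    · rw [f.num 5 (by omega), a5]
    · rw [f.num 7 (by omega), a6]
    · rw [f.num 9 (by omega), a7]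
    · intro k; rw [f.num _ (.inr (le_ad _ _)), a8]
  have d3 : ∀ s : Mem, (s.nat 2 = i ∧ s.nat 5 = 1 ∧ s.num 0 = σ ∧ s.num 2 = ξ ∧
        s.num 5 = b ∧ s.num 7 = ((2 * b ^ 2 : ℝ) : ℂ) ∧ s.num 9 = 0 ∧
        (∀ k, s.num (ad k 3) = 0) ∧ s.nat 20 = S) →
      Det O τ (block [.natConst 21 0, .natAdd 3 20 21, .natAdd 4 20 5, .numOfNat 6 3,
        .numSqrt 8 6, .numMul 20 6 6]) s (fun s => Consts i S (s.nat 8) σ ξ b s ∧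
          (∀ k, s.num (ad k 3) = 0) ∧ s.num 20 = (((S : ℝ) * S : ℝ) : ℂ)) 13 := by
    rintro s ⟨a1, a2, a3, a4, a5, a6, a7, a8, a9⟩
    refine Det.block O τ _ rfl s ⟨?_, ?_, ?_⟩
    · constructor <;> simp [a1, a2, a3, a4, a5, a6, a7, a9]
    · simp [a8]
    · simp [a9]
  have d4 : ∀ s : Mem, (Consts i S (s.nat 8) σ ξ b s ∧
          (∀ k, s.num (ad k 3) = 0) ∧ s.num 20 = (((S : ℝ) * S : ℝ) : ℂ)) →
      Det O τ ceilProg s (fun s => Consts i S (s.nat 8) σ ξ b s ∧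
          (∀ k, s.num (ad k 3) = 0) ∧ s.nat 20 = S ^ 2 + 1) (7 * (S ^ 2 + 1) + 7) := by
    rintro s ⟨a1, a2, a3⟩
    have hfl : ⌊(S : ℝ) * S⌋₊ = S ^ 2 := by
      rw [← Nat.cast_mul, Nat.floor_natCast, sq]
    refine (det_ceilProg O τ s _ (by positivity) a3 a1.one).conseq ?_ (by rw [hfl])
    rintro s' ⟨f, h⟩
    refine ⟨?_, ?_, by rw [h, hfl]⟩
    · rw [f.nat 8 (by omega)]; exact a1.mod (f.mod [])
    · intro k; rw [f.num _ (.inr (le_ad _ _)), a2]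
  have d5 : ∀ s : Mem, (Consts i S (s.nat 8) σ ξ b s ∧
          (∀ k, s.num (ad k 3) = 0) ∧ s.nat 20 = S ^ 2 + 1) →
      Det O τ (block [.natConst 21 0, .natAdd 8 20 21]) s (fun s =>
        Consts i S (S ^ 2 + 1) σ ξ b s ∧ ∀ k, s.num (ad k 3) = 0) 5 := by
    rintro s ⟨⟨a1, a2, a3, a4, -, a6, a7, a8, a9, a10, a11, a12⟩, b2, b3⟩
    refine Det.block O τ _ rfl s ⟨?_, ?_⟩
    · constructor <;> simp [a1, a2, a3, a4, a6, a7, a8, a9, a10, a11, a12, b3]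
    · simp [b2]
  have d := d1.seq fun s1 h1 => (d2 s1 h1).seq fun s2 h2 => (d3 s2 h2).seq fun s3 h3 =>
    (d4 s3 h3).seq d5
  refine d.conseq (fun _ h => h) ?_
  have : (S + 1) ^ 2 = S ^ 2 + 2 * S + 1 := by ring
  omega

theorem spec_mainProg [NeZero n] (O : OSQ ε φ (A.map ((↑) : ℝ → ℂ))) (τ : ℕ) (i : Fin m) (S : ℕ)
    (σ ν ξ δ : ℝ) (hS : S = sampleSize (l2 (rowNorms O.bar)) σ ν ξ) :
    Spec O τ mainProg (inputMem m n i σ ν ξ δ φ) (outLaw O i S σ ξ) (fun o s => s.nat 0 = o)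
      (2000 * (S + 1) ^ 3) := by
  set b := l2 (rowNorms O.bar) with hb
  set N := S ^ 2 + 1 with hN
  have e1 := det_preludeProg O τ i S σ ν ξ δ hS
  have e2 : ∀ s : Mem, (Consts i S N σ ξ b s ∧ ∀ k, s.num (ad k 3) = 0) →
      Det O τ firstRowProg s (RowInv O i S N σ ξ 0 fun _ => i) 87 :=
    fun s hs => det_firstRowProg O τ i s _ hs.1 hs.2
  have e3 : ∀ s : Mem, RowInv O i S N σ ξ 0 (fun _ => i) s →
      Spec O τ (.loop (.natLt 20 4) rowBody) s (iid O.rowSampler S fun _ => i)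
        (RowInv O i S N σ ξ S) (S * 201 + 1) := by
    intro s hs
    refine Spec.loop (b := .natLt 20 4) (N := S) (t := 200) ?_ ?_ ?_ S 0 (by omega) _ s hs
    · intro k v s1 hk h1
      simp only [Test.Holds, h1.ctr, h1.consts.size]; omega
    · intro k v s1 hk h1
      exact spec_rowBody O τ i s1 k hk v h1
    · intro v s1 h1
      simp [Test.Holds, h1.ctr, h1.consts.size]
  have e4 : ∀ v (s : Mem), RowInv O i S N σ ξ S v s → Det O τ (block [.natConst 10 0]) s
      (ColInv O i S N σ ξ (rowIdx O i v) (rowScale O i v) 0 fun _ => 0) 3 := by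
    intro v s hs
    refine Det.block O τ _ rfl s ⟨?_, ?_, ?_, ?_, ?_, ?_, ?_, ?_, ?_⟩
    · refine hs.consts.low (fun a _ ha => ?_) fun a ha => by simp
      have e1 : a ≠ 63 := by omega
      have e2 : a ≠ 10 := by omega
      simp [e1, e2]
    · simp
    · intro k hk; simpa using hs.row k hk
    · intro k hk; simpa using hs.scale k hk
    · intro k hk; simpa using (hs.coeff k hk).1
    · intro k _; simpa using hs.unit k
    · intro k hk; simpa using (hs.coeff k hk).2
    · intro k hk; exact absurd hk (Nat.not_lt_zero _)
    · intro k hk; exact absurd hk (Nat.not_lt_zero _)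
  have e5 : ∀ v (s : Mem), ColInv O i S N σ ξ (rowIdx O i v) (rowScale O i v) 0 (fun _ => 0) s →
      Spec O τ (.loop (.natLt 10 3) columnsBody) s (colsLaw O i S v)
        (ColInv O i S N σ ξ (rowIdx O i v) (rowScale O i v) S) (S * (250 * (S + 1) + 1) + 1) := by
    intro v s hs
    refine Spec.loop (b := .natLt 10 3) (N := S) (t := 250 * (S + 1)) ?_ ?_ ?_ S 0 (by omega) _ s hs
    · intro k c s1 hk h1
      simpa only [Test.Holds, h1.ctr, h1.consts.cols] using hk
    · intro k c s1 hk h1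
      exact spec_columnsBody O τ i _ _ s1 k hk c h1
    · intro c s1 h1
      simp [Test.Holds, h1.ctr, h1.consts.cols]
  have e6 : ∀ v c (s : Mem), ColInv O i S N σ ξ (rowIdx O i v) (rowScale O i v) S c s →
      Det O τ hornerProg s (fun s' => Consts i S N σ ξ b s' ∧
        Holds S (rowIdx O i v) (rowScale O i v) (coeffVec O i S σ ξ v c) s')
        (700 * ((S + 1) * (S + 1) * (S + 1))) := by
    intro v c s hs
    refine (det_hornerProg O τ s hs.consts ⟨hs.row, hs.scale, hs.col, hs.weight⟩ hs.coeff hs.unit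
      hs.coeff').conseq ?_ le_rfl
    rintro s' ⟨h1, h2, h3⟩
    exact ⟨h1, h1.size, h1.one, h2.row, h2.scale, h3⟩
  have e7 : ∀ v c (s : Mem), (Consts i S N σ ξ b s ∧
        Holds S (rowIdx O i v) (rowScale O i v) (coeffVec O i S σ ξ v c) s) →
      Det O τ (block [.natConst 0 0, .natConst 12 0]) s (TrialInv O i S N σ ξ (rowIdx O i v)
        (rowScale O i v) (coeffVec O i S σ ξ v c) 0 0) 5 := by
    rintro v c s ⟨h1, h2⟩
    have key : ∀ a, a ≠ 0 → a ≠ 12 → a ≠ 63 →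
        (effs O s [.natConst 0 0, .natConst 12 0]).nat a = s.nat a := by
      intro a e0 e1 e2
      simp [e0, e1, e2]
    refine Det.block O τ _ rfl s ⟨?_, ⟨?_, ?_, ?_, ?_, ?_⟩, ?_, ?_⟩
    · exact h1.low (fun a _ ha => key a (by omega) (by omega) (by omega)) fun a ha => by simp
    · rw [key 4 (by omega) (by omega) (by omega), h2.size]
    · rw [key 5 (by omega) (by omega) (by omega), h2.one]
    · intro k hk
      have := le_ad k 0
      rw [key _ (by omega) (by omega) (by omega), h2.row k hk]
    · intro k hk; simpa using h2.scale k hk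
    · intro k hk; simpa using h2.coeff k hk
    · simp
    · simp
  have e8 : ∀ v c (s : Mem), TrialInv O i S N σ ξ (rowIdx O i v)
        (rowScale O i v) (coeffVec O i S σ ξ v c) 0 0 s →
      Spec O τ (.loop (.natLt 12 8) trialBody) s (trialsLaw O S (rowIdx O i v) (rowScale O i v)
        (coeffVec O i S σ ξ v c)) (fun o s => s.nat 0 = o) (N * (250 * (S + 1) + 1) + 1) := by
    intro v c s hs
    refine (Spec.loop (b := .natLt 12 8) (N := N) (t := 250 * (S + 1))
      (κ := fun _ => trialStep O S (rowIdx O i v) (rowScale O i v) (coeffVec O i S σ ξ v c))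
      (R := TrialInv O i S N σ ξ (rowIdx O i v) (rowScale O i v) (coeffVec O i S σ ξ v c))
      ?_ ?_ ?_ N 0 (by omega) _ s hs).conseq (fun o s h => h.out) le_rfl
    · intro k c s1 hk h1
      simpa only [Test.Holds, h1.ctr, h1.consts.trials] using hk
    · intro k c s1 hk h1
      exact spec_trialBody O τ i _ _ _ s1 k c h1
    · intro c s1 h1
      simp [Test.Holds, h1.ctr, h1.consts.trials]
  have d := e1.seq_spec fun s1 h1 => (e2 s1 h1).seq_spec fun s2 h2 => (e3 s2 h2).seq fun v s3 h3 =>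
    (e4 v s3 h3).seq_spec fun s4 h4 => (e5 v s4 h4).seq fun c s5 h5 =>
    (e6 v c s5 h5).seq_spec fun s6 h6 => (e7 v c s6 h6).seq_spec (e8 v c)
  refine d.conseq (fun _ _ h => h) ?_
  have c1 : (S + 1) ^ 3 = S ^ 3 + 3 * S ^ 2 + 3 * S + 1 := by ring
  have c2 : (S + 1) ^ 2 = S ^ 2 + 2 * S + 1 := by ring
  have c3 : N * (250 * (S + 1) + 1) = 250 * S ^ 3 + 251 * S ^ 2 + 250 * S + 251 := by rw [hN]; ring
  have c4 : S * (250 * (S + 1) + 1) = 250 * S ^ 2 + 251 * S := by ring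
  have c5 : (S + 1) * (S + 1) * (S + 1) = S ^ 3 + 3 * S ^ 2 + 3 * S + 1 := by ring
  omega

/-! ### From the specification to the law of the machine -/

/-- Every step costs at most `τ + 1`, so a bound on the number of steps bounds the cost; there is no
need to count the uses of the access separately. -/
theorem Spec.endsBy {O : OSQ ε φ (A.map ((↑) : ℝ → ℂ))} {τ : ℕ} {p : Prog} {s : Mem}
    {P : PMF (Fin n)} {T : ℕ} (h : Spec O τ p s P (fun o s => s.nat 0 = o) T) {B : ℝ}
    (hB : (T * (τ + 1) : ℝ) ≤ B) : EndsBy O τ p s T B := by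
  obtain ⟨μ, -, h2, h3⟩ := h
  intro c hc
  have hl := h3.halts 0 T le_rfl
  have hmem : (c.todo, c.mem) ∈ ((law O τ ⟨[p], s, 0⟩ T).map fun c => (c.todo, c.mem)).support :=
    (PMF.mem_support_map_iff _ _ _).2 ⟨c, hc, rfl⟩
  rw [hl, PMF.mem_support_map_iff] at hmem
  obtain ⟨s', hs', heq⟩ := hmem
  rw [PMF.mem_support_map_iff] at hs'
  obtain ⟨x, hx, rfl⟩ := hs'
  obtain ⟨e1, e2⟩ := Prod.mk.inj heq
  refine ⟨e1.symm, ?_, ?_⟩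
  · have := law_cost_le O τ ⟨[p], s, 0⟩ T c hc
    rw [zero_add] at this
    exact le_trans (by exact_mod_cast this) hB
  · rw [← e2, h2 x hx]; exact x.1.2

theorem Spec.outDist_eq {O : OSQ ε φ (A.map ((↑) : ℝ → ℂ))} {τ : ℕ} {p : Prog} {s : Mem}
    {P : PMF (Fin n)} {T : ℕ} (h : Spec O τ p s P (fun o s => s.nat 0 = o) T) (j : Fin n) :
    outDist O τ p s T j = (P j).toReal := by
  obtain ⟨μ, h1, h2, h3⟩ := h
  have hl := congrArg (PMF.map fun x : List Prog × Mem => x.2.nat 0) (h3.halts 0 T le_rfl)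
  rw [PMF.map_comp, PMF.map_comp, PMF.map_comp] at hl
  have hP : μ.map (fun x => x.2.nat 0) = P.map Fin.val := by
    rw [← h1, PMF.map_comp]
    exact bind_congr_support _ fun x hx => by simp [h2 x hx]
  rw [outDist]
  change (((law O τ ⟨[p], s, 0⟩ T).map fun c => c.mem.nat 0) (j : ℕ)).toReal = _
  rw [show ((law O τ ⟨[p], s, 0⟩ T).map fun c => c.mem.nat 0) = P.map Fin.val from hl.trans hP]
  congr 1
  rw [PMF.map_apply, tsum_eq_single j]
  · simp
  · intro k hk
    rw [if_neg]
    exact fun h => hk (Fin.ext h.symm)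

end MainSpec

end RecSys

end

noncomputable section

namespace RecSys

/-! ### Functions of symmetric matrices -/

section Spectral

open Matrix

variable {ι κ : Type*} [Fintype ι] [DecidableEq ι] [Fintype κ] [DecidableEq κ]

/-- Sum of the squares of the coordinates. -/
def sumSq {ι : Type*} [Fintype ι] (v : ι → ℝ) : ℝ := ∑ i, v i ^ 2

/-- Sum of the squares of the entries. -/
def frobSq {ι κ : Type*} [Fintype ι] [Fintype κ] (Z : Matrix ι κ ℝ) : ℝ := ∑ i, ∑ j, Z i j ^ 2

theorem sumSq_nonneg {ι : Type*} [Fintype ι] (v : ι → ℝ) : 0 ≤ sumSq v :=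
  Finset.sum_nonneg fun _ _ => sq_nonneg _

theorem frobSq_nonneg {ι κ : Type*} [Fintype ι] [Fintype κ] (Z : Matrix ι κ ℝ) : 0 ≤ frobSq Z :=
  Finset.sum_nonneg fun _ _ => Finset.sum_nonneg fun _ _ => sq_nonneg _

theorem frobSq_eq_trace {ι κ : Type*} [Fintype ι] [Fintype κ] (Z : Matrix ι κ ℝ) :
    frobSq Z = (Zᵀ * Z).trace := by
  rw [frobSq, Finset.sum_comm]
  simp [Matrix.trace, Matrix.mul_apply, pow_two]

theorem sq_eq_dotProduct {ι : Type*} [Fintype ι] (v : ι → ℝ) : sumSq v = v ⬝ᵥ v := by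
  simp [sumSq, dotProduct, pow_two]

theorem sq_vecMul_le {ι κ : Type*} [Fintype ι] [Fintype κ] (v : ι → ℝ) (Z : Matrix ι κ ℝ) :
    sumSq (v ᵥ* Z) ≤ sumSq v * frobSq Z := by
  rw [frobSq, Finset.sum_comm, Finset.mul_sum]
  exact Finset.sum_le_sum fun j _ => Finset.sum_mul_sq_le_sq_mul_sq _ _ _

theorem sq_mulVec_le {ι κ : Type*} [Fintype ι] [Fintype κ] (v : κ → ℝ) (Z : Matrix ι κ ℝ) :
    sumSq (Z *ᵥ v) ≤ frobSq Z * sumSq v := by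
  rw [frobSq, Finset.sum_mul]
  exact Finset.sum_le_sum fun j _ => Finset.sum_mul_sq_le_sq_mul_sq _ _ _

theorem sq_add_le {ι : Type*} [Fintype ι] (v w : ι → ℝ) : sumSq (v + w) ≤ 2 * sumSq v + 2 * sumSq w := by
  simp only [sumSq, Finset.mul_sum, ← Finset.sum_add_distrib, Pi.add_apply]
  exact Finset.sum_le_sum fun i _ => by nlinarith [sq_nonneg (v i - w i)]

/-- Orthogonal matrix of eigenvectors. -/
abbrev evec {X : Matrix ι ι ℝ} (hX : X.IsHermitian) : Matrix ι ι ℝ := hX.eigenvectorUnitary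

theorem evec_transpose_mul {X : Matrix ι ι ℝ} (hX : X.IsHermitian) : (evec hX)ᵀ * evec hX = 1 := by
  have := Unitary.coe_star_mul_self hX.eigenvectorUnitary
  rwa [Matrix.star_eq_conjTranspose, Matrix.conjTranspose_eq_transpose_of_trivial] at this

theorem evec_mul_transpose {X : Matrix ι ι ℝ} (hX : X.IsHermitian) : evec hX * (evec hX)ᵀ = 1 := by
  have := Unitary.coe_mul_star_self hX.eigenvectorUnitary
  rwa [Unitary.coe_star, Matrix.star_eq_conjTranspose,
    Matrix.conjTranspose_eq_transpose_of_trivial] at this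

/-- The function `g` of a symmetric matrix. -/
def specFun {X : Matrix ι ι ℝ} (hX : X.IsHermitian) (g : ℝ → ℝ) : Matrix ι ι ℝ :=
  evec hX * diagonal (fun k => g (hX.eigenvalues k)) * (evec hX)ᵀ

theorem specFun_id {X : Matrix ι ι ℝ} (hX : X.IsHermitian) : specFun hX (fun y => y) = X := by
  conv_rhs => rw [hX.spectral_theorem]
  rw [Unitary.conjStarAlgAut_apply, specFun]
  rfl

theorem transpose_mul_specFun {X : Matrix ι ι ℝ} (hX : X.IsHermitian) (g : ℝ → ℝ) :
    (evec hX)ᵀ * specFun hX g = diagonal (fun k => g (hX.eigenvalues k)) * (evec hX)ᵀ := by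
  rw [specFun, ← Matrix.mul_assoc, ← Matrix.mul_assoc, evec_transpose_mul, Matrix.one_mul]

theorem specFun_mul_evec {X : Matrix ι ι ℝ} (hX : X.IsHermitian) (g : ℝ → ℝ) :
    specFun hX g * evec hX = evec hX * diagonal (fun k => g (hX.eigenvalues k)) := by
  rw [specFun, Matrix.mul_assoc, evec_transpose_mul, Matrix.mul_one]

theorem frobSq_conj {X : Matrix ι ι ℝ} {Y : Matrix κ κ ℝ} (hX : X.IsHermitian) (hY : Y.IsHermitian)
    (Z : Matrix ι κ ℝ) : frobSq ((evec hX)ᵀ * Z * evec hY) = frobSq Z := by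
  rw [frobSq_eq_trace, frobSq_eq_trace, Matrix.transpose_mul, Matrix.transpose_mul,
    Matrix.transpose_transpose]
  rw [show (evec hY)ᵀ * (Zᵀ * evec hX) * ((evec hX)ᵀ * Z * evec hY) =
    (evec hY)ᵀ * (Zᵀ * (evec hX * (evec hX)ᵀ) * Z * evec hY) by simp only [Matrix.mul_assoc],
    evec_mul_transpose, Matrix.mul_one, Matrix.trace_mul_comm, Matrix.mul_assoc,
    evec_mul_transpose, Matrix.mul_one]

/-- Lipschitz functions are Lipschitz on symmetric matrices with the Frobenius norm. -/
theorem frobSq_specFun_sub_le {X Y : Matrix ι ι ℝ} (hX : X.IsHermitian) (hY : Y.IsHermitian)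
    (g : ℝ → ℝ) (L : ℝ) (hL : ∀ x y, |g x - g y| ≤ L * |x - y|) :
    frobSq (specFun hX g - specFun hY g) ≤ L ^ 2 * frobSq (X - Y) := by
  -- Between the two eigenbases, `h(X) - h(Y)` is the overlap matrix of the bases multiplied
  -- entrywise by the differences `h(λₖ) - h(μₗ)`. Comparing `h = g` with `h = id` entry by entry
  -- gives the claim, since the Frobenius norm is invariant under the change of bases.
  have key : ∀ h : ℝ → ℝ, ∀ k l, ((evec hX)ᵀ * (specFun hX h - specFun hY h) * evec hY) k l =
      (h (hX.eigenvalues k) - h (hY.eigenvalues l)) * ((evec hX)ᵀ * evec hY) k l := by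
    intro h k l
    rw [Matrix.mul_sub, Matrix.sub_mul, transpose_mul_specFun, Matrix.mul_assoc _ (specFun hY h),
      specFun_mul_evec, Matrix.mul_assoc, ← Matrix.mul_assoc (evec hX)ᵀ (evec hY),
      Matrix.sub_apply, Matrix.diagonal_mul, Matrix.mul_diagonal]
    ring
  have hXY : X - Y = specFun hX (fun y => y) - specFun hY (fun y => y) := by
    rw [specFun_id, specFun_id]
  rw [← frobSq_conj hX hY, ← frobSq_conj hX hY (X - Y), hXY]
  simp only [frobSq, Finset.mul_sum, key, mul_pow]
  refine Finset.sum_le_sum fun k _ => Finset.sum_le_sum fun l _ => ?_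
  have h1 : (g (hX.eigenvalues k) - g (hY.eigenvalues l)) ^ 2 ≤
      L ^ 2 * (hX.eigenvalues k - hY.eigenvalues l) ^ 2 := by
    rw [← sq_abs, ← sq_abs (hX.eigenvalues k - hY.eigenvalues l), ← mul_pow]
    exact pow_le_pow_left₀ (abs_nonneg _) (hL _ _) 2
  rw [← mul_assoc]
  exact mul_le_mul_of_nonneg_right h1 (sq_nonneg _)

/-- Functions of matrices respect intertwining relations. -/
theorem specFun_intertwine {X : Matrix ι ι ℝ} {Y : Matrix κ κ ℝ} (hX : X.IsHermitian)
    (hY : Y.IsHermitian) (B : Matrix ι κ ℝ) (c : ℝ) (h : X * B = c • (B * Y)) (g : ℝ → ℝ) :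
    specFun hX g * B = B * specFun hY fun y => g (c * y) := by
  have e1 : ∀ h : ℝ → ℝ, (evec hX)ᵀ * (specFun hX h * B) * evec hY =
      diagonal (fun k => h (hX.eigenvalues k)) * ((evec hX)ᵀ * B * evec hY) := by
    intro h
    rw [← Matrix.mul_assoc, transpose_mul_specFun]
    simp only [Matrix.mul_assoc]
  have e2 : ∀ h : ℝ → ℝ, (evec hX)ᵀ * (B * specFun hY h) * evec hY =
      ((evec hX)ᵀ * B * evec hY) * diagonal (fun k => h (hY.eigenvalues k)) := by
    intro h
    rw [Matrix.mul_assoc, Matrix.mul_assoc B, specFun_mul_evec]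
    simp only [Matrix.mul_assoc]
  have e3 : ∀ k l, hX.eigenvalues k * ((evec hX)ᵀ * B * evec hY) k l =
      c * hY.eigenvalues l * ((evec hX)ᵀ * B * evec hY) k l := by
    intro k l
    have h1 := congrFun (congrFun (e1 fun y => y) k) l
    have h2 := congrFun (congrFun (e2 fun y => y) k) l
    rw [specFun_id, Matrix.diagonal_mul] at h1
    rw [specFun_id, Matrix.mul_diagonal] at h2
    rw [← h1, h, Matrix.mul_smul, Matrix.smul_mul, Matrix.smul_apply, h2, smul_eq_mul]
    ring
  have e4 : (evec hX)ᵀ * (specFun hX g * B) * evec hY =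
      (evec hX)ᵀ * (B * specFun hY fun y => g (c * y)) * evec hY := by
    rw [e1, e2]
    ext k l
    rw [Matrix.diagonal_mul, Matrix.mul_diagonal]
    rcases eq_or_ne (((evec hX)ᵀ * B * evec hY) k l) 0 with h0 | h0
    · rw [h0, mul_zero, zero_mul]
    · rw [mul_right_cancel₀ h0 (e3 k l), mul_comm]
  have e5 := congrArg (fun Z => evec hX * Z * (evec hY)ᵀ) e4
  have e6 : ∀ Z : Matrix ι κ ℝ, evec hX * ((evec hX)ᵀ * Z * evec hY) * (evec hY)ᵀ = Z := by
    intro Z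
    rw [show evec hX * ((evec hX)ᵀ * Z * evec hY) * (evec hY)ᵀ =
      (evec hX * (evec hX)ᵀ) * Z * (evec hY * (evec hY)ᵀ) by simp only [Matrix.mul_assoc],
      evec_mul_transpose, evec_mul_transpose, Matrix.one_mul, Matrix.mul_one]
  simpa only [e6] using e5

theorem sq_specFun_mulVec {X : Matrix ι ι ℝ} (hX : X.IsHermitian) (g : ℝ → ℝ) (y : ι → ℝ) :
    sumSq (specFun hX g *ᵥ y) = ∑ k, g (hX.eigenvalues k) ^ 2 * ((evec hX)ᵀ *ᵥ y) k ^ 2 := by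
  have h1 : ∀ z : ι → ℝ, sumSq (evec hX *ᵥ z) = sumSq z := by
    intro z
    rw [sq_eq_dotProduct, sq_eq_dotProduct, Matrix.dotProduct_mulVec, ← Matrix.mulVec_transpose,
      Matrix.mulVec_mulVec, evec_transpose_mul, Matrix.one_mulVec]
  rw [specFun, ← Matrix.mulVec_mulVec, ← Matrix.mulVec_mulVec, h1, sumSq]
  simp [Matrix.mulVec_diagonal, mul_pow]

theorem sq_evec_transpose_mulVec {X : Matrix ι ι ℝ} (hX : X.IsHermitian) (y : ι → ℝ) :
    sumSq ((evec hX)ᵀ *ᵥ y) = sumSq y := by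
  rw [sq_eq_dotProduct, sq_eq_dotProduct, Matrix.dotProduct_mulVec, ← Matrix.mulVec_transpose,
    Matrix.transpose_transpose, Matrix.mulVec_mulVec, evec_mul_transpose, Matrix.one_mulVec]

theorem specFun_sub {X : Matrix ι ι ℝ} (hX : X.IsHermitian) (g h : ℝ → ℝ) :
    specFun hX (fun y => g y - h y) = specFun hX g - specFun hX h := by
  simp only [specFun, ← Matrix.sub_mul, ← Matrix.mul_sub, Matrix.diagonal_sub]

theorem specFun_add {X : Matrix ι ι ℝ} (hX : X.IsHermitian) (g h : ℝ → ℝ) :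
    specFun hX (fun y => g y + h y) = specFun hX g + specFun hX h := by
  simp only [specFun, ← Matrix.add_mul, ← Matrix.mul_add, Matrix.diagonal_add]

theorem specFun_const_mul {X : Matrix ι ι ℝ} (hX : X.IsHermitian) (c : ℝ) (g : ℝ → ℝ) :
    specFun hX (fun y => c * g y) = c • specFun hX g := by
  rw [specFun, specFun, ← Matrix.smul_mul, ← Matrix.mul_smul]
  congr 2
  ext i j
  simp [Matrix.diagonal_apply]

theorem specFun_one {X : Matrix ι ι ℝ} (hX : X.IsHermitian) : specFun hX (fun _ => 1) = 1 := by
  rw [specFun, Matrix.diagonal_one, Matrix.mul_one, evec_mul_transpose]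

theorem mul_specFun {X : Matrix ι ι ℝ} (hX : X.IsHermitian) (g : ℝ → ℝ) :
    X * specFun hX g = specFun hX fun y => y * g y := by
  have hid : X * specFun hX g = specFun hX (fun y => y) * specFun hX g := by rw [specFun_id]
  rw [hid, specFun, specFun, specFun]
  rw [show evec hX * diagonal (fun k => hX.eigenvalues k) * (evec hX)ᵀ *
      (evec hX * diagonal (fun k => g (hX.eigenvalues k)) * (evec hX)ᵀ) =
    evec hX * (diagonal (fun k => hX.eigenvalues k) * (((evec hX)ᵀ * evec hX) *
      diagonal (fun k => g (hX.eigenvalues k)))) * (evec hX)ᵀ by simp only [Matrix.mul_assoc],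
    evec_transpose_mul, Matrix.one_mul, Matrix.diagonal_mul_diagonal]

/-- Functions that are close on the spectrum have close values. -/
theorem sq_specFun_sub_mulVec_le {X : Matrix ι ι ℝ} (hX : X.IsHermitian) (p g : ℝ → ℝ) (η : ℝ)
    (h : ∀ k, (p (hX.eigenvalues k) - g (hX.eigenvalues k)) ^ 2 ≤ η) (y : ι → ℝ) :
    sumSq (specFun hX p *ᵥ y - specFun hX g *ᵥ y) ≤ η * sumSq y := by
  rw [← Matrix.sub_mulVec, ← specFun_sub, sq_specFun_mulVec, ← sq_evec_transpose_mulVec hX y, sumSq,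
    Finset.mul_sum]
  exact Finset.sum_le_sum fun k _ => mul_le_mul_of_nonneg_right (h k) (sq_nonneg _)

/-- A cutoff function shrinks coordinate vectors according to the diagonal entries. -/
theorem sq_specFun_single_le {X : Matrix ι ι ℝ} (hX : X.IsHermitian) (hpos : X.PosSemidef)
    (g : ℝ → ℝ) (c : ℝ) (hg : ∀ y, 0 ≤ y → c * g y ^ 2 ≤ y) (i : ι) :
    c * sumSq (specFun hX g *ᵥ Pi.single i 1) ≤ X i i := by
  have h1 : X i i = ∑ k, hX.eigenvalues k * ((evec hX)ᵀ *ᵥ Pi.single i 1) k ^ 2 := by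
    have hid : X i i = specFun hX (fun y => y) i i := by rw [specFun_id]
    rw [hid, specFun, Matrix.mul_apply]
    simp only [Matrix.mul_diagonal, Matrix.transpose_apply,
      Matrix.mulVec_single_one, Matrix.col_apply]
    exact Finset.sum_congr rfl fun k _ => by ring
  rw [h1, sq_specFun_mulVec, Finset.mul_sum]
  refine Finset.sum_le_sum fun k _ => ?_
  rw [← mul_assoc]
  exact mul_le_mul_of_nonneg_right (hg _ (hpos.eigenvalues_nonneg k)) (sq_nonneg _)

end Spectral

end RecSys

end

noncomputable section

namespace RecSys

/-! ### The ramp and its Bernstein polynomials -/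

section Scalar

variable {σ ξ : ℝ}

theorem ramp_eq_max (σ ξ y : ℝ) : ramp σ ξ y = max 0 (min 1 ((y / σ ^ 2 - 1) / (2 * ξ))) := by
  unfold ramp
  generalize (y / σ ^ 2 - 1) / (2 * ξ) = a
  rcases le_total a 0 with h | h
  · rw [abs_of_nonpos h, abs_of_nonpos (by linarith), min_eq_right (by linarith), max_eq_left h]
    ring
  · rcases le_total a 1 with h' | h'
    · rw [abs_of_nonneg h, abs_of_nonpos (by linarith), min_eq_right h', max_eq_right h]
      ring
    · rw [abs_of_nonneg h, abs_of_nonneg (by linarith), min_eq_left h', max_eq_right zero_le_one]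
      ring

theorem ramp_nonneg (σ ξ y : ℝ) : 0 ≤ ramp σ ξ y := by
  rw [ramp_eq_max]
  exact le_max_left _ _

theorem ramp_le_one (σ ξ y : ℝ) : ramp σ ξ y ≤ 1 := by
  rw [ramp_eq_max]
  exact max_le zero_le_one (min_le_left _ _)

theorem ramp_of_le (hσ : 0 < σ) (hξ : 0 < ξ) {y : ℝ} (hy : y ≤ σ ^ 2) : ramp σ ξ y = 0 := by
  rw [ramp_eq_max, max_eq_left]
  refine (min_le_right _ _).trans (div_nonpos_of_nonpos_of_nonneg ?_ (by positivity))
  rw [sub_nonpos, div_le_one (by positivity)]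
  exact hy

theorem ramp_of_ge (hσ : 0 < σ) (hξ : 0 < ξ) {y : ℝ} (hy : σ ^ 2 * (1 + 2 * ξ) ≤ y) :
    ramp σ ξ y = 1 := by
  rw [ramp_eq_max, min_eq_left, max_eq_right zero_le_one]
  rw [le_div_iff₀ (by positivity), le_sub_iff_add_le, le_div_iff₀ (by positivity)]
  linarith

theorem ramp_lipschitz (hσ : 0 < σ) (hξ : 0 < ξ) (x y : ℝ) :
    |ramp σ ξ x - ramp σ ξ y| ≤ 1 / (2 * ξ * σ ^ 2) * |x - y| := by
  have h : |(x / σ ^ 2 - 1) / (2 * ξ) - (y / σ ^ 2 - 1) / (2 * ξ)| =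
      1 / (2 * ξ * σ ^ 2) * |x - y| := by
    conv_rhs => rw [← abs_of_pos (show 0 < 1 / (2 * ξ * σ ^ 2) by positivity), ← abs_mul]
    congr 1
    field_simp
    ring
  rw [ramp_eq_max, ramp_eq_max, ← h]
  refine (abs_max_sub_max_le_max _ _ _ _).trans ?_
  rw [sub_self, abs_zero, max_eq_right (abs_nonneg _)]
  refine (abs_min_sub_min_le_max _ _ _ _).trans ?_
  rw [sub_self, abs_zero, max_eq_right (abs_nonneg _)]

/-- The ramp vanishes up to `σ²` and is at most `1` beyond. This is the only property of the ramp
that bounds the coefficient vector. -/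
theorem sq_mul_ramp_sq_le (hσ : 0 < σ) (hξ : 0 < ξ) (y : ℝ) (hy : 0 ≤ y) :
    σ ^ 2 * ramp σ ξ y ^ 2 ≤ y := by
  rcases le_total y (σ ^ 2) with h | h
  · rw [ramp_of_le hσ hξ h]
    simpa using hy
  · have := pow_le_one₀ (n := 2) (ramp_nonneg σ ξ y) (ramp_le_one σ ξ y)
    nlinarith [sq_nonneg σ]

/-- `σ²(1 + 2ξ) ≤ (σ(1 + ξ))²`, so the ramp has reached `1` in time; and it is still `0` for all `x
≤ σ`, which is more than required. -/
theorem isSoftThreshold_ramp (hσ : 0 < σ) (hξ : 0 < ξ) (hξ1 : ξ ≤ 1 / 2) :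
    IsSoftThreshold σ ξ fun x => x * ramp σ ξ (x ^ 2) where
  above x hx := by
    rw [ramp_of_ge hσ hξ, mul_one]
    have : (σ * (1 + ξ)) ^ 2 ≤ x ^ 2 := pow_le_pow_left₀ (by positivity) hx 2
    nlinarith [sq_nonneg (σ * ξ)]
  below x hx hx1 := by
    rw [ramp_of_le hσ hξ, mul_zero]
    exact pow_le_pow_left₀ hx (by nlinarith) 2
  between x hx _ := by
    have : 0 ≤ x := le_trans (mul_nonneg hσ.le (by linarith)) hx
    exact ⟨mul_nonneg this (ramp_nonneg _ _ _), mul_le_of_le_one_right this (ramp_le_one _ _ _)⟩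

/-- Bernstein polynomials of Lipschitz functions. -/
theorem sq_bernstein_sub_le {S : ℕ} (hS : S ≠ 0) (G : ℝ → ℝ) (L : ℝ)
    (hG : ∀ x y, |G x - G y| ≤ L * |x - y|) {y : ℝ} (hy : 0 ≤ y) (hy1 : y ≤ 1) :
    (∑ t ∈ Finset.range (S + 1), G (t / S) * S.choose t * y ^ t * (1 - y) ^ (S - t) - G y) ^ 2 ≤
      L ^ 2 / (4 * S) := by
  have hp := bernstein.probability S ⟨y, hy, hy1⟩
  have hv := bernstein.variance hS ⟨y, hy, hy1⟩
  have hb : ∀ t : Fin (S + 1), 0 ≤ bernstein S t ⟨y, hy, hy1⟩ := fun t => bernstein_nonneg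
  have e : ∑ t ∈ Finset.range (S + 1), G (t / S) * S.choose t * y ^ t * (1 - y) ^ (S - t) - G y =
      ∑ t : Fin (S + 1), (G (t / S) - G y) * bernstein S t ⟨y, hy, hy1⟩ := by
    simp only [sub_mul, Finset.sum_sub_distrib, ← Finset.mul_sum, hp, mul_one, Finset.sum_range]
    simp only [bernstein_apply, mul_assoc]
  rw [e]
  -- The Bernstein polynomial is the mean of `G` at a binomial frequency with mean `y`. By
  -- Cauchy–Schwarz the squared error is at most `L²` times the variance `y (1 - y) / S ≤ 1 / (4
  -- S)`.
  have cs := Finset.sum_mul_sq_le_sq_mul_sq Finset.univ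
    (fun t : Fin (S + 1) => (G (t / S) - G y) * √(bernstein S t ⟨y, hy, hy1⟩))
    (fun t => √(bernstein S t ⟨y, hy, hy1⟩))
  simp only [mul_assoc, Real.mul_self_sqrt (hb _), mul_pow, Real.sq_sqrt (hb _), hp, mul_one] at cs
  refine cs.trans ?_
  have h1 : ∑ t : Fin (S + 1), (G (t / S) - G y) ^ 2 * bernstein S t ⟨y, hy, hy1⟩ ≤
      ∑ t : Fin (S + 1), L ^ 2 * ((y - (t : ℝ) / S) ^ 2 * bernstein S t ⟨y, hy, hy1⟩) := by
    refine Finset.sum_le_sum fun t _ => ?_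
    rw [← mul_assoc]
    refine mul_le_mul_of_nonneg_right ?_ (hb t)
    rw [← sq_abs, ← sq_abs (y - _), abs_sub_comm y, ← mul_pow]
    exact pow_le_pow_left₀ (abs_nonneg _) (hG _ _) 2
  refine h1.trans ?_
  rw [← Finset.mul_sum]
  simp only [bernstein.z] at hv
  rw [hv]
  have h4 : y * (1 - y) ≤ 1 / 4 := by nlinarith [sq_nonneg (y - 1 / 2)]
  have hS' : (0 : ℝ) < S := by positivity
  rw [div_eq_mul_inv (L ^ 2), mul_inv]
  refine mul_le_mul_of_nonneg_left ?_ (sq_nonneg _)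
  rw [div_eq_mul_inv]
  exact mul_le_mul_of_nonneg_right (by linarith) (by positivity)

/-- Scalar version of `hornerVec`. -/
def hornerFun (c : ℕ → ℝ) : ℕ → ℝ → ℝ
  | 0 => fun _ => c 0
  | t + 1 => fun y => hornerFun c t y - y * hornerFun c t y + c (t + 1) * y ^ (t + 1)

/-- Multiplying a partial sum by `1 - y` raises all its complementary exponents, so each step of the
recursion only adds one top term. The Bernstein form avoids expansion in monomials. -/
theorem hornerFun_eq (c : ℕ → ℝ) (t : ℕ) (y : ℝ) :
    hornerFun c t y = ∑ s ∈ Finset.range (t + 1), c s * y ^ s * (1 - y) ^ (t - s) := by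
  induction t with
  | zero => simp [hornerFun]
  | succ t ih =>
    rw [Finset.sum_range_succ]
    change hornerFun c t y - y * hornerFun c t y + _ = _
    rw [ih, Nat.sub_self, pow_zero, mul_one, ← one_sub_mul,
      Finset.mul_sum]
    congr 1
    refine Finset.sum_congr rfl fun s hs => ?_
    rw [Nat.sub_add_comm (by simpa [Nat.lt_succ_iff] using hs), pow_succ]
    ring

/-- The ramp has slope `1 / (2ξσ²)`; the rescaling of `[0, 2b²]` to the unit interval multiplies it
by `2b²`. -/
theorem sq_hornerFun_sub_ramp_le {S : ℕ} (hS : S ≠ 0) (hσ : 0 < σ) (hξ : 0 < ξ) (b : ℝ) {y : ℝ}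
    (hy : 0 ≤ y) (hy1 : y ≤ 1) :
    (hornerFun (bernCoeff S σ ξ b) S y - ramp σ ξ (2 * b ^ 2 * y)) ^ 2 ≤
      (b ^ 2 / (ξ * σ ^ 2)) ^ 2 / (4 * S) := by
  have h := sq_bernstein_sub_le hS (fun y => ramp σ ξ (2 * b ^ 2 * y)) (b ^ 2 / (ξ * σ ^ 2))
    (fun x y => by
      refine (ramp_lipschitz hσ hξ _ _).trans (le_of_eq ?_)
      rw [← mul_sub, abs_mul, abs_of_nonneg (by positivity : 0 ≤ 2 * b ^ 2)]
      field_simp) hy hy1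
  rw [hornerFun_eq]
  convert h using 5 with t _
  rw [bernCoeff]
  ring_nf

end Scalar

/-! ### Singular value transformation of a row -/

section Transform

open Matrix

variable {m n : ℕ}

/-- In the eigenbasis of `AᵀA`, a singular value `s` contributes `s g(s²) s⁻¹ A v vᵀ = g(s²) A v
vᵀ`. At `s = 0` the left side vanishes by convention, and `g 0 = 0` makes the right side vanish too.
-/
theorem svt_eq_mul_specFun (A : Matrix (Fin m) (Fin n) ℝ) (g : ℝ → ℝ) (hg : g 0 = 0) :
    svt (fun x => x * g (x ^ 2)) A = A * specFun (isHermitian_conjTranspose_mul_self A) g := by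
  have hpos := (posSemidef_conjTranspose_mul_self A).eigenvalues_nonneg
  ext i j
  rw [svt, specFun, ← Matrix.mul_assoc, Matrix.mul_apply, Matrix.sum_apply]
  refine Finset.sum_congr rfl fun k _ => ?_
  rw [← Matrix.mul_assoc, Matrix.mul_diagonal, Matrix.smul_apply, Matrix.vecMulVec_apply,
    Matrix.transpose_apply, Real.sq_sqrt (hpos k), Pi.smul_apply, smul_eq_mul, smul_eq_mul,
    Matrix.mul_apply]
  simp only [evec, Matrix.IsHermitian.eigenvectorUnitary_apply, mulVec, dotProduct]
  have key : ∀ l : ℝ, 0 ≤ l → ∀ a b : ℝ, √l * g l * ((√l)⁻¹ * a * b) = a * g l * b := by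
    intro l hl a b
    rcases hl.eq_or_lt with h | h
    · simp [← h, hg]
    · have := (Real.sqrt_pos.2 h).ne'
      field_simp
  exact key _ (hpos k) _ _

end Transform

end RecSys

end

noncomputable section

namespace RecSys

/-! ### Error of the sketched transformation -/

section Sketch

open Matrix

theorem specFun_transpose {ι : Type*} [Fintype ι] [DecidableEq ι] {X : Matrix ι ι ℝ}
    (hX : X.IsHermitian) (g : ℝ → ℝ) : (specFun hX g)ᵀ = specFun hX g := by
  rw [specFun, Matrix.transpose_mul, Matrix.transpose_mul, Matrix.transpose_transpose,
    Matrix.diagonal_transpose, Matrix.mul_assoc]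

theorem vecMul_specFun {ι : Type*} [Fintype ι] [DecidableEq ι] {X : Matrix ι ι ℝ}
    (hX : X.IsHermitian) (g : ℝ → ℝ) (v : ι → ℝ) : v ᵥ* specFun hX g = specFun hX g *ᵥ v := by
  rw [← Matrix.mulVec_transpose, specFun_transpose]

variable {ι κ μ : Type*} [Fintype ι] [DecidableEq ι] [Fintype κ] [Fintype μ]

/-- `R g(RᵀR) = g(RRᵀ) R` by the intertwining relation `(RRᵀ) R = R (RᵀR)`. It replaces a function
of an `n × n` matrix by one of size `S + 1`, and exhibits the result as a combination of the rows of
`R`. -/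
theorem row_vecMul_specFun [DecidableEq κ] (R : Matrix ι κ ℝ) (g : ℝ → ℝ) (k : ι) :
    R k ᵥ* specFun (isHermitian_conjTranspose_mul_self R) g =
      (specFun (isHermitian_mul_conjTranspose_self R) g *ᵥ Pi.single k 1) ᵥ* R := by
  have h := specFun_intertwine (isHermitian_mul_conjTranspose_self R)
    (isHermitian_conjTranspose_mul_self R) R 1 (by rw [one_smul, Matrix.mul_assoc]) g
  simp only [one_mul] at h
  rw [← vecMul_specFun, Matrix.vecMul_vecMul, h, ← Matrix.vecMul_vecMul, Matrix.single_one_vecMul]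
  rfl

/-- Two errors are added: `p` against `g(b ·)` on the spectrum of `FFᵀ`, which lies in `[0, ‖F‖²]`
because the trace is `‖F‖²`, and `g(b FFᵀ)` against `g(RRᵀ)` by the Lipschitz property. The scaling
`b` is moved into the function by intertwining with the identity matrix. -/
theorem sq_specFun_sub_specFun_le (R : Matrix ι κ ℝ) (F : Matrix ι μ ℝ) (p g : ℝ → ℝ) (η ℓ b : ℝ)
    (hp : ∀ y, 0 ≤ y → y ≤ frobSq F → (p y - g (b * y)) ^ 2 ≤ η)
    (hg : ∀ x y, |g x - g y| ≤ ℓ * |x - y|) (k : ι) :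
    sumSq (specFun (isHermitian_mul_conjTranspose_self F) p *ᵥ Pi.single k 1 -
        specFun (isHermitian_mul_conjTranspose_self R) g *ᵥ Pi.single k 1) ≤
      2 * η + 2 * (ℓ ^ 2 * frobSq (b • (F * Fᴴ) - R * Rᴴ)) := by
  have hF := isHermitian_mul_conjTranspose_self F
  have hb : (b • (F * Fᴴ)).IsHermitian := by
    rw [Matrix.IsHermitian, Matrix.conjTranspose_smul, hF.eq, star_trivial]
  have h1 : specFun hb g = specFun hF fun y => g (b * y) := by
    have := specFun_intertwine hb hF 1 b (by rw [Matrix.mul_one, Matrix.one_mul]) g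
    rwa [Matrix.mul_one, Matrix.one_mul] at this
  have hpos := (posSemidef_self_mul_conjTranspose F).eigenvalues_nonneg
  have htr : ∑ k, hF.eigenvalues k = frobSq F := by
    have := hF.trace_eq_sum_eigenvalues
    simp only [RCLike.ofReal_real_eq_id, id] at this
    rw [← this, frobSq_eq_trace, Matrix.trace_mul_comm, conjTranspose_eq_transpose_of_trivial]
  have hone : sumSq (Pi.single k 1 : ι → ℝ) = 1 := by
    rw [sumSq, Finset.sum_eq_single k] <;> simp +contextual
  have h2 := sq_specFun_sub_mulVec_le hF p (fun y => g (b * y)) η (fun k => hp _ (hpos k) (by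
    rw [← htr]
    exact Finset.single_le_sum (fun k _ => hpos k) (Finset.mem_univ k))) (Pi.single k 1)
  have h3 := sq_mulVec_le (Pi.single k 1)
    (specFun hb g - specFun (isHermitian_mul_conjTranspose_self R) g)
  have h4 := frobSq_specFun_sub_le hb (isHermitian_mul_conjTranspose_self R) g ℓ hg
  have h5 := sq_add_le (specFun hF p *ᵥ Pi.single k 1 -
    specFun hF (fun y => g (b * y)) *ᵥ Pi.single k 1) (specFun hb g *ᵥ Pi.single k 1 -
        specFun (isHermitian_mul_conjTranspose_self R) g *ᵥ Pi.single k 1)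
  rw [hone, mul_one] at h2 h3
  rw [Matrix.sub_mulVec] at h3
  rw [← h1, sub_add_sub_cancel] at h5
  rw [← h1] at h2
  linarith

/-- Since `R k = A i`, the vector `A i g(RᵀR)` equals `(g(RRᵀ) eₖ)ᵀ R`. It serves as an intermediate
point between the target and `uᵀR`. -/
theorem sq_vecMul_sub_le [DecidableEq κ] (A : Matrix μ κ ℝ) (R : Matrix ι κ ℝ) (g : ℝ → ℝ) (ℓ : ℝ)
    (hg : ∀ x y, |g x - g y| ≤ ℓ * |x - y|) (i : μ) (k : ι) (hk : R k = A i) (u : ι → ℝ) :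
    sumSq (u ᵥ* R - A i ᵥ* specFun (isHermitian_conjTranspose_mul_self A) g) ≤
      2 * (sumSq (A i) * (ℓ ^ 2 * frobSq (Rᴴ * R - Aᴴ * A))) +
        2 * (sumSq (u - specFun (isHermitian_mul_conjTranspose_self R) g *ᵥ Pi.single k 1) *
          frobSq R) := by
  have h1 := sq_vecMul_le (A i) (specFun (isHermitian_conjTranspose_mul_self R) g -
    specFun (isHermitian_conjTranspose_mul_self A) g)
  have h2 := frobSq_specFun_sub_le (isHermitian_conjTranspose_mul_self R)
    (isHermitian_conjTranspose_mul_self A) g ℓ hg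
  have h3 := sq_vecMul_le
    (u - specFun (isHermitian_mul_conjTranspose_self R) g *ᵥ Pi.single k 1) R
  have h4 := sq_add_le (A i ᵥ* (specFun (isHermitian_conjTranspose_mul_self R) g -
    specFun (isHermitian_conjTranspose_mul_self A) g))
    ((u - specFun (isHermitian_mul_conjTranspose_self R) g *ᵥ Pi.single k 1) ᵥ* R)
  have h5 : u ᵥ* R - A i ᵥ* specFun (isHermitian_conjTranspose_mul_self A) g =
      A i ᵥ* (specFun (isHermitian_conjTranspose_mul_self R) g -
        specFun (isHermitian_conjTranspose_mul_self A) g) +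
      (u - specFun (isHermitian_mul_conjTranspose_self R) g *ᵥ Pi.single k 1) ᵥ* R := by
    rw [Matrix.sub_vecMul, ← row_vecMul_specFun, hk, Matrix.vecMul_sub]
    abel
  rw [h5]
  have := mul_le_mul_of_nonneg_left h2 (sumSq_nonneg (A i))
  linarith

/-- `c g² ≤ id` on the spectrum gives `c eₖᵀ g(RRᵀ)² eₖ ≤ (RRᵀ)ₖₖ`. For the row `i` on top of the
sketch the right side is `‖Aᵢ‖²`, whatever rows were sampled. -/
theorem mul_sq_specFun_single_le (R : Matrix ι κ ℝ) (g : ℝ → ℝ) (c : ℝ)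
    (hg : ∀ y, 0 ≤ y → c * g y ^ 2 ≤ y) (k : ι) :
    c * sumSq (specFun (isHermitian_mul_conjTranspose_self R) g *ᵥ Pi.single k 1) ≤ sumSq (R k) := by
  refine (sq_specFun_single_le _ (posSemidef_self_mul_conjTranspose R) g c hg k).trans
    (le_of_eq ?_)
  simp [Matrix.mul_apply, sumSq, pow_two]

end Sketch

/-! ### The coefficient vector as a matrix function -/

section Horner

open Matrix

variable {S : ℕ}

theorem powVec_eq (Y : (ℕ → ℝ) → ℕ → ℝ) {M : Matrix (Fin (S + 1)) (Fin (S + 1)) ℝ}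
    (hM : M.IsHermitian) (hY : ∀ u (k : Fin (S + 1)), Y u k = (M *ᵥ fun k' => u k') k) (t : ℕ) :
    (fun k : Fin (S + 1) => powVec Y t k) = specFun hM (fun y => y ^ t) *ᵥ Pi.single 0 1 := by
  induction t with
  | zero =>
    simp only [pow_zero, specFun_one, Matrix.one_mulVec]
    funext k
    simp [powVec, unitVec, Pi.single_apply]
  | succ t ih =>
    funext k
    rw [powVec, hY, ih, Matrix.mulVec_mulVec, mul_specFun]
    simp only [pow_succ']

/-- The recursion for vectors is the scalar recursion carried through the functional calculus, so an
error bound on the spectrum bounds the error of the computed vector. -/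
theorem hornerVec_eq (Y : (ℕ → ℝ) → ℕ → ℝ) {M : Matrix (Fin (S + 1)) (Fin (S + 1)) ℝ}
    (hM : M.IsHermitian) (hY : ∀ u (k : Fin (S + 1)), Y u k = (M *ᵥ fun k' => u k') k) (c : ℕ → ℝ)
    (t : ℕ) : (fun k : Fin (S + 1) => hornerVec Y c t k) =
      specFun hM (hornerFun c t) *ᵥ Pi.single 0 1 := by
  induction t with
  | zero =>
    have : hornerFun c 0 = fun y => c 0 * 1 := by
      funext y
      rw [mul_one, hornerFun]
    rw [this, specFun_const_mul, specFun_one, Matrix.smul_mulVec, Matrix.one_mulVec]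
    funext k
    simp [hornerVec, unitVec, Pi.single_apply]
  | succ t ih =>
    have h1 : hornerFun c (t + 1) = fun y =>
        (hornerFun c t y - y * hornerFun c t y) + c (t + 1) * y ^ (t + 1) := rfl
    rw [h1, specFun_add, specFun_sub, specFun_const_mul, ← mul_specFun, Matrix.add_mulVec,
      Matrix.sub_mulVec, Matrix.smul_mulVec, ← Matrix.mulVec_mulVec, ← ih, ← powVec_eq Y hM hY]
    funext k
    simp only [hornerVec, hY, Pi.add_apply, Pi.sub_apply, Pi.smul_apply, smul_eq_mul, powVec]

variable {m n : ℕ}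

/-- The rows of the sketch as a matrix. -/
def sketch (A : Matrix (Fin m) (Fin n) ℝ) (S : ℕ) (r : ℕ → Fin m) (α : ℕ → ℝ) :
    Matrix (Fin (S + 1)) (Fin n) ℝ := fun k j => α k * A (r k) j

/-- Selected columns of the sketch, rescaled. -/
def subsketch (A : Matrix (Fin m) (Fin n) ℝ) (S : ℕ) (r : ℕ → Fin m) (α : ℕ → ℝ) (c : ℕ → Fin n)
    (β : ℕ → ℝ) (L : ℕ) : Matrix (Fin (S + 1)) (Fin L) ℝ :=
  fun k l => √(β l) * sketch A S r α k (c l)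

theorem gram_eq (A : Matrix (Fin m) (Fin n) ℝ) (r : ℕ → Fin m) (α : ℕ → ℝ) (c : ℕ → Fin n)
    (β : ℕ → ℝ) (hβ : ∀ l, 0 ≤ β l) (L : ℕ) (u : ℕ → ℝ) (k : Fin (S + 1)) :
    gram A S r α c β L u k = ((subsketch A S r α c β L * (subsketch A S r α c β L)ᴴ) *ᵥ
      fun k' => u k') k := by
  rw [← Matrix.mulVec_mulVec, gram, Finset.sum_range, mulVec, dotProduct]
  refine Finset.sum_congr rfl fun l _ => ?_
  rw [mulVec, dotProduct, gather, Finset.sum_range]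
  simp only [subsketch, sketch, conjTranspose_apply, star_trivial, Finset.sum_mul, Finset.mul_sum]
  refine Finset.sum_congr rfl fun k' _ => ?_
  have := Real.mul_self_sqrt (hβ l)
  calc _ = (√(β l) * √(β l)) * (α k * A (r k) (c l) * (α k' * A (r k') (c l) * u k')) := by
        rw [this]; ring
    _ = _ := by ring

theorem sq_fin_succ (u : ℕ → ℝ) :
    sumSq (fun k : Fin (S + 1) => u k) = ∑ k ∈ Finset.range (S + 1), u k ^ 2 := by
  rw [sumSq, Finset.sum_range]

theorem comb_eq_vecMul (A : Matrix (Fin m) (Fin n) ℝ) (r : ℕ → Fin m) (α w : ℕ → ℝ) (j : Fin n) :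
    comb A S r α w j = ((fun k : Fin (S + 1) => w k) ᵥ* sketch A S r α) j := by
  rw [comb, Finset.sum_range, vecMul, dotProduct]
  exact Finset.sum_congr rfl fun k _ => by rw [sketch, mul_assoc]

end Horner

end RecSys

end

noncomputable section

namespace RecSys

/-! ### Expectations with respect to finite distributions -/

section Expectation

variable {α β : Type*} [Fintype α] [Fintype β]

/-- Expectation. -/
def expect (P : PMF α) (f : α → ℝ) : ℝ := ∑ a, (P a).toReal * f a

theorem sum_toReal (P : PMF α) : ∑ a, (P a).toReal = 1 := by
  have h := P.tsum_coe
  rw [tsum_fintype] at h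
  rw [← ENNReal.toReal_sum fun a _ => P.apply_ne_top a, h, ENNReal.toReal_one]

theorem toReal_bind {γ : Type*} (P : PMF α) (f : α → PMF γ) (c : γ) :
    ((P.bind f) c).toReal = expect P fun a => (f a c).toReal := by
  rw [PMF.bind_apply, tsum_fintype, ENNReal.toReal_sum, expect]
  · simp only [ENNReal.toReal_mul]
  · exact fun a _ => ENNReal.mul_ne_top (P.apply_ne_top a) ((f a).apply_ne_top c)

theorem expect_bind (P : PMF α) (f : α → PMF β) (h : β → ℝ) :
    expect (P.bind f) h = expect P fun a => expect (f a) h := by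
  simp only [expect, toReal_bind, Finset.sum_mul, Finset.mul_sum]
  rw [Finset.sum_comm]
  exact Finset.sum_congr rfl fun _ _ => Finset.sum_congr rfl fun _ _ => mul_assoc _ _ _

theorem expect_pure (a : α) (h : α → ℝ) : expect (PMF.pure a) h = h a := by
  rw [expect, Finset.sum_eq_single a]
  · simp
  · intro b _ hb
    simp [hb]
  · simp

theorem expect_map (P : PMF α) (f : α → β) (h : β → ℝ) :
    expect (P.map f) h = expect P fun a => h (f a) := by
  rw [← PMF.bind_pure_comp, expect_bind]
  simp only [Function.comp_apply, expect_pure]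

theorem expect_mono (P : PMF α) {f g : α → ℝ} (h : ∀ a, f a ≤ g a) : expect P f ≤ expect P g :=
  Finset.sum_le_sum fun a _ => mul_le_mul_of_nonneg_left (h a) ENNReal.toReal_nonneg

theorem expect_const (P : PMF α) (c : ℝ) : expect P (fun _ => c) = c := by
  rw [expect, ← Finset.sum_mul, sum_toReal, one_mul]

theorem expect_add (P : PMF α) (f g : α → ℝ) :
    expect P (fun a => f a + g a) = expect P f + expect P g := by
  simp only [expect, mul_add, Finset.sum_add_distrib]

theorem expect_sub (P : PMF α) (f g : α → ℝ) :
    expect P (fun a => f a - g a) = expect P f - expect P g := by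
  simp only [expect, mul_sub, Finset.sum_sub_distrib]

theorem expect_const_mul (P : PMF α) (c : ℝ) (f : α → ℝ) :
    expect P (fun a => c * f a) = c * expect P f := by
  simp only [expect, Finset.mul_sum]
  exact Finset.sum_congr rfl fun _ _ => by ring

theorem expect_mul_const (P : PMF α) (c : ℝ) (f : α → ℝ) :
    expect P (fun a => f a * c) = expect P f * c := by
  simp only [mul_comm _ c, expect_const_mul]

theorem expect_sum {γ : Type*} (P : PMF α) (s : Finset γ) (f : γ → α → ℝ) :
    expect P (fun a => ∑ c ∈ s, f c a) = ∑ c ∈ s, expect P (f c) := by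
  simp only [expect, Finset.mul_sum]
  exact Finset.sum_comm

theorem expect_nonneg (P : PMF α) {f : α → ℝ} (h : ∀ a, 0 ≤ f a) : 0 ≤ expect P f :=
  Finset.sum_nonneg fun a _ => mul_nonneg ENNReal.toReal_nonneg (h a)

theorem abs_expect_sub_le (P : PMF α) (p : α → ℝ) (f : α → ℝ) (C : ℝ) (hf : ∀ a, |f a| ≤ C) :
    |expect P f - ∑ a, p a * f a| ≤ (∑ a, |(P a).toReal - p a|) * C := by
  rw [expect, ← Finset.sum_sub_distrib, Finset.sum_mul]
  refine (Finset.abs_sum_le_sum_abs _ _).trans (Finset.sum_le_sum fun a _ => ?_)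
  rw [← sub_mul, abs_mul]
  exact mul_le_mul_of_nonneg_left (hf a) (abs_nonneg _)

end Expectation

/-! ### Means of independent samples -/

section Iid

variable {α : Type} [Fintype α] {S : ℕ}

theorem expect_chain_iidStep_succ (P : PMF α) (v : Fin S → α) (r : ℕ) (hr : r < S)
    (F : (Fin S → α) → ℝ) :
    expect (chain (iidStep P S) 0 (r + 1) v) F =
      expect (chain (iidStep P S) 0 r v) fun u =>
        expect P fun x => F (Function.update u ⟨r, hr⟩ x) := by
  rw [chain_succ, expect_bind]
  congr 1
  funext u
  rw [iidStep, Nat.zero_add, dif_pos hr, expect_map]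

theorem sum_update_eq {α : Type} (u : Fin S → α) (g : α → ℝ) (r : ℕ) (hr : r < S) (x : α) :
    ∑ l with l.1 < r + 1, g (Function.update u ⟨r, hr⟩ x l) = (∑ l with l.1 < r, g (u l)) + g x := by
  have : (Finset.univ.filter fun l : Fin S => l.1 < r + 1) =
      insert ⟨r, hr⟩ (Finset.univ.filter fun l : Fin S => l.1 < r) := by
    ext l
    simp only [Finset.mem_filter, Finset.mem_univ, true_and, Finset.mem_insert, Fin.ext_iff]
    omega
  rw [this, Finset.sum_insert (by simp), Function.update_self, add_comm]
  congr 1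
  refine Finset.sum_congr rfl fun l hl => ?_
  rw [Function.update_of_ne]
  intro h
  simp [h] at hl

theorem expect_chain_sum (P : PMF α) (v : Fin S → α) (g : α → ℝ) (r : ℕ) (hr : r ≤ S) :
    expect (chain (iidStep P S) 0 r v) (fun u => ∑ l with l.1 < r, g (u l)) = r * expect P g := by
  induction r with
  | zero => simp [expect]
  | succ r ih =>
    rw [expect_chain_iidStep_succ P v r hr]
    simp only [sum_update_eq, expect_add, expect_const, ih (by omega)]
    push_cast
    ring

theorem expect_chain_sum_sq (P : PMF α) (v : Fin S → α) (g : α → ℝ) (r : ℕ) (hr : r ≤ S) :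
    expect (chain (iidStep P S) 0 r v) (fun u => (∑ l with l.1 < r, g (u l)) ^ 2) =
      r * (r - 1) * expect P g ^ 2 + r * expect P fun x => g x ^ 2 := by
  induction r with
  | zero => simp [expect]
  | succ r ih =>
    rw [expect_chain_iidStep_succ P v r hr]
    simp only [sum_update_eq, add_sq, expect_add, expect_const, expect_const_mul,
      expect_mul_const, ih (by omega), expect_chain_sum P v g r (by omega)]
    push_cast
    ring

theorem expect_iid_sum (P : PMF α) (v : Fin S → α) (g : α → ℝ) :
    expect (iid P S v) (fun u => ∑ l, g (u l)) = S * expect P g := by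
  rw [iid, ← expect_chain_sum P v g S le_rfl]
  simp

/-- Squared bias plus variance; the variance of one sample is bounded by its second moment. -/
theorem expect_iid_mean_sq (hS : S ≠ 0) (P : PMF α) (v : Fin S → α) (h : α → ℝ) (T : ℝ) :
    expect (iid P S v) (fun u => (1 / S * ∑ l, h (u l) - T) ^ 2) ≤
      (expect P h - T) ^ 2 + 1 / S * expect P fun x => h x ^ 2 := by
  have hS' : (0 : ℝ) < S := by positivity
  have h1 := expect_chain_sum_sq P v (fun x => h x - T) S le_rfl
  simp only [Fin.is_lt, Finset.filter_true] at h1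
  have h2 : (fun u : Fin S → α => (1 / (S : ℝ) * ∑ l, h (u l) - T) ^ 2) =
      fun u => 1 / (S : ℝ) ^ 2 * (∑ l, (h (u l) - T)) ^ 2 := by
    funext u
    simp only [Finset.sum_sub_distrib, Finset.sum_const, Finset.card_univ, Fintype.card_fin,
      nsmul_eq_mul]
    field_simp
  rw [h2, expect_const_mul, iid, h1]
  have h3 : expect P (fun x => (h x - T) ^ 2) =
      expect P (fun x => h x ^ 2) - 2 * T * expect P h + T ^ 2 := by
    simp only [sub_sq, expect_add, expect_sub, expect_const, expect_mul_const, expect_const_mul]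
    ring
  rw [expect_sub, expect_const, h3]
  have h4 : 1 / (S : ℝ) ^ 2 * (S * (S - 1) * (expect P h - T) ^ 2 +
      S * (expect P (fun x => h x ^ 2) - 2 * T * expect P h + T ^ 2)) =
      (expect P h - T) ^ 2 + 1 / S * (expect P (fun x => h x ^ 2)) - 1 / S * expect P h ^ 2 := by
    field_simp
    ring
  rw [h4]
  have : 0 ≤ 1 / (S : ℝ) * expect P h ^ 2 := by positivity
  linarith

/-- Mean square error of the mean of independent samples from an approximate distribution. -/
theorem expect_iid_sum_mean_sq_le {β : Type*} [Fintype β] (hS : S ≠ 0) (P : PMF α)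
    (v : Fin S → α) (p : α → ℝ) (ε B : ℝ) (hp : ∑ a, |(P a).toReal - p a| ≤ 2 * ε)
    (X : α → β → ℝ) (hX : ∀ a, ∑ b, X a b ^ 2 ≤ B) :
    expect (iid P S v) (fun u => ∑ b, (1 / S * ∑ l, X (u l) b - ∑ a, p a * X a b) ^ 2) ≤
      (4 * ε ^ 2 + 1 / S) * B := by
  have hS' : (0 : ℝ) < S := by positivity
  have hd0 : 0 ≤ ∑ a, |(P a).toReal - p a| := Finset.sum_nonneg fun _ _ => abs_nonneg _
  have hB : ∀ q : α → ℝ, (∀ a, 0 ≤ q a) →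
      ∑ b, ∑ a, q a * X a b ^ 2 ≤ (∑ a, q a) * B := by
    intro q hq
    rw [Finset.sum_comm, Finset.sum_mul]
    refine Finset.sum_le_sum fun a _ => ?_
    rw [← Finset.mul_sum]
    exact mul_le_mul_of_nonneg_left (hX a) (hq a)
  -- The bias term. Cauchy–Schwarz with the weights `|P - p|`, whose total is at most `2ε`, produces
  -- `4ε²` times the uniform bound `B`, independently of the number of coordinates.
  have h1 : ∑ b, (expect P (fun a => X a b) - ∑ a, p a * X a b) ^ 2 ≤ 4 * ε ^ 2 * B := by
    have h2 : ∀ b, (expect P (fun a => X a b) - ∑ a, p a * X a b) ^ 2 ≤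
        (∑ a, |(P a).toReal - p a|) * ∑ a, |(P a).toReal - p a| * X a b ^ 2 := by
      intro b
      have e : expect P (fun a => X a b) - ∑ a, p a * X a b =
          ∑ a, ((P a).toReal - p a) * X a b := by
        rw [expect, ← Finset.sum_sub_distrib]
        exact Finset.sum_congr rfl fun _ _ => (sub_mul _ _ _).symm
      have cs := Finset.sum_mul_sq_le_sq_mul_sq Finset.univ (fun a => √|(P a).toReal - p a|)
        (fun a => √|(P a).toReal - p a| * |X a b|)
      simp only [mul_pow, Real.sq_sqrt (abs_nonneg _), sq_abs, ← mul_assoc,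
        Real.mul_self_sqrt (abs_nonneg _)] at cs
      refine le_trans ?_ cs
      rw [e, ← sq_abs]
      refine pow_le_pow_left₀ (abs_nonneg _) ?_ 2
      refine (Finset.abs_sum_le_sum_abs _ _).trans (le_of_eq ?_)
      exact Finset.sum_congr rfl fun _ _ => abs_mul _ _
    refine (Finset.sum_le_sum fun b _ => h2 b).trans ?_
    rw [← Finset.mul_sum]
    have h3 := hB _ fun a => abs_nonneg ((P a).toReal - p a)
    rcases isEmpty_or_nonempty α with hα | ⟨⟨a₀⟩⟩
    · have := sum_toReal P
      simp at this
    have hB0 : 0 ≤ B := (Finset.sum_nonneg fun _ _ => sq_nonneg _).trans (hX a₀)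
    calc _ ≤ (∑ a, |(P a).toReal - p a|) * ((∑ a, |(P a).toReal - p a|) * B) :=
          mul_le_mul_of_nonneg_left h3 hd0
      _ = (∑ a, |(P a).toReal - p a|) ^ 2 * B := by ring
      _ ≤ (2 * ε) ^ 2 * B := mul_le_mul_of_nonneg_right (pow_le_pow_left₀ hd0 hp 2) hB0
      _ = _ := by ring
  have h4 : ∑ b, expect P (fun x => X x b ^ 2) ≤ B := by
    have := hB (fun a => (P a).toReal) fun a => ENNReal.toReal_nonneg
    rwa [sum_toReal, one_mul] at this
  rw [expect_sum]
  refine (Finset.sum_le_sum fun b _ => expect_iid_mean_sq hS P v (fun a => X a b) _).trans ?_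
  rw [Finset.sum_add_distrib, ← Finset.mul_sum, add_mul]
  exact add_le_add h1 (mul_le_mul_of_nonneg_left h4 (by positivity))

end Iid

end RecSys

end

noncomputable section

namespace RecSys

/-! ### Laws of the sampled columns and of the rejection sampling -/

section Rejection

theorem toReal_coin_bind {γ : Type*} {p : ℝ} (h0 : 0 ≤ p) (h1 : p ≤ 1) (f : ℕ → PMF γ) (c : γ) :
    (((coin p).bind f) c).toReal = p * (f 1 c).toReal + (1 - p) * (f 0 c).toReal := by
  have hp : min (ENNReal.ofReal p) 1 = ENNReal.ofReal p := min_eq_left (by simpa using h1)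
  rw [coin, PMF.bind_map, toReal_bind, expect, Fintype.sum_bool]
  simp only [PMF.ofFintype_apply, cond_true, cond_false, Function.comp_apply, hp]
  rw [ENNReal.toReal_ofReal h0, ENNReal.toReal_sub_of_le (by simpa using h1) ENNReal.one_ne_top,
    ENNReal.toReal_ofReal h0, ENNReal.toReal_one]

/-- Reservoir sampling: the last index wins with its share of the total, and otherwise the earlier
choice is kept. The identity is stated without division so that it remains valid when all weights
vanish. -/
theorem toReal_pickChain_bind {γ : Type*} (w : ℕ → ℝ) (f : ℕ → PMF γ) (c : γ) (r : ℕ) :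
    (((chain (pickStep w) 0 r 0).bind f) c).toReal * ∑ k ∈ Finset.range r, w k ^ 2 =
      ∑ k ∈ Finset.range r, w k ^ 2 * (f k c).toReal := by
  induction r with
  | zero => simp
  | succ r ih =>
    have hW : 0 ≤ ∑ k ∈ Finset.range r, w k ^ 2 := Finset.sum_nonneg fun _ _ => sq_nonneg _
    have hr : 0 ≤ w r ^ 2 := sq_nonneg _
    have e : (chain (pickStep w) 0 (r + 1) 0).bind f =
        (coin (w r ^ 2 / ∑ k' ∈ Finset.range (r + 1), w k' ^ 2)).bind fun b =>
          (chain (pickStep w) 0 r 0).bind fun pick => f (if b = 1 then r else pick) := by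
      rw [chain_succ, PMF.bind_bind, PMF.bind_comm]
      simp only [pickStep, Nat.zero_add, PMF.bind_map]
      rfl
    rw [e, Finset.sum_range_succ, Finset.sum_range_succ, ← ih, toReal_coin_bind (by positivity)
      (div_le_one_of_le₀ (by linarith) (by linarith))]
    simp only [if_true, zero_ne_one, if_false, PMF.bind_const]
    rcases eq_or_ne ((∑ k ∈ Finset.range r, w k ^ 2) + w r ^ 2) 0 with h | h
    · rw [show w r ^ 2 = 0 by linarith, show ∑ k ∈ Finset.range r, w k ^ 2 = 0 by linarith]
      ring
    · field_simp
      ring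

variable {ε φ : ℝ} {m n : ℕ}

theorem toReal_colLaw_mul {A : Matrix (Fin m) (Fin n) ℂ} (O : OSQ ε φ A) (S : ℕ) (r : ℕ → Fin m)
    (w : ℕ → ℝ) (j : Fin n) :
    (colLaw O S r w j).toReal * ∑ k ∈ Finset.range (S + 1), w k ^ 2 =
      ∑ k ∈ Finset.range (S + 1), w k ^ 2 * (O.colSampler (r k) j).toReal :=
  toReal_pickChain_bind w _ j (S + 1)

theorem sqDist_bar {A : Matrix (Fin m) (Fin n) ℂ} (O : OSQ ε φ A) (i : Fin m) (j : Fin n) :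
    sqDist (O.bar i) j = ‖O.bar i j‖ ^ 2 / rowNorms O.bar i ^ 2 := rfl

/-- The columns are sampled from approximately the right distribution. -/
theorem sum_abs_colLaw_sub_le {A : Matrix (Fin m) (Fin n) ℂ} (O : OSQ ε φ A) (S : ℕ)
    (r : ℕ → Fin m) (w : ℕ → ℝ) (hW : 0 < ∑ k ∈ Finset.range (S + 1), w k ^ 2)
    (hr : ∀ k, O.bar (r k) ≠ 0) :
    ∑ j, |(colLaw O S r w j).toReal - dens O S r w j / ∑ k ∈ Finset.range (S + 1), w k ^ 2| ≤
      2 * ε := by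
  have h1 : ∀ k, ∑ j, |(O.colSampler (r k) j).toReal - sqDist (O.bar (r k)) j| ≤ 2 * ε := by
    intro k
    have := O.colSampler_close _ (hr k)
    rw [tv] at this
    linarith
  have h2 : ∀ j, |(colLaw O S r w j).toReal -
      dens O S r w j / ∑ k ∈ Finset.range (S + 1), w k ^ 2| *
        ∑ k ∈ Finset.range (S + 1), w k ^ 2 ≤ ∑ k ∈ Finset.range (S + 1),
          w k ^ 2 * |(O.colSampler (r k) j).toReal - sqDist (O.bar (r k)) j| := by
    intro j
    rw [← abs_of_pos hW, ← abs_mul, abs_of_pos hW, sub_mul, div_mul_cancel₀ _ hW.ne',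
      toReal_colLaw_mul, dens, ← Finset.sum_sub_distrib]
    refine (Finset.abs_sum_le_sum_abs _ _).trans (le_of_eq (Finset.sum_congr rfl fun k _ => ?_))
    rw [← sqDist_bar, ← mul_sub, abs_mul, abs_of_nonneg (sq_nonneg (w k))]
  have h3 := Finset.sum_le_sum fun j (_ : j ∈ Finset.univ) => h2 j
  rw [← Finset.sum_mul, Finset.sum_comm] at h3
  simp only [← Finset.mul_sum] at h3
  have h4 := h3.trans (Finset.sum_le_sum fun k _ =>
    mul_le_mul_of_nonneg_left (h1 k) (sq_nonneg (w k)))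
  rw [← Finset.sum_mul, mul_comm _ (2 * ε)] at h4
  exact le_of_mul_le_mul_right h4 hW

/-- Law of the last accepted proposal among independent attempts. -/
theorem toReal_chain_bind_map {n : ℕ} (c : PMF (Fin n)) (a : Fin n → ℝ) (h0 : ∀ j, 0 ≤ a j)
    (h1 : ∀ j, a j ≤ 1) (N : ℕ) (o j : Fin n) :
    ((chain (fun _ o => c.bind fun j => (coin (a j)).map fun x => if x = 1 then j else o) 0 N o)
      j).toReal = (c j).toReal * a j * (∑ t ∈ Finset.range N, (1 - expect c a) ^ t) +
        (1 - expect c a) ^ N * if j = o then 1 else 0 := by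
  induction N with
  | zero =>
    rw [chain, PMF.pure_apply]
    split_ifs <;> simp
  | succ N ih =>
    have hstep : ∀ o : Fin n, ((c.bind fun j => (coin (a j)).map fun x =>
        if x = 1 then j else o) j).toReal =
        (c j).toReal * a j + (1 - expect c a) * if j = o then 1 else 0 := by
      intro o
      have hj : ∀ j' : Fin n, (((coin (a j')).map fun x => if x = 1 then j' else o) j).toReal =
          a j' * (if j = j' then 1 else 0) + (if j = o then 1 else 0) -
            a j' * (if j = o then 1 else 0) := by
        intro j'
        rw [← PMF.bind_pure_comp, toReal_coin_bind (h0 _) (h1 _)]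
        simp only [Function.comp_apply, if_true, zero_ne_one, if_false, PMF.pure_apply]
        split_ifs <;> simp
      rw [toReal_bind]
      simp only [hj, expect_sub, expect_add, expect_const, expect_mul_const]
      rw [expect, Finset.sum_eq_single j (by intro b _ hb; simp [hb.symm]) (by simp)]
      simp only [if_true, mul_one]
      ring
    rw [chain_succ, toReal_bind]
    simp only [hstep, expect_add, expect_const, expect_const_mul]
    have : expect (chain (fun _ o => c.bind fun j => (coin (a j)).map fun x =>
        if x = 1 then j else o) 0 N o) (fun o => if j = o then (1 : ℝ) else 0) =
        (c j).toReal * a j * (∑ t ∈ Finset.range N, (1 - expect c a) ^ t) +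
        (1 - expect c a) ^ N * if j = o then 1 else 0 := by
      rw [expect, Finset.sum_eq_single j (by intro b _ hb; simp [hb.symm]) (by simp), if_pos rfl,
        mul_one, ih]
    rw [this, Finset.sum_range_succ', pow_succ']
    simp only [pow_succ', ← Finset.mul_sum, pow_zero]
    ring

/-- Rejection sampling from an approximate proposal distribution. -/
theorem tv_chain_bind_map_le {n : ℕ} (c : PMF (Fin n)) (q a : Fin n → ℝ) (h0 : ∀ j, 0 ≤ a j)
    (h1 : ∀ j, a j ≤ 1) {ε : ℝ} (hc : ∑ j, |(c j).toReal - q j| ≤ 2 * ε) (hq : ∑ j, q j = 1)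
    {s : ℝ} (hs : ∑ j, q j * a j = s) (hs0 : 0 < s) (N : ℕ) (o : Fin n) :
    s - ε ≤ expect c a ∧ expect c a ≤ 1 ∧
    tv (fun j => ((chain (fun _ o => c.bind fun j => (coin (a j)).map fun x =>
      if x = 1 then j else o) 0 N o) j).toReal) (fun j => (1 - (1 - expect c a) ^ N) *
        (q j * a j / s) + (1 - expect c a) ^ N * if j = o then 1 else 0) ≤ ε / s := by
  set s' := expect c a with hs'
  -- `c` and `q` have equal mass, so the positive and the negative parts of their difference are
  -- each at most `ε`, half of the `ℓ¹` distance.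
  have hpos : ∑ j, max ((c j).toReal - q j) 0 ≤ ε ∧ ∑ j, max (q j - (c j).toReal) 0 ≤ ε := by
    have e1 : ∑ j, max ((c j).toReal - q j) 0 + ∑ j, max (q j - (c j).toReal) 0 =
        ∑ j, |(c j).toReal - q j| := by
      rw [← Finset.sum_add_distrib]
      refine Finset.sum_congr rfl fun j _ => ?_
      rw [← neg_sub (c j).toReal]
      exact max_zero_add_max_neg_zero_eq_abs_self _
    have e2 : ∑ j, max ((c j).toReal - q j) 0 - ∑ j, max (q j - (c j).toReal) 0 = 0 := by
      have e3 : ∑ j, ((c j).toReal - q j) = 0 := by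
        rw [Finset.sum_sub_distrib, sum_toReal, hq, sub_self]
      rw [← Finset.sum_sub_distrib]
      refine Eq.trans ?_ e3
      refine Finset.sum_congr rfl fun j _ => ?_
      rw [← neg_sub (c j).toReal]
      rcases le_total 0 ((c j).toReal - q j) with h | h
      · rw [max_eq_left h, max_eq_right (by linarith), sub_zero]
      · rw [max_eq_right h, max_eq_left (by linarith)]
        ring
    constructor <;> linarith
  have hs'0 : 0 ≤ s' := expect_nonneg c h0
  have hs'1 : s' ≤ 1 := (expect_mono c h1).trans (expect_const c 1).le
  have hlow : s - ε ≤ s' := by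
    have : s - s' ≤ ∑ j, max (q j - (c j).toReal) 0 := by
      rw [← hs, hs', expect, ← Finset.sum_sub_distrib]
      refine Finset.sum_le_sum fun j _ => ?_
      rw [← sub_mul]
      rcases le_total 0 (q j - (c j).toReal) with h | h
      · rw [max_eq_left h]
        exact mul_le_of_le_one_right h (h1 j)
      · rw [max_eq_right h]
        exact mul_nonpos_of_nonpos_of_nonneg h (h0 j)
    linarith [hpos.2]
  refine ⟨hlow, hs'1, ?_⟩
  have hgeom : s' * ∑ t ∈ Finset.range N, (1 - s') ^ t = 1 - (1 - s') ^ N := by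
    have := geom_sum_mul (1 - s') N
    linarith
  have hη0 : 0 ≤ (1 - s') ^ N := pow_nonneg (by linarith) N
  have hη1 : (1 - s') ^ N ≤ 1 := pow_le_one₀ (by linarith) (by linarith)
  have hε : 0 ≤ ε := le_trans (Finset.sum_nonneg fun _ _ => le_max_right _ _) hpos.1
  -- If nothing is ever accepted, the actual law and the comparison law are both the point mass at
  -- `o`.
  rcases hs'0.eq_or_lt with h | h
  · have hz : ∀ j, (c j).toReal * a j = 0 := fun j =>
      (Finset.sum_eq_zero_iff_of_nonneg fun j _ =>
        mul_nonneg ENNReal.toReal_nonneg (h0 j)).1 (hs'.symm.trans h.symm) j (Finset.mem_univ j)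
    have : tv (fun j => ((chain (fun _ o => c.bind fun j => (coin (a j)).map fun x =>
      if x = 1 then j else o) 0 N o) j).toReal) (fun j => (1 - (1 - s') ^ N) *
        (q j * a j / s) + (1 - s') ^ N * if j = o then 1 else 0) = 0 := by
      rw [tv, Finset.sum_eq_zero, mul_zero]
      intro j _
      rw [toReal_chain_bind_map c a h0 h1, hz, ← hs', ← h]
      simp
    rw [this]
    positivity
  · have hdiff : ∀ j, |((chain (fun _ o => c.bind fun j => (coin (a j)).map fun x =>
        if x = 1 then j else o) 0 N o) j).toReal - ((1 - (1 - s') ^ N) *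
        (q j * a j / s) + (1 - s') ^ N * if j = o then 1 else 0)| ≤
        |(c j).toReal * a j / s' - q j * a j / s| := by
      intro j
      rw [toReal_chain_bind_map c a h0 h1, ← hs']
      have e : (c j).toReal * a j * (∑ t ∈ Finset.range N, (1 - s') ^ t) =
          (1 - (1 - s') ^ N) * ((c j).toReal * a j / s') := by
        rw [← hgeom]
        field_simp
      rw [e, add_sub_add_right_eq_sub, ← mul_sub, abs_mul]
      refine mul_le_of_le_one_left (abs_nonneg _) ?_
      rw [abs_le]
      constructor <;> linarith
    have hzero : ∑ j, ((c j).toReal * a j / s' - q j * a j / s) = 0 := by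
      rw [Finset.sum_sub_distrib, ← Finset.sum_div, ← Finset.sum_div, hs]
      rw [show ∑ j, (c j).toReal * a j = s' from rfl, div_self h.ne', div_self hs0.ne', sub_self]
    have habs : ∀ x : ℝ, |x| = 2 * max x 0 - x ∧ |x| = 2 * max (-x) 0 + x := by
      intro x
      rcases le_total 0 x with hx | hx
      · rw [abs_of_nonneg hx, max_eq_left hx, max_eq_right (by linarith)]
        constructor <;> ring
      · rw [abs_of_nonpos hx, max_eq_right hx, max_eq_left (by linarith)]
        constructor <;> ring
    -- Both normalised laws have mass `1`, so either one-sided part of the difference gives the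
    -- distance. The side is chosen so that replacing the larger of `s`, `s'` by the smaller goes in
    -- the right direction; this yields `ε / s` without a second error term for the normalisation.
    have hkey : ∑ j, |(c j).toReal * a j / s' - q j * a j / s| ≤ 2 * (ε / s) := by
      rcases le_total s s' with hle | hle
      · have : ∀ j, max ((c j).toReal * a j / s' - q j * a j / s) 0 ≤
            max ((c j).toReal - q j) 0 / s := by
          intro j
          refine max_le ?_ (div_nonneg (le_max_right _ _) hs0.le)
          have t1 : (c j).toReal * a j / s' ≤ (c j).toReal * a j / s :=
            div_le_div_of_nonneg_left (mul_nonneg ENNReal.toReal_nonneg (h0 j)) hs0 hle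
          have t2 : ((c j).toReal - q j) * a j ≤ max ((c j).toReal - q j) 0 :=
            (mul_le_mul_of_nonneg_right (le_max_left _ _) (h0 j)).trans
              (mul_le_of_le_one_right (le_max_right _ _) (h1 j))
          have t3 := div_le_div_of_nonneg_right t2 hs0.le
          rw [sub_mul, sub_div] at t3
          linarith
        have t := Finset.sum_le_sum fun j (_ : j ∈ Finset.univ) => this j
        rw [← Finset.sum_div] at t
        rw [Finset.sum_congr rfl fun j _ => (habs _).1, Finset.sum_sub_distrib, hzero, sub_zero,
          ← Finset.mul_sum]
        have := div_le_div_of_nonneg_right hpos.1 hs0.le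
        linarith
      · have : ∀ j, max (-((c j).toReal * a j / s' - q j * a j / s)) 0 ≤
            max (q j - (c j).toReal) 0 / s := by
          intro j
          refine max_le ?_ (div_nonneg (le_max_right _ _) hs0.le)
          have t1 : (c j).toReal * a j / s ≤ (c j).toReal * a j / s' :=
            div_le_div_of_nonneg_left (mul_nonneg ENNReal.toReal_nonneg (h0 j)) h hle
          have t2 : (q j - (c j).toReal) * a j ≤ max (q j - (c j).toReal) 0 :=
            (mul_le_mul_of_nonneg_right (le_max_left _ _) (h0 j)).trans
              (mul_le_of_le_one_right (le_max_right _ _) (h1 j))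
          have t3 := div_le_div_of_nonneg_right t2 hs0.le
          rw [sub_mul, sub_div] at t3
          linarith
        have t := Finset.sum_le_sum fun j (_ : j ∈ Finset.univ) => this j
        rw [← Finset.sum_div] at t
        rw [Finset.sum_congr rfl fun j _ => (habs _).2, Finset.sum_add_distrib, hzero, add_zero,
          ← Finset.mul_sum]
        have := div_le_div_of_nonneg_right hpos.2 hs0.le
        linarith
    have := Finset.sum_le_sum fun j (_ : j ∈ Finset.univ) => hdiff j
    rw [tv]
    linarith

end Rejection

end RecSys

end

noncomputable section

namespace RecSys

/-! ### Mean square errors of the sketches -/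

section Sampling

open Matrix

theorem l2_sq {𝕜 : Type*} [RCLike 𝕜] {n : ℕ} (u : Fin n → 𝕜) : l2 u ^ 2 = ∑ j, ‖u j‖ ^ 2 :=
  EuclideanSpace.norm_sq_eq _

theorem l2_sq_real {n : ℕ} (u : Fin n → ℝ) : l2 u ^ 2 = sumSq u := by
  simp [l2_sq, sumSq]

theorem l2_nonneg {𝕜 : Type*} [RCLike 𝕜] {n : ℕ} (u : Fin n → 𝕜) : 0 ≤ l2 u := norm_nonneg _

theorem l2_eq_zero {𝕜 : Type*} [RCLike 𝕜] {n : ℕ} {u : Fin n → 𝕜} : l2 u = 0 ↔ u = 0 := by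
  simp [l2]

theorem frobenius_norm_sq {𝕜 : Type*} [RCLike 𝕜] {m n : ℕ} (A : Matrix (Fin m) (Fin n) 𝕜) :
    ‖A‖ ^ 2 = ∑ i, ∑ j, ‖A i j‖ ^ 2 := by
  rw [Matrix.frobenius_norm_def, ← Real.sqrt_eq_rpow, Real.sq_sqrt (by positivity)]
  simp

theorem frobenius_norm_sq_real {m n : ℕ} (A : Matrix (Fin m) (Fin n) ℝ) : ‖A‖ ^ 2 = frobSq A := by
  simp [frobenius_norm_sq, frobSq]

theorem l2_rowNorms_sq {m n : ℕ} (A : Matrix (Fin m) (Fin n) ℂ) :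
    l2 (rowNorms A) ^ 2 = ‖A‖ ^ 2 := by
  rw [l2_sq, frobenius_norm_sq]
  refine Finset.sum_congr rfl fun i _ => ?_
  rw [Real.norm_eq_abs, sq_abs, rowNorms, l2_sq]

variable {ε φ : ℝ} {m n : ℕ} {A : Matrix (Fin m) (Fin n) ℝ}

theorem l2_rowNorms_bar_sq (O : OSQ ε φ (A.map ((↑) : ℝ → ℂ))) :
    l2 (rowNorms O.bar) ^ 2 = φ * frobSq A := by
  rw [l2_rowNorms_sq, O.norm_bar_sq, frobenius_norm_sq, frobSq]
  simp

theorem sq_le_norm_bar_sq (O : OSQ ε φ (A.map ((↑) : ℝ → ℂ))) (i : Fin m) (j : Fin n) :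
    A i j ^ 2 ≤ ‖O.bar i j‖ ^ 2 := by
  have := O.norm_le_bar i j
  rw [Matrix.map_apply, Complex.norm_real] at this
  rw [← sq_abs]
  exact pow_le_pow_left₀ (abs_nonneg _) this 2

theorem rowNorms_sq (M : Matrix (Fin m) (Fin n) ℂ) (i : Fin m) :
    rowNorms M i ^ 2 = ∑ j, ‖M i j‖ ^ 2 := l2_sq _

theorem rowNorms_sq_le (M : Matrix (Fin m) (Fin n) ℂ) (i : Fin m) :
    rowNorms M i ^ 2 ≤ l2 (rowNorms M) ^ 2 := by
  rw [l2_sq]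
  simp only [Real.norm_eq_abs, sq_abs]
  exact Finset.single_le_sum (f := fun i => rowNorms M i ^ 2) (fun _ _ => sq_nonneg _)
    (Finset.mem_univ i)

theorem sq_row_le (O : OSQ ε φ (A.map ((↑) : ℝ → ℂ))) (i : Fin m) :
    sumSq (A i) ≤ rowNorms O.bar i ^ 2 := by
  rw [rowNorms_sq]
  exact Finset.sum_le_sum fun j _ => sq_le_norm_bar_sq O i j

/-- Weight of a sampled row. -/
def rowFactor (O : OSQ ε φ (A.map ((↑) : ℝ → ℂ))) (i x : Fin m) : ℝ :=
  open Classical in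
  if IsVoid O i x then 0 else l2 (rowNorms O.bar) ^ 2 / rowNorms O.bar x ^ 2

theorem rowFactor_nonneg (O : OSQ ε φ (A.map ((↑) : ℝ → ℂ))) (i x : Fin m) :
    0 ≤ rowFactor O i x := by
  rw [rowFactor]
  split_ifs <;> positivity

theorem rowFactor_mul_sq_le (O : OSQ ε φ (A.map ((↑) : ℝ → ℂ))) (i x : Fin m) :
    rowFactor O i x * sumSq (A x) ≤ l2 (rowNorms O.bar) ^ 2 := by
  rw [rowFactor]
  split_ifs with h
  · rw [zero_mul]
    positivity
  · rw [IsVoid, not_or] at h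
    have := h.2
    rw [div_mul_eq_mul_div, div_le_iff₀ (by positivity)]
    exact mul_le_mul_of_nonneg_left (sq_row_le O x) (by positivity)

/-- The importance weight cancels the sampling probability. A zero row of `bar` forces a zero row of
`A`, so discarding it loses nothing; the row `i` is removed because it enters the sketch separately.
-/
theorem sqDist_mul_rowFactor_mul (O : OSQ ε φ (A.map ((↑) : ℝ → ℂ))) (i x : Fin m) (j j' : Fin n) :
    sqDist (rowNorms O.bar) x * (rowFactor O i x * (A x j * A x j')) =
      if x = i then 0 else A x j * A x j' := by
  rw [rowFactor, sqDist, Real.norm_eq_abs, sq_abs]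
  by_cases hi : x = i
  · have hv : IsVoid O i x := Or.inl hi
    rw [if_pos hv, if_pos hi, zero_mul, mul_zero]
  · rw [if_neg hi]
    by_cases h0 : rowNorms O.bar x = 0
    · have h1 := sq_le_norm_bar_sq O x j
      have h2 := rowNorms_sq O.bar x
      rw [h0, zero_pow two_ne_zero, eq_comm,
        Finset.sum_eq_zero_iff_of_nonneg fun _ _ => sq_nonneg _] at h2
      rw [h2 j (Finset.mem_univ j)] at h1
      rw [pow_eq_zero_iff two_ne_zero |>.1 (le_antisymm h1 (sq_nonneg _))]
      simp
    · have h3 : 0 < l2 (rowNorms O.bar) ^ 2 := lt_of_lt_of_le (by positivity) (rowNorms_sq_le O.bar x)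
      have hv : ¬ IsVoid O i x := by
        rintro (h | h) <;> contradiction
      have h4 : rowNorms O.bar x ^ 2 ≠ 0 := pow_ne_zero 2 h0
      have h5 := h3.ne'
      rw [if_neg hv]
      generalize l2 (rowNorms O.bar) ^ 2 = b at *
      field_simp

variable {S : ℕ}

theorem sketch_zero (O : OSQ ε φ (A.map ((↑) : ℝ → ℂ))) (i : Fin m) (v : Fin S → Fin m) :
    sketch A S (rowIdx O i v) (rowScale O i v) 0 = A i := by
  funext j
  simp [sketch, rowIdx, rowScale]

theorem sketch_succ_mul (hS : S ≠ 0) (O : OSQ ε φ (A.map ((↑) : ℝ → ℂ))) (i : Fin m)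
    (v : Fin S → Fin m) (k : Fin S) (j j' : Fin n) :
    sketch A S (rowIdx O i v) (rowScale O i v) k.succ j *
      sketch A S (rowIdx O i v) (rowScale O i v) k.succ j' =
      1 / S * (rowFactor O i (v k) * (A (v k) j * A (v k) j')) := by
  have hS' : (0 : ℝ) < S := by positivity
  rw [sketch, sketch, Fin.val_succ, rowIdx, rowScale, dif_pos k.2, dif_pos k.2, rowFactor]
  simp only [Fin.eta]
  split_ifs with h
  · simp
  · have := Real.sq_sqrt hS'.le
    field_simp
    rw [this]
    ring

/-- The exact contribution of the row `i` plus a mean of independent terms, whose ideal expectation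
is the contribution of all other rows to `AᵀA`. -/
theorem sum_sketch_mul (hS : S ≠ 0) (O : OSQ ε φ (A.map ((↑) : ℝ → ℂ))) (i : Fin m)
    (v : Fin S → Fin m) (j j' : Fin n) :
    ∑ k, sketch A S (rowIdx O i v) (rowScale O i v) k j *
      sketch A S (rowIdx O i v) (rowScale O i v) k j' =
      A i j * A i j' + 1 / S * ∑ k, rowFactor O i (v k) * (A (v k) j * A (v k) j') := by
  rw [Fin.sum_univ_succ, sketch_zero, Finset.mul_sum]
  simp only [sketch_succ_mul hS]

theorem sum_sqDist_rowFactor (O : OSQ ε φ (A.map ((↑) : ℝ → ℂ))) (i : Fin m) (j j' : Fin n) :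
    ∑ x, sqDist (rowNorms O.bar) x * (rowFactor O i x * (A x j * A x j')) =
      (∑ x, A x j * A x j') - A i j * A i j' := by
  simp only [sqDist_mul_rowFactor_mul]
  rw [← Finset.add_sum_erase _ _ (Finset.mem_univ i), ← Finset.add_sum_erase _
    (fun x => A x j * A x j') (Finset.mem_univ i), if_pos rfl, zero_add, add_sub_cancel_left]
  exact Finset.sum_congr rfl fun x hx => if_neg (Finset.ne_of_mem_erase hx)

theorem sum_abs_rowSampler_sub_le (O : OSQ ε φ (A.map ((↑) : ℝ → ℂ))) :
    ∑ x, |(O.rowSampler x).toReal - sqDist (rowNorms O.bar) x| ≤ 2 * ε := by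
  have := O.rowSampler_close
  rw [tv] at this
  linarith

theorem expect_frobSq_rows_le (hS : S ≠ 0) (O : OSQ ε φ (A.map ((↑) : ℝ → ℂ))) (i : Fin m)
    (v₀ : Fin S → Fin m) :
    expect (iid O.rowSampler S v₀) (fun v => frobSq
      ((sketch A S (rowIdx O i v) (rowScale O i v))ᴴ * sketch A S (rowIdx O i v) (rowScale O i v) -
        Aᴴ * A)) ≤ (4 * ε ^ 2 + 1 / S) * (l2 (rowNorms O.bar) ^ 2) ^ 2 := by
  have h := expect_iid_sum_mean_sq_le hS O.rowSampler v₀ (sqDist (rowNorms O.bar)) ε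
    ((l2 (rowNorms O.bar) ^ 2) ^ 2) (sum_abs_rowSampler_sub_le O)
    (fun x (b : Fin n × Fin n) => rowFactor O i x * (A x b.1 * A x b.2)) (fun x => by
      have e : ∑ b : Fin n × Fin n, (rowFactor O i x * (A x b.1 * A x b.2)) ^ 2 =
          (rowFactor O i x * sumSq (A x)) ^ 2 := by
        rw [Fintype.sum_prod_type, sumSq, mul_pow, pow_two (∑ j, A x j ^ 2), Finset.sum_mul_sum,
          Finset.mul_sum]
        refine Finset.sum_congr rfl fun j _ => ?_
        rw [Finset.mul_sum]
        exact Finset.sum_congr rfl fun j' _ => by ring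
      rw [e]
      exact pow_le_pow_left₀ (mul_nonneg (rowFactor_nonneg O i x) (sumSq_nonneg _))
        (rowFactor_mul_sq_le O i x) 2)
  refine le_trans (le_of_eq ?_) h
  congr 1
  funext v
  rw [frobSq, Fintype.sum_prod_type]
  refine Finset.sum_congr rfl fun j _ => Finset.sum_congr rfl fun j' _ => ?_
  rw [sum_sqDist_rowFactor]
  simp only [Matrix.sub_apply, Matrix.mul_apply, conjTranspose_apply, star_trivial,
    sum_sketch_mul hS]
  ring

/-- The pointwise bound on `‖R‖_F²` would be of order `b² = φ‖A‖_F²`. The mean is better by the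
factor `φ`, which the choice of `S` relies on. -/
theorem expect_frobSq_sketch_le (hS : S ≠ 0) (O : OSQ ε φ (A.map ((↑) : ℝ → ℂ))) (i : Fin m)
    (v₀ : Fin S → Fin m) :
    expect (iid O.rowSampler S v₀) (fun v => frobSq (sketch A S (rowIdx O i v) (rowScale O i v))) ≤
      frobSq A + 2 * ε * l2 (rowNorms O.bar) ^ 2 := by
  have hS' : (0 : ℝ) < S := by positivity
  have e : ∀ v : Fin S → Fin m, frobSq (sketch A S (rowIdx O i v) (rowScale O i v)) =
      sumSq (A i) + 1 / S * ∑ k, rowFactor O i (v k) * sumSq (A (v k)) := by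
    intro v
    rw [frobSq, Finset.sum_comm]
    simp only [pow_two, sum_sketch_mul hS, sumSq, Finset.sum_add_distrib, Finset.mul_sum]
    rw [Finset.sum_comm]
  simp only [e, expect_add, expect_const, expect_const_mul]
  rw [expect_iid_sum (g := fun x => rowFactor O i x * sumSq (A x))]
  have h := abs_expect_sub_le O.rowSampler (sqDist (rowNorms O.bar))
    (fun x => rowFactor O i x * sumSq (A x)) (l2 (rowNorms O.bar) ^ 2) (fun x => by
      rw [abs_of_nonneg (mul_nonneg (rowFactor_nonneg O i x) (sumSq_nonneg _))]
      exact rowFactor_mul_sq_le O i x)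
  have h2 := mul_le_mul_of_nonneg_right (sum_abs_rowSampler_sub_le O)
    (sq_nonneg (l2 (rowNorms O.bar)))
  have h3 : ∑ x, sqDist (rowNorms O.bar) x * (rowFactor O i x * sumSq (A x)) =
      frobSq A - sumSq (A i) := by
    simp only [sumSq, Finset.mul_sum, frobSq]
    rw [Finset.sum_comm, Finset.sum_comm (f := fun x j => A x j ^ 2), ← Finset.sum_sub_distrib]
    simp only [pow_two, sum_sqDist_rowFactor]
  rw [h3] at h
  have h4 := (abs_le.1 (h.trans h2)).2
  rw [one_div, inv_mul_cancel_left₀ hS'.ne']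
  linarith

/-! Columns -/

theorem sum_initVec_sq (S : ℕ) : ∑ k ∈ Finset.range (S + 1), initVec S k ^ 2 = 2 * S := by
  rw [Finset.sum_range_succ']
  simp [initVec, two_mul]

theorem dens_nonneg {A : Matrix (Fin m) (Fin n) ℂ} (O : OSQ ε φ A) (S : ℕ) (r : ℕ → Fin m)
    (w : ℕ → ℝ) (j : Fin n) : 0 ≤ dens O S r w j :=
  Finset.sum_nonneg fun _ _ => by positivity

theorem sq_le_mul_sqDist_bar (O : OSQ ε φ (A.map ((↑) : ℝ → ℂ))) (i : Fin m) (j : Fin n) :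
    A i j ^ 2 ≤ l2 (rowNorms O.bar) ^ 2 * (‖O.bar i j‖ ^ 2 / rowNorms O.bar i ^ 2) := by
  have h1 := sq_le_norm_bar_sq O i j
  rcases eq_or_ne (rowNorms O.bar i) 0 with h | h
  · have h2 := rowNorms_sq O.bar i
    rw [h, zero_pow two_ne_zero, eq_comm,
      Finset.sum_eq_zero_iff_of_nonneg fun _ _ => sq_nonneg _] at h2
    rw [h2 j (Finset.mem_univ j)] at h1
    exact h1.trans (by positivity)
  · rw [mul_div_assoc', le_div_iff₀ (by positivity), mul_comm]
    exact mul_le_mul (rowNorms_sq_le _ _) h1 (sq_nonneg _) (sq_nonneg _)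

/-- Explains the weights `initVec`: the unscaled row `i` can be `√S` times as large as the bound on
a sampled row, and weight `S` in the mixture compensates for it. The mixture density then dominates
all entries of the sketch in a column. -/
theorem sketch_sq_le (hS : S ≠ 0) (O : OSQ ε φ (A.map ((↑) : ℝ → ℂ))) (i : Fin m)
    (v : Fin S → Fin m) (k : Fin (S + 1)) (j : Fin n) :
    S * sketch A S (rowIdx O i v) (rowScale O i v) k j ^ 2 ≤ l2 (rowNorms O.bar) ^ 2 *
      (initVec S k ^ 2 * (‖O.bar (rowIdx O i v k) j‖ ^ 2 /
        rowNorms O.bar (rowIdx O i v k) ^ 2)) := by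
  have hS' : (0 : ℝ) < S := by positivity
  refine Fin.cases ?_ (fun k => ?_) k
  · have := mul_le_mul_of_nonneg_left (sq_le_mul_sqDist_bar O i j) hS'.le
    rw [sketch_zero]
    simp only [Fin.val_zero, rowIdx, initVec, if_true, Real.sq_sqrt hS'.le]
    linarith
  · rw [pow_two, sketch_succ_mul hS, Fin.val_succ, rowIdx, dif_pos k.2, Fin.eta, initVec,
      if_neg (Nat.succ_ne_zero _), one_pow, one_mul, rowFactor]
    split_ifs with h
    · rw [zero_mul, mul_zero, mul_zero]
      positivity
    · rw [← mul_assoc, mul_one_div_cancel hS'.ne', one_mul, div_mul_eq_mul_div, mul_div_assoc']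
      refine div_le_div_of_nonneg_right (mul_le_mul_of_nonneg_left ?_ (sq_nonneg _)) (sq_nonneg _)
      rw [← pow_two]
      exact sq_le_norm_bar_sq O _ j

theorem sum_sketch_sq_le (hS : S ≠ 0) (O : OSQ ε φ (A.map ((↑) : ℝ → ℂ))) (i : Fin m)
    (v : Fin S → Fin m) (j : Fin n) :
    S * ∑ k, sketch A S (rowIdx O i v) (rowScale O i v) k j ^ 2 ≤
      l2 (rowNorms O.bar) ^ 2 * dens O S (rowIdx O i v) (initVec S) j := by
  rw [dens, Finset.sum_range, Finset.mul_sum, Finset.mul_sum]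
  exact Finset.sum_le_sum fun k _ => sketch_sq_le hS O i v k j

/-- The acceptance probability is at most `1`. The top row is split off at the cost of a factor `2`,
and Cauchy–Schwarz on the other `S` rows is paid for by their scale `1/√S`. -/
theorem comb_sq_le (hS : S ≠ 0) (O : OSQ ε φ (A.map ((↑) : ℝ → ℂ))) (i : Fin m)
    (v : Fin S → Fin m) (w : ℕ → ℝ) (j : Fin n) :
    comb A S (rowIdx O i v) (rowScale O i v) w j ^ 2 ≤
      2 * l2 (rowNorms O.bar) ^ 2 * dens O S (rowIdx O i v) w j := by
  have hS' : (0 : ℝ) < S := by positivity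
  rw [comb_eq_vecMul, vecMul, dotProduct, Fin.sum_univ_succ, dens, Finset.sum_range,
    Fin.sum_univ_succ]
  have h0 := sketch_sq_le hS O i v 0 j
  simp only [Fin.val_zero, initVec, if_true, Real.sq_sqrt hS'.le] at h0 ⊢
  have h0' : sketch A S (rowIdx O i v) (rowScale O i v) 0 j ^ 2 ≤ l2 (rowNorms O.bar) ^ 2 *
      (‖O.bar (rowIdx O i v 0) j‖ ^ 2 / rowNorms O.bar (rowIdx O i v 0) ^ 2) :=
    le_of_mul_le_mul_left (by linarith) hS'
  have h1 : (∑ k : Fin S, w k.succ * sketch A S (rowIdx O i v) (rowScale O i v) k.succ j) ^ 2 ≤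
      l2 (rowNorms O.bar) ^ 2 * ∑ k : Fin S, w k.succ ^ 2 * (‖O.bar (rowIdx O i v k.succ) j‖ ^ 2 /
        rowNorms O.bar (rowIdx O i v k.succ) ^ 2) := by
    have cs := sq_sum_le_card_mul_sum_sq (s := Finset.univ)
      (f := fun k : Fin S => w k.succ * sketch A S (rowIdx O i v) (rowScale O i v) k.succ j)
    rw [Finset.card_univ, Fintype.card_fin] at cs
    refine cs.trans ?_
    rw [Finset.mul_sum, Finset.mul_sum]
    refine Finset.sum_le_sum fun k _ => ?_
    have h2 := sketch_sq_le hS O i v k.succ j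
    rw [initVec, Fin.val_succ, if_neg (Nat.succ_ne_zero _), one_pow, one_mul] at h2
    have h3 := mul_le_mul_of_nonneg_left h2 (sq_nonneg (w k.succ))
    rw [Fin.val_succ] at h3 ⊢
    rw [mul_pow]
    linarith
  have h4 := mul_le_mul_of_nonneg_left h0' (sq_nonneg (w 0))
  refine (add_sq_le (a := w 0 * sketch A S (rowIdx O i v) (rowScale O i v) 0 j)).trans ?_
  rw [mul_pow]
  linarith

theorem bar_rowIdx_ne_zero (O : OSQ ε φ (A.map ((↑) : ℝ → ℂ))) {i : Fin m} (hi : A i ≠ 0)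
    (v : Fin S → Fin m) (k : ℕ) : O.bar (rowIdx O i v k) ≠ 0 := by
  have hbar : O.bar i ≠ 0 := by
    intro h
    refine hi (funext fun j => ?_)
    have := sq_le_norm_bar_sq O i j
    rw [h] at this
    simpa using this
  cases k with
  | zero => exact hbar
  | succ k =>
    rw [rowIdx]
    split_ifs with h1 h2
    · exact hbar
    · rw [IsVoid, not_or] at h2
      intro h
      exact h2.2 (by rw [rowNorms, h]; exact l2_eq_zero.2 rfl)
    · exact hbar

theorem colWeight_nonneg {A : Matrix (Fin m) (Fin n) ℂ} (O : OSQ ε φ A) (S : ℕ) (r : ℕ → Fin m)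
    (j : Fin n) : 0 ≤ colWeight O S r j := by
  have := dens_nonneg O S r (initVec S) j
  rw [colWeight]
  positivity

/-- Each rescaled column has squared norm at most `1 / S`, since its weight is `1 / (b² D)` with `D`
the mixture density that dominates the column. The bound holds for every outcome, so the spectrum of
`FFᵀ` always lies in `[0, 1]`, where the polynomial is accurate. -/
theorem frobSq_subsketch_le [NeZero n] (hS : S ≠ 0) (O : OSQ ε φ (A.map ((↑) : ℝ → ℂ))) (i : Fin m)
    (v : Fin S → Fin m) (c : ℕ → Fin n) (hb : 0 < l2 (rowNorms O.bar)) :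
    frobSq (subsketch A S (rowIdx O i v) (rowScale O i v) c
      (fun l => colWeight O S (rowIdx O i v) (c l)) S) ≤ 1 := by
  have hS' : (0 : ℝ) < S := by positivity
  rw [frobSq, Finset.sum_comm]
  have h : ∀ l : Fin S, ∑ k, subsketch A S (rowIdx O i v) (rowScale O i v) c
      (fun l => colWeight O S (rowIdx O i v) (c l)) S k l ^ 2 ≤ 1 / S := by
    intro l
    simp only [subsketch, mul_pow, Real.sq_sqrt (colWeight_nonneg _ _ _ _), ← Finset.mul_sum]
    have h1 := sum_sketch_sq_le hS O i v (c l)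
    rw [colWeight, sum_initVec_sq]
    rcases (dens_nonneg O S (rowIdx O i v) (initVec S) (c l)).eq_or_lt with h0 | h0
    · rw [← h0, mul_zero, div_zero, zero_mul]
      positivity
    · rw [div_mul_eq_mul_div, div_le_div_iff₀ (by positivity) hS']
      nlinarith
  refine (Finset.sum_le_sum fun l _ => h l).trans (le_of_eq ?_)
  rw [Finset.sum_const, Finset.card_univ, Fintype.card_fin, nsmul_eq_mul,
    mul_one_div_cancel hS'.ne']

/-- `2b² FFᵀ` is the mean over the samples of (column)(column)ᵀ divided by the ideal probability `D
/ (2S)`; its ideal expectation is `RRᵀ`. Where `D` vanishes so does the column, so division by zero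
is harmless. The bound is uniform in the sampled rows. -/
theorem expect_frobSq_cols_le [NeZero n] (hS : S ≠ 0) (O : OSQ ε φ (A.map ((↑) : ℝ → ℂ)))
    {i : Fin m} (hi : A i ≠ 0) (v : Fin S → Fin m) (hb : 0 < l2 (rowNorms O.bar)) :
    expect (colsLaw O i S v) (fun c => frobSq ((2 * l2 (rowNorms O.bar) ^ 2) •
      (subsketch A S (rowIdx O i v) (rowScale O i v) (colIdx c)
        (fun l => colWeight O S (rowIdx O i v) (colIdx c l)) S *
      (subsketch A S (rowIdx O i v) (rowScale O i v) (colIdx c)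
        (fun l => colWeight O S (rowIdx O i v) (colIdx c l)) S)ᴴ) -
      sketch A S (rowIdx O i v) (rowScale O i v) *
        (sketch A S (rowIdx O i v) (rowScale O i v))ᴴ)) ≤
      (4 * ε ^ 2 + 1 / S) * (2 * l2 (rowNorms O.bar) ^ 2) ^ 2 := by
  have hS' : (0 : ℝ) < S := by positivity
  set R := sketch A S (rowIdx O i v) (rowScale O i v) with hR
  set D := dens O S (rowIdx O i v) (initVec S) with hD
  have hD0 : ∀ j, 0 ≤ D j := dens_nonneg O S _ _
  have hRD : ∀ j, S * ∑ k, R k j ^ 2 ≤ l2 (rowNorms O.bar) ^ 2 * D j := sum_sketch_sq_le hS O i v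
  have hRz : ∀ j, D j = 0 → ∀ k, R k j = 0 := by
    intro j hj k
    have h1 := hRD j
    rw [hj, mul_zero] at h1
    have h2 : ∑ k, R k j ^ 2 ≤ 0 := by
      by_contra h
      push Not at h
      nlinarith [mul_pos hS' h]
    have h3 := (Finset.single_le_sum (fun k _ => sq_nonneg (R k j)) (Finset.mem_univ k)).trans h2
    exact pow_eq_zero_iff two_ne_zero |>.1 (le_antisymm h3 (sq_nonneg _))
  have hclose := sum_abs_colLaw_sub_le O S (rowIdx O i v) (initVec S)
    (by rw [sum_initVec_sq]; positivity) (bar_rowIdx_ne_zero O hi v)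
  rw [sum_initVec_sq] at hclose
  have h := expect_iid_sum_mean_sq_le hS (colLaw O S (rowIdx O i v) (initVec S)) (fun _ => 0)
    (fun j => D j / (2 * S)) ε ((2 * l2 (rowNorms O.bar) ^ 2) ^ 2) hclose
    (fun j (b : Fin (S + 1) × Fin (S + 1)) => R b.1 j * R b.2 j / (D j / (2 * S))) (fun j => by
      have e : ∑ b : Fin (S + 1) × Fin (S + 1), (R b.1 j * R b.2 j / (D j / (2 * S))) ^ 2 =
          ((∑ k, R k j ^ 2) / (D j / (2 * S))) ^ 2 := by
        simp only [div_pow]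
        rw [← Finset.sum_div, Fintype.sum_prod_type, pow_two (∑ k, R k j ^ 2),
          Finset.sum_mul_sum]
        simp only [mul_pow]
      rw [e]
      refine pow_le_pow_left₀ (div_nonneg (Finset.sum_nonneg fun _ _ => sq_nonneg _)
        (div_nonneg (hD0 j) (by positivity))) ?_ 2
      rcases (hD0 j).eq_or_lt with h0 | h0
      · rw [← h0, zero_div, div_zero]
        positivity
      · rw [div_le_iff₀ (by positivity), mul_div_assoc', le_div_iff₀ (by positivity)]
        linarith [hRD j])
  refine le_trans (le_of_eq ?_) h
  rw [colsLaw]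
  congr 1
  funext c
  rw [frobSq, Fintype.sum_prod_type]
  refine Finset.sum_congr rfl fun k _ => Finset.sum_congr rfl fun k' _ => ?_
  congr 1
  simp only [Matrix.sub_apply, Matrix.smul_apply, Matrix.mul_apply, conjTranspose_apply,
    star_trivial, smul_eq_mul]
  congr 1
  · rw [Finset.mul_sum, Finset.mul_sum]
    refine Finset.sum_congr rfl fun l _ => ?_
    have hc : colIdx c l = c l := by simp [colIdx]
    simp only [subsketch, hc]
    have hw := Real.mul_self_sqrt (colWeight_nonneg O S (rowIdx O i v) (c l))
    rw [← hR, mul_mul_mul_comm (√_), hw, colWeight, sum_initVec_sq, ← hD]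
    rcases (hD0 (c l)).eq_or_lt with h0 | h0
    · rw [← h0]
      simp
    · field_simp
  · refine Finset.sum_congr rfl fun j _ => ?_
    rcases (hD0 j).eq_or_lt with h0 | h0
    · rw [hRz j h0.symm]
      simp
    · field_simp

end Sampling

end RecSys

end

noncomputable section

namespace RecSys

/-! ### The law of the output for a given sketch -/

section Ideal

open Matrix

theorem sq_le_add_mul {ι : Type*} [Fintype ι] (u v : ι → ℝ) {t : ℝ} (ht : 0 < t) :
    sumSq v ≤ (1 + t) * sumSq u + (1 + 1 / t) * sumSq (u - v) := by
  simp only [sumSq, Finset.mul_sum, ← Finset.sum_add_distrib, Pi.sub_apply]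
  refine Finset.sum_le_sum fun i _ => ?_
  have : (1 + t) * u i ^ 2 + (1 + 1 / t) * (u i - v i) ^ 2 - v i ^ 2 =
      (t * u i + (u i - v i)) ^ 2 / t := by
    field_simp
    ring
  have : 0 ≤ (t * u i + (u i - v i)) ^ 2 / t := by positivity
  linarith

theorem sqrt_sub_sqrt_sq_le {a b : ℝ} (ha : 0 ≤ a) (hb : 0 ≤ b) : (√a - √b) ^ 2 ≤ |a - b| := by
  have h : a - b = (√a - √b) * (√a + √b) := by
    rw [← Real.sq_sqrt ha, ← Real.sq_sqrt hb]
    simp only [Real.sqrt_sq (Real.sqrt_nonneg _)]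
    ring
  rw [h, abs_mul, ← sq_abs, pow_two]
  refine mul_le_mul_of_nonneg_left ?_ (abs_nonneg _)
  rw [abs_of_nonneg (by positivity : 0 ≤ √a + √b)]
  have := Real.sqrt_nonneg a
  have := Real.sqrt_nonneg b
  rw [abs_le]
  constructor <;> linarith

variable {n : ℕ}

theorem l2_eq_sqrt (x : Fin n → ℝ) : l2 x = √(sumSq x) := by
  rw [← l2_sq_real, Real.sqrt_sq (l2_nonneg x)]

theorem l2_sub_le (x y : Fin n → ℝ) : |l2 x - l2 y| ≤ l2 (x - y) :=
  abs_norm_sub_norm_le (WithLp.toLp 2 x) (WithLp.toLp 2 y)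

theorem l2_add_le (x y : Fin n → ℝ) : l2 (x + y) ≤ l2 x + l2 y :=
  norm_add_le (WithLp.toLp 2 x) (WithLp.toLp 2 y)

/-- The cross term has a favourable sign and is dropped. This bound, valid for any distribution,
takes care of bad sketches. -/
theorem sum_sub_abs_sq_le_of_sum_eq_one (x D : Fin n → ℝ) (hD : ∀ j, 0 ≤ D j)
    (hD1 : ∑ j, D j = 1) : ∑ j, (l2 x * √(D j) - |x j|) ^ 2 ≤ 2 * sumSq x := by
  have h : ∀ j, (l2 x * √(D j) - |x j|) ^ 2 ≤ sumSq x * D j + x j ^ 2 := by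
    intro j
    have h1 : 0 ≤ l2 x * √(D j) * |x j| :=
      mul_nonneg (mul_nonneg (l2_nonneg x) (Real.sqrt_nonneg _)) (abs_nonneg _)
    rw [sub_sq, mul_pow, l2_sq_real, Real.sq_sqrt (hD j), sq_abs]
    linarith
  refine (Finset.sum_le_sum fun j _ => h j).trans (le_of_eq ?_)
  rw [Finset.sum_add_distrib, ← Finset.mul_sum, hD1, sumSq]
  ring

/-- The normalized squares of a nearby vector, with a small perturbation. -/
theorem sum_sub_abs_sq_le (x y : Fin n → ℝ) (hy : 0 < sumSq y) (d : Fin n → ℝ) (hd : ∀ j, 0 ≤ d j)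
    (hd1 : ∑ j, d j = 1) (η : ℝ) (hη : 0 ≤ η) (hη1 : η ≤ 1) :
    ∑ j, (l2 x * √((1 - η) * (y j ^ 2 / sumSq y) + η * d j) - |x j|) ^ 2 ≤
      8 * sumSq (y - x) + 4 * sumSq x * η := by
  have hp : ∀ j, 0 ≤ y j ^ 2 / sumSq y := fun j => by positivity
  have hly : 0 < l2 y := by
    rw [l2_eq_sqrt]
    exact Real.sqrt_pos.2 hy
  have h1 : ∑ j, (l2 x * √(y j ^ 2 / sumSq y) - |x j|) ^ 2 ≤ 4 * sumSq (y - x) := by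
    have e1 : ∑ j, (l2 x * √(y j ^ 2 / sumSq y) - |x j|) ^ 2 ≤ sumSq ((l2 x / l2 y) • y - x) := by
      refine Finset.sum_le_sum fun j _ => ?_
      have e : l2 x * √(y j ^ 2 / sumSq y) = |(l2 x / l2 y) * y j| := by
        rw [Real.sqrt_div (sq_nonneg _), Real.sqrt_sq_eq_abs, ← l2_eq_sqrt, abs_mul,
          abs_of_nonneg (div_nonneg (l2_nonneg x) hly.le)]
        ring
      rw [e, ← sq_abs, ← sq_abs (((l2 x / l2 y) • y - x) j), Pi.sub_apply, Pi.smul_apply,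
        smul_eq_mul]
      exact pow_le_pow_left₀ (abs_nonneg _) (abs_abs_sub_abs_le _ _) 2
    -- Rescaling `y` to the length of `x` moves it by `|‖x‖ - ‖y‖| ≤ ‖y - x‖`, so the distance to
    -- `x` at most doubles.
    have e2 : l2 ((l2 x / l2 y) • y - x) ≤ 2 * l2 (y - x) := by
      have t1 : l2 ((l2 x / l2 y) • y - y) = |l2 x - l2 y| := by
        have : (l2 x / l2 y) • y - y = ((l2 x - l2 y) / l2 y) • y := by
          rw [sub_div, div_self hly.ne', sub_smul, one_smul]
        rw [this, l2, WithLp.toLp_smul, norm_smul, Real.norm_eq_abs, abs_div, abs_of_pos hly]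
        exact div_mul_cancel₀ _ hly.ne'
      have t2 := l2_add_le ((l2 x / l2 y) • y - y) (y - x)
      have t3 := l2_sub_le y x
      rw [sub_add_sub_cancel, t1, abs_sub_comm] at t2
      linarith
    have e3 := pow_le_pow_left₀ (l2_nonneg _) e2 2
    rw [mul_pow, l2_sq_real, l2_sq_real] at e3
    linarith
  have h2 : ∑ j, (l2 x * √((1 - η) * (y j ^ 2 / sumSq y) + η * d j) - l2 x * √(y j ^ 2 / sumSq y)) ^ 2 ≤
      2 * sumSq x * η := by
    have e1 : ∀ j, (l2 x * √((1 - η) * (y j ^ 2 / sumSq y) + η * d j) -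
        l2 x * √(y j ^ 2 / sumSq y)) ^ 2 ≤ sumSq x * (η * (y j ^ 2 / sumSq y + d j)) := by
      intro j
      rw [← mul_sub, mul_pow, l2_sq_real]
      refine mul_le_mul_of_nonneg_left ?_ (sumSq_nonneg x)
      refine (sqrt_sub_sqrt_sq_le (add_nonneg (mul_nonneg (by linarith) (hp j))
        (mul_nonneg hη (hd j))) (hp j)).trans ?_
      rw [show (1 - η) * (y j ^ 2 / sumSq y) + η * d j - y j ^ 2 / sumSq y =
        η * (d j - y j ^ 2 / sumSq y) by ring, abs_mul, abs_of_nonneg hη]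
      refine mul_le_mul_of_nonneg_left ?_ hη
      rw [abs_le]
      constructor <;> linarith [hp j, hd j]
    refine (Finset.sum_le_sum fun j _ => e1 j).trans (le_of_eq ?_)
    rw [← Finset.mul_sum, ← Finset.mul_sum, Finset.sum_add_distrib, hd1, ← Finset.sum_div]
    rw [show ∑ j, y j ^ 2 = sumSq y from rfl, div_self hy.ne']
    ring
  have h3 : ∀ j, (l2 x * √((1 - η) * (y j ^ 2 / sumSq y) + η * d j) - |x j|) ^ 2 ≤
      2 * (l2 x * √((1 - η) * (y j ^ 2 / sumSq y) + η * d j) - l2 x * √(y j ^ 2 / sumSq y)) ^ 2 +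
      2 * (l2 x * √(y j ^ 2 / sumSq y) - |x j|) ^ 2 := by
    intro j
    nlinarith [sq_nonneg (l2 x * √((1 - η) * (y j ^ 2 / sumSq y) + η * d j) -
      l2 x * √(y j ^ 2 / sumSq y) - (l2 x * √(y j ^ 2 / sumSq y) - |x j|))]
  have h4 := Finset.sum_le_sum fun j (_ : j ∈ Finset.univ) => h3 j
  rw [Finset.sum_add_distrib, ← Finset.mul_sum, ← Finset.mul_sum] at h4
  linarith

/-- Averaging distributions does not increase the mean square error. -/
theorem sum_sub_abs_sq_expect_le {Ω : Type*} [Fintype Ω] (P : PMF Ω) (x : Fin n → ℝ)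
    (D : Ω → Fin n → ℝ) (hD : ∀ ω j, 0 ≤ D ω j) :
    ∑ j, (l2 x * √(expect P fun ω => D ω j) - |x j|) ^ 2 ≤
      expect P fun ω => ∑ j, (l2 x * √(D ω j) - |x j|) ^ 2 := by
  rw [expect_sum]
  refine Finset.sum_le_sum fun j _ => ?_
  -- Jensen: in the expanded square only the cross term changes under averaging, and concavity of
  -- the root changes it in the right direction. Nonnegativity of the variance of `√D` is the whole
  -- proof.
  have h1 : expect P (fun ω => √(D ω j)) ≤ √(expect P fun ω => D ω j) := by
    refine Real.le_sqrt_of_sq_le ?_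
    have h2 : 0 ≤ expect P fun ω => (√(D ω j) - expect P fun ω => √(D ω j)) ^ 2 :=
      expect_nonneg P fun _ => sq_nonneg _
    simp only [sub_sq, expect_add, expect_sub, expect_const, expect_mul_const, expect_const_mul,
      Real.sq_sqrt (hD _ _)] at h2
    nlinarith
  simp only [sub_sq, mul_pow, expect_add, expect_sub, expect_const, expect_mul_const,
    expect_const_mul, Real.sq_sqrt (hD _ _)]
  rw [Real.sq_sqrt (expect_nonneg P fun ω => hD ω j)]
  have h3 := mul_le_mul_of_nonneg_left h1
    (mul_nonneg (mul_nonneg zero_le_two (l2_nonneg x)) (abs_nonneg (x j)))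
  linarith

/-- `(1 - s)ᴺ (1 + s)ᴺ ≤ 1`, with Bernoulli's inequality for the second factor. Polynomial decay
suffices as there are about `S²` attempts. -/
theorem one_sub_pow_le {s : ℝ} (hs : 0 < s) (hs1 : s ≤ 1) {N : ℕ} (hN : N ≠ 0) :
    (1 - s) ^ N ≤ 1 / (N * s) := by
  have hN' : (0 : ℝ) < N := by positivity
  have h1 := one_add_mul_le_pow (a := s) (by linarith) N
  have h2 : (1 - s) ^ N * (1 + s) ^ N ≤ 1 := by
    rw [← mul_pow]
    exact pow_le_one₀ (mul_nonneg (by linarith) (by linarith)) (by nlinarith)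
  have h3 : 0 ≤ (1 - s) ^ N := pow_nonneg (by linarith) N
  rw [le_div_iff₀ (by positivity)]
  nlinarith

variable {ε φ : ℝ} {m : ℕ} {A : Matrix (Fin m) (Fin n) ℝ} {S : ℕ}

theorem sum_dens {A : Matrix (Fin m) (Fin n) ℂ} (O : OSQ ε φ A) (S : ℕ) (r : ℕ → Fin m) (w : ℕ → ℝ)
    (hr : ∀ k, O.bar (r k) ≠ 0) :
    ∑ j, dens O S r w j = ∑ k ∈ Finset.range (S + 1), w k ^ 2 := by
  simp only [dens]
  rw [Finset.sum_comm]
  refine Finset.sum_congr rfl fun k _ => ?_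
  have h : rowNorms O.bar (r k) ^ 2 ≠ 0 := by
    rw [rowNorms]
    exact pow_ne_zero 2 (mt l2_eq_zero.1 (hr k))
  rw [← Finset.mul_sum, ← Finset.sum_div, ← rowNorms_sq, div_self h, mul_one]

/-- The output of the rejection sampling is close to a distribution that is close to the squares of
a given vector `x` if the sketch is good. -/
theorem exists_ideal_law [NeZero n] (hS : S ≠ 0) (O : OSQ ε φ (A.map ((↑) : ℝ → ℂ))) {i : Fin m}
    (hi : A i ≠ 0) (v : Fin S → Fin m) (w : ℕ → ℝ) (x : Fin n → ℝ) (z : Fin (S + 1) → ℝ)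
    {σ δ M : ℝ} (hσ : 0 < σ) (hδ : 0 < δ) (hδ1 : δ ≤ 1 / 2) (hM : 0 ≤ M)
    (hb : 0 < l2 (rowNorms O.bar)) (hz : σ ^ 2 * sumSq z ≤ sumSq (A i)) (hx : 0 < sumSq x)
    (hxa : sumSq x ≤ sumSq (A i)) (hε0 : 0 ≤ ε)
    (hε : ε * (50 / 9 * (l2 (rowNorms O.bar) ^ 2 * sumSq (A i))) ≤ δ * (σ ^ 2 * sumSq x))
    (hη : 400 / 9 * (l2 (rowNorms O.bar) ^ 2 * sumSq (A i)) ≤ M * (σ ^ 2 * S ^ 2)) :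
    ∃ D : Fin n → ℝ, (∀ j, 0 ≤ D j) ∧ ∑ j, D j = 1 ∧
      tv (fun j => (trialsLaw O S (rowIdx O i v) (rowScale O i v) w j).toReal) D ≤ δ ∧
      ∑ j, (l2 x * √(D j) - |x j|) ^ 2 ≤
        32 * sumSq ((fun k : Fin (S + 1) => w k) ᵥ* sketch A S (rowIdx O i v) (rowScale O i v) - x) +
        32 * (σ ^ 2 * sumSq ((fun k : Fin (S + 1) => w k) - z)) + M := by
  have hS' : (0 : ℝ) < S := by positivity
  set u : Fin (S + 1) → ℝ := fun k => w k with hu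
  set y := u ᵥ* sketch A S (rowIdx O i v) (rowScale O i v) with hy
  have hsq1 := sumSq_nonneg (y - x)
  have hsq2 := mul_nonneg (sq_nonneg σ) (sumSq_nonneg (u - z))
  have ha : 0 < sumSq (A i) := lt_of_lt_of_le hx hxa
  -- A sketch is good if `y` is within `‖x‖/4` of `x` and `w` is within `‖Aᵢ‖/(4σ)` of `z`. Then
  -- `‖y‖ ≥ (3/4)‖x‖` and `σ‖w‖ ≤ (5/4)‖Aᵢ‖`, which are the next two estimates.
  by_cases hgood : 16 * sumSq (y - x) ≤ sumSq x ∧ 16 * (σ ^ 2 * sumSq (u - z)) ≤ sumSq (A i)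
  · obtain ⟨hg1, hg2⟩ := hgood
    have hyx : 9 * sumSq x ≤ 16 * sumSq y := by
      have := sq_le_add_mul y x (t := 1 / 3) (by norm_num)
      norm_num at this
      linarith
    have hW : 16 * (σ ^ 2 * sumSq u) ≤ 25 * sumSq (A i) := by
      have := sq_le_add_mul z u (t := 1 / 4) (by norm_num)
      have e : sumSq (z - u) = sumSq (u - z) := by
        simp only [sumSq, Pi.sub_apply]
        exact Finset.sum_congr rfl fun k _ => by ring
      rw [e] at this
      have := mul_le_mul_of_nonneg_left this (sq_nonneg σ)
      norm_num at this
      linarith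
    have hy0 : 0 < sumSq y := by linarith
    have hu0 : 0 < sumSq u := by
      refine lt_of_le_of_ne (sumSq_nonneg u) fun h => hy0.ne' ?_
      have h1 := sq_vecMul_le u (sketch A S (rowIdx O i v) (rowScale O i v))
      rw [← h, zero_mul] at h1
      exact le_antisymm h1 (sumSq_nonneg _)
    have hWu : ∑ k ∈ Finset.range (S + 1), w k ^ 2 = sumSq u := (sq_fin_succ w).symm
    have hbar := bar_rowIdx_ne_zero O hi v
    have hclose := sum_abs_colLaw_sub_le O S (rowIdx O i v) w (by rw [hWu]; exact hu0) hbar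
    have hq1 := sum_dens O S (rowIdx O i v) w hbar
    rw [hWu] at hclose hq1
    have hcomb := comb_sq_le hS O i v w
    have hD0 := dens_nonneg O S (rowIdx O i v) w
    have hcy : ∀ j, comb A S (rowIdx O i v) (rowScale O i v) w j = y j := comb_eq_vecMul A _ _ w
    simp only [hcy] at hcomb
    have hqa : ∀ j, dens O S (rowIdx O i v) w j / sumSq u *
        (comb A S (rowIdx O i v) (rowScale O i v) w j ^ 2 /
          (2 * l2 (rowNorms O.bar) ^ 2 * dens O S (rowIdx O i v) w j)) =
        y j ^ 2 / (2 * l2 (rowNorms O.bar) ^ 2 * sumSq u) := by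
      intro j
      rw [hcy]
      rcases (hD0 j).eq_or_lt with h0 | h0
      · have := hcomb j
        rw [← h0, mul_zero] at this
        rw [le_antisymm this (sq_nonneg _)]
        simp
      · field_simp
    set s := sumSq y / (2 * l2 (rowNorms O.bar) ^ 2 * sumSq u) with hs
    have hs0 : 0 < s := by positivity
    obtain ⟨r1, r2, r3⟩ := tv_chain_bind_map_le (colLaw O S (rowIdx O i v) w)
      (fun j => dens O S (rowIdx O i v) w j / sumSq u)
      (fun j => comb A S (rowIdx O i v) (rowScale O i v) w j ^ 2 /
          (2 * l2 (rowNorms O.bar) ^ 2 * dens O S (rowIdx O i v) w j))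
      (fun j => div_nonneg (sq_nonneg _) (mul_nonneg (by positivity) (hD0 j)))
      (fun j => div_le_one_of_le₀ (by rw [hcy]; exact hcomb j)
        (mul_nonneg (by positivity) (hD0 j))) hclose
      (by rw [← Finset.sum_div, hq1, div_self hu0.ne'])
      (s := s) (by simp only [hqa]; rw [← Finset.sum_div]; rfl) hs0 (S ^ 2 + 1) 0
    set s' := expect (colLaw O S (rowIdx O i v) w) _ with hs'
    -- Lower bound for the ideal acceptance rate `s = ‖y‖² / (2b²‖w‖²)`; the constant `50/9` is `2
    -- (25/16) / (9/16)`.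
    have hκ : (50 / 9 * (l2 (rowNorms O.bar) ^ 2 * sumSq (A i))) * s ≥ σ ^ 2 * sumSq x := by
      rw [ge_iff_le, hs, mul_div_assoc', le_div_iff₀ (by positivity)]
      have t1 : (16 * (σ ^ 2 * sumSq u)) * (9 * sumSq x) ≤ (25 * sumSq (A i)) * (16 * sumSq y) :=
        mul_le_mul hW hyx (by positivity) (by positivity)
      have t2 := mul_le_mul_of_nonneg_left t1 (sq_nonneg (l2 (rowNorms O.bar)))
      linarith
    have hεs : ε ≤ δ * s := by
      have t1 := mul_le_mul_of_nonneg_left hκ hδ.le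
      have t2 : ε * (50 / 9 * (l2 (rowNorms O.bar) ^ 2 * sumSq (A i))) ≤
        (δ * s) * (50 / 9 * (l2 (rowNorms O.bar) ^ 2 * sumSq (A i))) := by linarith
      exact le_of_mul_le_mul_right t2 (by positivity)
    -- The true acceptance rate loses at most `ε ≤ δ s ≤ s / 2`.
    have hs's : s / 2 ≤ s' := by nlinarith
    have hη1 : (1 - s') ^ (S ^ 2 + 1) ≤ 2 / (S ^ 2 * s) := by
      refine (one_sub_pow_le (by linarith) r2 (Nat.succ_ne_zero _)).trans ?_
      rw [div_le_div_iff₀ (mul_pos (by positivity) (by linarith)) (by positivity)]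
      push_cast
      nlinarith [sq_nonneg (S : ℝ), mul_pos (pow_pos hS' 2) hs0]
    have hη0 : 0 ≤ (1 - s') ^ (S ^ 2 + 1) := pow_nonneg (by linarith) _
    have hηle : (1 - s') ^ (S ^ 2 + 1) ≤ 1 := pow_le_one₀ (by linarith) (by linarith)
    have hd : ∀ j : Fin n, (0 : ℝ) ≤ if j = 0 then 1 else 0 := fun j => by split_ifs <;> simp
    have hpy : ∀ j, dens O S (rowIdx O i v) w j / sumSq u *
        (comb A S (rowIdx O i v) (rowScale O i v) w j ^ 2 /
          (2 * l2 (rowNorms O.bar) ^ 2 * dens O S (rowIdx O i v) w j)) / s = y j ^ 2 / sumSq y := by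
      intro j
      rw [hqa, hs]
      field_simp
    simp only [hpy] at r3
    refine ⟨fun j => (1 - (1 - s') ^ (S ^ 2 + 1)) * (y j ^ 2 / sumSq y) +
      (1 - s') ^ (S ^ 2 + 1) * if j = 0 then 1 else 0, fun j => add_nonneg
        (mul_nonneg (by linarith) (by positivity)) (mul_nonneg hη0 (hd j)), ?_, ?_, ?_⟩
    · rw [Finset.sum_add_distrib, ← Finset.mul_sum, ← Finset.mul_sum, ← Finset.sum_div]
      rw [show ∑ j, y j ^ 2 = sumSq y from rfl, div_self hy0.ne']
      simp
    · refine le_trans r3 ?_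
      rwa [div_le_iff₀ hs0]
    · refine (sum_sub_abs_sq_le x y hy0 _ hd (by simp) _ hη0 hηle).trans ?_
      have t1 : 4 * sumSq x * (1 - s') ^ (S ^ 2 + 1) ≤ M := by
        refine (mul_le_mul_of_nonneg_left hη1 (by positivity)).trans ?_
        rw [mul_div_assoc', div_le_iff₀ (by positivity)]
        have t2 := mul_le_mul_of_nonneg_right hη hs0.le
        have t3 : 8 * (σ ^ 2 * sumSq x) ≤ M * (σ ^ 2 * S ^ 2) * s := by linarith
        have t4 : σ ^ 2 * (4 * sumSq x * 2) ≤ σ ^ 2 * (M * (S ^ 2 * s)) := by linarith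
        exact le_of_mul_le_mul_left t4 (by positivity)
      linarith
  -- A bad sketch needs no analysis: the conditional law is its own `D`, and the trivial error
  -- `2‖x‖²` is below `32` times the sketching error that is large.
  · refine ⟨fun j => (trialsLaw O S (rowIdx O i v) (rowScale O i v) w j).toReal,
      fun j => ENNReal.toReal_nonneg, sum_toReal _, ?_, ?_⟩
    · simp only [tv, sub_self, abs_zero, Finset.sum_const_zero, mul_zero]
      exact hδ.le
    · refine (sum_sub_abs_sq_le_of_sum_eq_one x _ (fun j => ENNReal.toReal_nonneg)
        (sum_toReal _)).trans ?_
      rw [not_and_or, not_le, not_le] at hgood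
      rcases hgood with h | h <;> linarith

end Ideal

end RecSys

end

noncomputable section

namespace RecSys

/-! ### The law of the output -/

section Output

open Matrix

theorem tv_expect_le {Ω : Type*} [Fintype Ω] {n : ℕ} (P : PMF Ω) (L : Ω → PMF (Fin n))
    (D : Ω → Fin n → ℝ) (δ : ℝ) (h : ∀ ω, tv (fun j => (L ω j).toReal) (D ω) ≤ δ) :
    tv (fun j => ((P.bind L) j).toReal) (fun j => expect P fun ω => D ω j) ≤ δ := by
  have h1 : tv (fun j => ((P.bind L) j).toReal) (fun j => expect P fun ω => D ω j) ≤
      expect P fun ω => tv (fun j => (L ω j).toReal) (D ω) := by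
    simp only [tv, expect_const_mul, expect_sum]
    refine mul_le_mul_of_nonneg_left (Finset.sum_le_sum fun j _ => ?_) (by norm_num)
    rw [toReal_bind, ← expect_sub, expect]
    refine (Finset.abs_sum_le_sum_abs _ _).trans (le_of_eq (Finset.sum_congr rfl fun ω _ => ?_))
    rw [abs_mul, abs_of_nonneg ENNReal.toReal_nonneg]
  exact h1.trans ((expect_mono P h).trans (expect_const P δ).le)

variable {ε φ : ℝ} {m n : ℕ} {A : Matrix (Fin m) (Fin n) ℝ} {S : ℕ}

/-- Joint law of the sampled rows and columns. -/
def sketchLaw [NeZero n] (O : OSQ ε φ (A.map ((↑) : ℝ → ℂ))) (i : Fin m) (S : ℕ) :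
    PMF ((Fin S → Fin m) × (Fin S → Fin n)) :=
  (iid O.rowSampler S fun _ => i).bind fun v => (colsLaw O i S v).map (Prod.mk v)

theorem expect_sketchLaw [NeZero n] (O : OSQ ε φ (A.map ((↑) : ℝ → ℂ))) (i : Fin m) (S : ℕ)
    (f : (Fin S → Fin m) × (Fin S → Fin n) → ℝ) :
    expect (sketchLaw O i S) f = expect (iid O.rowSampler S fun _ => i) fun v =>
      expect (colsLaw O i S v) fun c => f (v, c) := by
  rw [sketchLaw, expect_bind]
  simp only [expect_map]

theorem outLaw_eq_bind [NeZero n] (O : OSQ ε φ (A.map ((↑) : ℝ → ℂ))) (i : Fin m) (S : ℕ)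
    (σ ξ : ℝ) : outLaw O i S σ ξ = (sketchLaw O i S).bind fun ω =>
      trialsLaw O S (rowIdx O i ω.1) (rowScale O i ω.1) (coeffVec O i S σ ξ ω.1 ω.2) := by
  rw [outLaw, sketchLaw, PMF.bind_bind]
  simp only [PMF.bind_map]
  rfl

/-- The sketched Gram matrix of the columns, up to its scale. -/
def subsketchAt [NeZero n] (O : OSQ ε φ (A.map ((↑) : ℝ → ℂ))) (i : Fin m) (v : Fin S → Fin m)
    (c : Fin S → Fin n) : Matrix (Fin (S + 1)) (Fin S) ℝ :=
  subsketch A S (rowIdx O i v) (rowScale O i v) (colIdx c)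
    (fun l => colWeight O S (rowIdx O i v) (colIdx c l)) S

/-- The two terms are the Bernstein error, from the degree `S`, and the error of the sampled
columns. -/
theorem sq_coeffVec_sub_le [NeZero n] (hS : S ≠ 0) (O : OSQ ε φ (A.map ((↑) : ℝ → ℂ))) (i : Fin m)
    (v : Fin S → Fin m) (c : Fin S → Fin n) (hb : 0 < l2 (rowNorms O.bar)) {σ ξ : ℝ} (hσ : 0 < σ)
    (hξ : 0 < ξ) :
    sumSq ((fun k : Fin (S + 1) => coeffVec O i S σ ξ v c k) -
      specFun (isHermitian_mul_conjTranspose_self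
        (sketch A S (rowIdx O i v) (rowScale O i v))) (ramp σ ξ) *ᵥ Pi.single 0 1) ≤
      2 * ((l2 (rowNorms O.bar) ^ 2 / (ξ * σ ^ 2)) ^ 2 / (4 * S)) +
      2 * ((1 / (2 * ξ * σ ^ 2)) ^ 2 * frobSq ((2 * l2 (rowNorms O.bar) ^ 2) •
        (subsketchAt O i v c * (subsketchAt O i v c)ᴴ) -
        sketch A S (rowIdx O i v) (rowScale O i v) *
          (sketch A S (rowIdx O i v) (rowScale O i v))ᴴ)) := by
  have hF : frobSq (subsketchAt O i v c) ≤ 1 := frobSq_subsketch_le hS O i v _ hb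
  have h := sq_specFun_sub_specFun_le (sketch A S (rowIdx O i v) (rowScale O i v))
    (subsketchAt O i v c) (hornerFun (bernCoeff S σ ξ (l2 (rowNorms O.bar))) S) (ramp σ ξ)
    ((l2 (rowNorms O.bar) ^ 2 / (ξ * σ ^ 2)) ^ 2 / (4 * S)) (1 / (2 * ξ * σ ^ 2))
    (2 * l2 (rowNorms O.bar) ^ 2)
    (fun y hy hy1 => sq_hornerFun_sub_ramp_le hS hσ hξ _ hy (hy1.trans hF))
    (ramp_lipschitz hσ hξ) 0
  have hvec : (fun k : Fin (S + 1) => coeffVec O i S σ ξ v c k) =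
      specFun (isHermitian_mul_conjTranspose_self (subsketchAt O i v c))
        (hornerFun (bernCoeff S σ ξ (l2 (rowNorms O.bar))) S) *ᵥ Pi.single 0 1 :=
    hornerVec_eq _ (isHermitian_mul_conjTranspose_self (subsketchAt O i v c))
      (fun u k => gram_eq A (rowIdx O i v) (rowScale O i v) (colIdx c)
        (fun l => colWeight O S (rowIdx O i v) (colIdx c l)) (fun l => colWeight_nonneg _ _ _ _)
        S u k) _ _
  rw [hvec]
  exact h

theorem sq_row_vecMul_specFun_le (A : Matrix (Fin m) (Fin n) ℝ) (i : Fin m) (σ ξ : ℝ) :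
    sumSq (A i ᵥ* specFun (isHermitian_conjTranspose_mul_self A) (ramp σ ξ)) ≤ sumSq (A i) := by
  rw [vecMul_specFun, sq_specFun_mulVec,
    ← sq_evec_transpose_mulVec (isHermitian_conjTranspose_mul_self A) (A i)]
  exact Finset.sum_le_sum fun k _ => mul_le_of_le_one_left (sq_nonneg _)
    (pow_le_one₀ (ramp_nonneg _ _ _) (ramp_le_one _ _ _))

theorem sq_row_le_frobSq (A : Matrix (Fin m) (Fin n) ℝ) (i : Fin m) : sumSq (A i) ≤ frobSq A :=
  Finset.single_le_sum (f := fun i => sumSq (A i)) (fun _ _ => sumSq_nonneg _) (Finset.mem_univ i)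

theorem sq_div_le_of_sampleSize {b σ ν ξ : ℝ} (hσ : 0 < σ) (hν : 0 < ν) (hξ : 0 < ξ) :
    (b ^ 2 / (ξ * σ ^ 2)) ^ 2 * 10000 ≤ ν ^ 2 * (sampleSize b σ ν ξ : ℕ) := by
  have h := (Nat.lt_floor_add_one (((10000 : ℕ) : ℝ) * (b ^ 2 / (σ ^ 2 * ξ * ν)) ^ 2)).le
  rw [sampleSize]
  push_cast at h ⊢
  have h2 := mul_le_mul_of_nonneg_left h (sq_nonneg ν)
  refine le_trans (le_of_eq ?_) h2
  field_simp

/-- The final budget: `64 + 800` times `ℓ²U ≤ ν²/2000`, `200` times `q ≤ ν²/40000` and `1/10` for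
the attempts add up to less than `ν²`. The factor `100` rounds up `64 · 25/24 + 32`. -/
theorem mean_error_le {F s a ℓ E₁ E q ν U : ℝ} (hF : 0 ≤ F) (hs : s ≤ F)
    (haF : a ≤ F) (hE₁ : 0 ≤ E₁) (hEU : E₁ ≤ U) (hE : E ≤ 25 / 24 * F) (hV0 : 0 ≤ ℓ ^ 2 * U)
    (hV : ℓ ^ 2 * U * 2000 ≤ ν ^ 2) (hq0 : 0 ≤ q) (hq : q * 40000 ≤ ν ^ 2) :
    64 * a * ℓ ^ 2 * E₁ + ν ^ 2 * F / 10 + (64 * E + 32 * s) * (2 * q + 8 * (ℓ ^ 2 * U)) ≤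
      ν ^ 2 * F := by
  have h1 : a * (ℓ ^ 2 * E₁) ≤ F * (ℓ ^ 2 * U) :=
    mul_le_mul haF (mul_le_mul_of_nonneg_left hEU (sq_nonneg ℓ))
      (mul_nonneg (sq_nonneg ℓ) hE₁) hF
  have h2 : (64 * E + 32 * s) * (2 * q + 8 * (ℓ ^ 2 * U)) ≤
      (100 * F) * (2 * q + 8 * (ℓ ^ 2 * U)) :=
    mul_le_mul_of_nonneg_right (by linarith) (by linarith)
  have h3 := mul_le_mul_of_nonneg_left hV hF
  have h4 := mul_le_mul_of_nonneg_left hq hF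
  have h5 : 0 ≤ F * ν ^ 2 := mul_nonneg hF (sq_nonneg ν)
  linarith

set_option maxHeartbeats 1600000 in
/-- The output has almost the law given by the squares of a vector close to the row `i` of the
transformed matrix. -/
theorem exists_output_law [NeZero n] (O : OSQ ε φ (A.map ((↑) : ℝ → ℂ))) {i : Fin m}
    (hi : A i ≠ 0) {σ ν ξ δ : ℝ} (hσ : 0 < σ) (hν : 0 < ν) (hν1 : ν ≤ 1) (hξ : 0 < ξ)
    (hξ1 : ξ ≤ 1 / 2) (hδ : 0 < δ) (hδ1 : δ ≤ 1 / 2) (hφ : 1 ≤ φ) (hK : σ ^ 2 ≤ frobSq A)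
    (hε0 : 0 ≤ ε) (hε : ε * (48 * l2 (rowNorms O.bar) ^ 2) ≤ ν * ξ * σ ^ 2)
    (hx : 0 < sumSq (A i ᵥ* specFun (isHermitian_conjTranspose_mul_self A) (ramp σ ξ)))
    (hεx : ε * (50 / 9 * (l2 (rowNorms O.bar) ^ 2 * sumSq (A i))) ≤
      δ * (σ ^ 2 * sumSq (A i ᵥ* specFun (isHermitian_conjTranspose_mul_self A) (ramp σ ξ))))
    (hS : S = sampleSize (l2 (rowNorms O.bar)) σ ν ξ) :
    ∃ D : Fin n → ℝ, (∀ j, 0 ≤ D j) ∧ ∑ j, D j = 1 ∧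
      tv (fun j => (outLaw O i S σ ξ j).toReal) D ≤ δ ∧
      ∑ j, (l2 (A i ᵥ* specFun (isHermitian_conjTranspose_mul_self A) (ramp σ ξ)) * √(D j) -
        |(A i ᵥ* specFun (isHermitian_conjTranspose_mul_self A) (ramp σ ξ)) j|) ^ 2 ≤
        ν ^ 2 * frobSq A := by
  set x := A i ᵥ* specFun (isHermitian_conjTranspose_mul_self A) (ramp σ ξ) with hxdef
  set F := frobSq A with hF
  have hσ2 : 0 < σ ^ 2 := by positivity
  have hF0 : 0 < F := lt_of_lt_of_le hσ2 hK
  have hb2 : l2 (rowNorms O.bar) ^ 2 = φ * F := l2_rowNorms_bar_sq O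
  have hb0 : 0 < l2 (rowNorms O.bar) := by
    refine lt_of_le_of_ne (l2_nonneg _) fun h => ?_
    rw [← h, zero_pow two_ne_zero] at hb2
    have : 0 < φ * F := by positivity
    linarith
  have hS0 : S ≠ 0 := by
    rw [hS, sampleSize]
    exact Nat.succ_ne_zero _
  have hS' : (0 : ℝ) < S := by positivity
  have hP := sq_div_le_of_sampleSize (b := l2 (rowNorms O.bar)) hσ hν hξ
  rw [← hS] at hP
  have hbF : F ≤ l2 (rowNorms O.bar) ^ 2 := by
    rw [hb2]
    nlinarith
  have haF : sumSq (A i) ≤ F := sq_row_le_frobSq A i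
  set b2 := l2 (rowNorms O.bar) ^ 2 with hb2def
  have hb20 : 0 < b2 := by positivity
  set p := b2 / (ξ * σ ^ 2) with hp
  have hp0 : 0 < p := by positivity
  have hpξ : p * (ξ * σ ^ 2) = b2 := div_mul_cancel₀ _ (by positivity)
  have hp1 : 1 ≤ p := by
    rw [hp, one_le_div (by positivity)]
    nlinarith
  have hS1 : (10000 : ℝ) ≤ S := by
    have : ν ^ 2 ≤ 1 := pow_le_one₀ hν.le hν1
    nlinarith
  -- number of attempts
  have hη : 400 / 9 * (b2 * sumSq (A i)) ≤ ν ^ 2 * F / 10 * (σ ^ 2 * S ^ 2) := by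
    have t1 : b2 ≤ p ^ 2 * σ ^ 2 := by
      have : ξ * p * σ ^ 2 = b2 := by rw [← hpξ]; ring
      nlinarith [mul_pos hp0 hσ2]
    have t2 : p ^ 2 * σ ^ 2 * 10000 * 10000 ≤ ν ^ 2 * S * σ ^ 2 * S := by
      have := mul_le_mul_of_nonneg_right hP hσ2.le
      exact mul_le_mul (by linarith) hS1 (by norm_num) (by positivity)
    have t3 : b2 * sumSq (A i) ≤ b2 * F := mul_le_mul_of_nonneg_left haF hb20.le
    have t4 : b2 * F * 100000000 ≤ ν ^ 2 * S * σ ^ 2 * S * F := by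
      have : b2 * 100000000 ≤ ν ^ 2 * S * σ ^ 2 * S := by linarith
      have := mul_le_mul_of_nonneg_right this hF0.le
      linarith
    have t5 : 0 ≤ b2 * F := by positivity
    linarith
  -- the laws given the sketch
  have key : ∀ ω : (Fin S → Fin m) × (Fin S → Fin n), _ := fun ω =>
    exists_ideal_law hS0 O hi ω.1 (coeffVec O i S σ ξ ω.1 ω.2) x
      (specFun (isHermitian_mul_conjTranspose_self
        (sketch A S (rowIdx O i ω.1) (rowScale O i ω.1))) (ramp σ ξ) *ᵥ Pi.single 0 1)
      hσ hδ hδ1 (M := ν ^ 2 * F / 10) (by positivity) hb0 (by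
        have := mul_sq_specFun_single_le (sketch A S (rowIdx O i ω.1) (rowScale O i ω.1))
          (ramp σ ξ) (σ ^ 2) (sq_mul_ramp_sq_le hσ hξ) 0
        rwa [sketch_zero] at this) hx (sq_row_vecMul_specFun_le A i σ ξ) hε0 hεx hη
  choose D hD0 hD1 hDtv hDx using key
  refine ⟨fun j => expect (sketchLaw O i S) fun ω => D ω j,
    fun j => expect_nonneg _ fun ω => hD0 ω j, ?_, ?_, ?_⟩
  · rw [← expect_sum]
    simp only [hD1, expect_const]
  · rw [outLaw_eq_bind]
    exact tv_expect_le _ _ _ _ hDtv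
  refine (sum_sub_abs_sq_expect_le _ x D hD0).trans ?_
  set ℓ := 1 / (2 * ξ * σ ^ 2) with hℓ
  have hℓb : ℓ ^ 2 * b2 ^ 2 = p ^ 2 / 4 := by
    rw [hℓ, hp]
    field_simp
    ring
  set q := p ^ 2 / (4 * S) with hq
  have hq0 : 0 < q := by positivity
  have hqν : q * 40000 ≤ ν ^ 2 := by
    rw [hq, div_mul_eq_mul_div, div_le_iff₀ (by positivity)]
    linarith
  have ht : ℓ ^ 2 * ((4 * ε ^ 2 + 1 / S) * b2 ^ 2) * 2000 ≤ ν ^ 2 := by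
    -- The bias part is `(εp)² ≤ (ν/48)²` by the assumption on `ε`; the variance part is exactly the
    -- Bernstein error `q`.
    have e : ℓ ^ 2 * ((4 * ε ^ 2 + 1 / S) * b2 ^ 2) = (ε * p) ^ 2 + q := by
      calc _ = (4 * ε ^ 2 + 1 / S) * (ℓ ^ 2 * b2 ^ 2) := by ring
        _ = _ := by rw [hℓb, hq]; field_simp
    have t1 : ε * p * 48 ≤ ν := by
      rw [← hpξ] at hε
      have : (ε * p * 48) * (ξ * σ ^ 2) ≤ ν * (ξ * σ ^ 2) := by linarith
      exact le_of_mul_le_mul_right this (by positivity)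
    have t2 := pow_le_pow_left₀ (by positivity) t1 2
    rw [e]
    nlinarith
  set R : (Fin S → Fin m) → Matrix (Fin (S + 1)) (Fin n) ℝ :=
    fun v => sketch A S (rowIdx O i v) (rowScale O i v) with hR
  set Δ₁ : (Fin S → Fin m) → ℝ := fun v => frobSq ((R v)ᴴ * R v - Aᴴ * A) with hΔ₁
  set Δ₂ : (Fin S → Fin m) → (Fin S → Fin n) → ℝ := fun v c => frobSq ((2 * b2) •
    (subsketchAt O i v c * (subsketchAt O i v c)ᴴ) - R v * (R v)ᴴ) with hΔ₂
  have hpt : ∀ v c, ∑ j, (l2 x * √(D (v, c) j) - |x j|) ^ 2 ≤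
      64 * sumSq (A i) * ℓ ^ 2 * Δ₁ v + ν ^ 2 * F / 10 +
        (64 * frobSq (R v) + 32 * σ ^ 2) * (2 * q + 2 * ℓ ^ 2 * Δ₂ v c) := by
    intro v c
    have h1 := hDx (v, c)
    have h2 := sq_vecMul_sub_le A (R v) (ramp σ ξ) ℓ (ramp_lipschitz hσ hξ) i 0
      (sketch_zero O i v) (fun k : Fin (S + 1) => coeffVec O i S σ ξ v c k)
    have h3 := sq_coeffVec_sub_le hS0 O i v c hb0 hσ hξ
    have h4 := mul_le_mul_of_nonneg_left h3 (frobSq_nonneg (R v))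
    have h5 := mul_le_mul_of_nonneg_left h3 hσ2.le
    simp only [← hxdef] at h2
    linarith
  rw [expect_sketchLaw]
  -- The column error is averaged first, with a bound uniform in the rows. The product of the column
  -- error with `‖R‖_F²` then averages to a product of bounds.
  have hE2 : ∀ v, expect (colsLaw O i S v) (fun c => Δ₂ v c) ≤
      (4 * ε ^ 2 + 1 / S) * (2 * b2) ^ 2 := fun v => expect_frobSq_cols_le hS0 O hi v hb0
  have hE1 : expect (iid O.rowSampler S fun _ => i) Δ₁ ≤ (4 * ε ^ 2 + 1 / S) * b2 ^ 2 :=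
    expect_frobSq_rows_le hS0 O i _
  have hER : expect (iid O.rowSampler S fun _ => i) (fun v => frobSq (R v)) ≤ F + 2 * ε * b2 :=
    expect_frobSq_sketch_le hS0 O i _
  set V := ℓ ^ 2 * ((4 * ε ^ 2 + 1 / S) * b2 ^ 2) with hV
  have hV0 : 0 ≤ V := by positivity
  have hin : ∀ v, expect (colsLaw O i S v) (fun c => ∑ j, (l2 x * √(D (v, c) j) - |x j|) ^ 2) ≤
      64 * sumSq (A i) * ℓ ^ 2 * Δ₁ v + ν ^ 2 * F / 10 +
        (64 * frobSq (R v) + 32 * σ ^ 2) * (2 * q + 8 * V) := by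
    intro v
    refine (expect_mono _ (hpt v)).trans ?_
    simp only [expect_add, expect_const, expect_const_mul]
    have h1 := mul_le_mul_of_nonneg_left (hE2 v) (by positivity : 0 ≤ 2 * ℓ ^ 2)
    have h2 : 2 * q + 2 * ℓ ^ 2 * expect (colsLaw O i S v) (fun c => Δ₂ v c) ≤ 2 * q + 8 * V := by
      rw [hV]
      linarith
    have h3 := mul_le_mul_of_nonneg_left h2
      (add_nonneg (mul_nonneg (by norm_num : (0 : ℝ) ≤ 64) (frobSq_nonneg (R v)))
        (by positivity : 0 ≤ 32 * σ ^ 2))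
    linarith
  refine (expect_mono _ hin).trans ?_
  simp only [expect_add, expect_const, expect_const_mul, expect_mul_const]
  have hεb : 48 * (ε * b2) ≤ F := by
    have : ν * ξ ≤ 1 := by nlinarith
    nlinarith
  refine mean_error_le hF0.le hK haF (expect_nonneg _ fun v => frobSq_nonneg _) hE1
    (hER.trans ?_) hV0 ht hq0.le hqν
  linarith

end Output

end RecSys

end

noncomputable section

namespace RecSys

/-! ### The approximating matrix and the running time -/

section Final

open Matrix

variable {m n : ℕ}

theorem sqDist_eq_of_sq_eq {u D : Fin n → ℝ} {c : ℝ} (hc : 0 < c) (hD1 : ∑ j, D j = 1)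
    (h : ∀ j, u j ^ 2 = c ^ 2 * D j) : sqDist u = D ∧ u ≠ 0 := by
  have hl : l2 u ^ 2 = c ^ 2 := by
    rw [l2_sq_real, sumSq]
    simp only [h]
    rw [← Finset.mul_sum, hD1, mul_one]
  constructor
  · funext j
    rw [sqDist, hl, Real.norm_eq_abs, sq_abs, h]
    exact mul_div_cancel_left₀ _ (by positivity)
  · intro hu
    rw [hu, l2_eq_zero.2 rfl] at hl
    have : 0 < c ^ 2 := by positivity
    linarith [zero_pow (M₀ := ℝ) two_ne_zero]

theorem norm_updateRow_sub_le (X : Matrix (Fin m) (Fin n) ℝ) (i : Fin m) (u : Fin n → ℝ) {r : ℝ}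
    (hr : 0 ≤ r) (h : sumSq (u - X i) ≤ r ^ 2) : ‖X.updateRow i u - X‖ ≤ r := by
  refine abs_le_of_sq_le_sq' ?_ hr |>.2
  rw [frobenius_norm_sq_real, frobSq, Finset.sum_eq_single i]
  · simpa [sumSq] using h
  · intro k _ hk
    simp [Matrix.updateRow_ne hk]
  · simp

theorem l2_row_sub_le (B X : Matrix (Fin m) (Fin n) ℝ) (i : Fin m) :
    l2 (B i - X i) ≤ ‖B - X‖ := by
  refine abs_le_of_sq_le_sq' ?_ (norm_nonneg _) |>.2
  rw [l2_sq_real, frobenius_norm_sq_real]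
  exact sq_row_le_frobSq (B - X) i

theorem one_le_logDim [NeZero m] [NeZero n] : 1 ≤ logDim m n := by
  have hm : (1 : ℝ) ≤ m := by exact_mod_cast Nat.one_le_iff_ne_zero.2 (NeZero.ne m)
  have hn : (1 : ℝ) ≤ n := by exact_mod_cast Nat.one_le_iff_ne_zero.2 (NeZero.ne n)
  have := Real.log_nonneg (one_le_mul_of_one_le_of_one_le hm hn)
  rw [logDim]
  linarith

/-- The first term alone suffices: `K⁶ ≤ K⁸`, and `log (1/δ) ≥ log 2 ≥ 1/2` costs the factor `8`.
The second term is only used to be nonnegative. -/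
theorem pow_six_le_timeBound {K φ ξ ν δ : ℝ} (a b : ℝ) (hK : 1 ≤ K) (hφ : 1 ≤ φ) (hξ : 0 < ξ)
    (hν : 0 < ν) (hδ : 0 < δ) (hδ1 : δ ≤ 1 / 2) :
    (φ * K / (ξ * ν)) ^ 6 ≤ 8 * timeBound K φ ξ ν δ a b := by
  have hL : 1 / 2 ≤ Real.log (1 / δ) := by
    have h2 : Real.log 2 ≤ Real.log (1 / δ) :=
      Real.log_le_log (by norm_num) (by rw [le_div_iff₀ hδ]; linarith)
    linarith [Real.log_two_gt_d9]
  have hL3 : 1 / 8 ≤ Real.log (1 / δ) ^ 3 := by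
    have := pow_le_pow_left₀ (by norm_num) hL 3
    norm_num at this ⊢
    linarith
  have hK8 : K ^ 6 ≤ K ^ 8 := pow_le_pow_right₀ hK (by norm_num)
  have h1 : φ ^ 6 * K ^ 6 ≤ 8 * (K ^ 8 * φ ^ 6 * Real.log (1 / δ) ^ 3) := by
    have hφ6 : 0 ≤ φ ^ 6 := by positivity
    have t1 := mul_le_mul_of_nonneg_left hK8 hφ6
    have t2 := mul_le_mul_of_nonneg_left hL3 (by positivity : 0 ≤ K ^ 8 * φ ^ 6)
    linarith
  have h2 : 0 ≤ K ^ 3 * φ ^ 6 * Real.log (1 / δ) ^ 2 / (ξ ^ 2 * ν ^ 2) * (a ^ 2 / b ^ 2) := by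
    positivity
  have h3 := div_le_div_of_nonneg_right h1 (by positivity : 0 ≤ ξ ^ 6 * ν ^ 6)
  rw [timeBound, div_pow, mul_pow, mul_pow]
  rw [mul_div_assoc (8 : ℝ)] at h3
  linarith

/-- The running time in terms of the parameters. -/
theorem cost_le [NeZero m] [NeZero n] {K φ σ ξ ν δ bnorm : ℝ} (a : ℕ) (a' b' : ℝ) (τ : ℕ)
    (hK : 1 ≤ K) (hφ : 1 ≤ φ) (hσ : 0 < σ) (hξ : 0 < ξ) (hξ1 : ξ ≤ 1) (hν : 0 < ν) (hν1 : ν ≤ 1)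
    (hδ : 0 < δ) (hδ1 : δ ≤ 1 / 2) (hb : bnorm ^ 2 = φ * K * σ ^ 2)
    (hτ : (τ : ℝ) ≤ a * logDim m n ^ a) :
    ((2000 * (sampleSize bnorm σ ν ξ + 1) ^ 3 : ℕ) * (τ + 1) : ℝ) ≤
      (16000 * 10002 ^ 3 * (a + 1) : ℕ) * logDim m n ^ (16000 * 10002 ^ 3 * (a + 1)) *
        timeBound K φ ξ ν δ a' b' := by
  have hL := one_le_logDim (m := m) (n := n)
  have hq1 : 1 ≤ φ * K / (ξ * ν) := by
    rw [one_le_div (by positivity)]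
    nlinarith
  have hq : bnorm ^ 2 / (σ ^ 2 * ξ * ν) = φ * K / (ξ * ν) := by
    rw [hb]
    field_simp
  have hT := pow_six_le_timeBound a' b' hK hφ hξ hν hδ hδ1
  set q := φ * K / (ξ * ν) with hqdef
  -- `q ≥ 1` absorbs the two units added to `10000 q²`.
  have hS : ((sampleSize bnorm σ ν ξ + 1 : ℕ) : ℝ) ≤ 10002 * q ^ 2 := by
    have h1 := Nat.floor_le (by positivity : (0 : ℝ) ≤ ((10000 : ℕ) : ℝ) * q ^ 2)
    rw [sampleSize, hq]
    push_cast at h1 ⊢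
    nlinarith
  have hS3 := pow_le_pow_left₀ (Nat.cast_nonneg _) hS 3
  have hT0 : 0 ≤ timeBound K φ ξ ν δ a' b' := by
    have : 0 ≤ q ^ 6 := by positivity
    linarith
  have h1 : ((2000 * (sampleSize bnorm σ ν ξ + 1) ^ 3 : ℕ) : ℝ) ≤
      16000 * 10002 ^ 3 * timeBound K φ ξ ν δ a' b' := by
    push_cast at hS3 ⊢
    calc _ ≤ 2000 * (10002 * q ^ 2) ^ 3 := by linarith
      _ = 2000 * 10002 ^ 3 * q ^ 6 := by ring
      _ ≤ 2000 * 10002 ^ 3 * (8 * timeBound K φ ξ ν δ a' b') :=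
        mul_le_mul_of_nonneg_left hT (by norm_num)
      _ = _ := by ring
  have h2 : (τ + 1 : ℝ) ≤ (a + 1) * logDim m n ^ a := by
    have : 1 ≤ logDim m n ^ a := one_le_pow₀ hL
    linarith
  have h3 : logDim m n ^ a ≤ logDim m n ^ (16000 * 10002 ^ 3 * (a + 1)) :=
    pow_le_pow_right₀ hL (by omega)
  calc _ ≤ (16000 * 10002 ^ 3 * timeBound K φ ξ ν δ a' b') * ((a + 1) * logDim m n ^ a) :=
        mul_le_mul h1 h2 (by positivity) (by positivity)
    _ ≤ (16000 * 10002 ^ 3 * timeBound K φ ξ ν δ a' b') *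
        ((a + 1) * logDim m n ^ (16000 * 10002 ^ 3 * (a + 1))) := by gcongr
    _ = _ := by
        push_cast
        ring

/-- Existence of the approximating matrix for the program `mainProg`. -/
theorem exists_approximation (a : ℕ) (A : Matrix (Fin m) (Fin n) ℝ) (i : Fin m)
    {σ ν ξ δ φ ε : ℝ} (O : OSQ ε φ (A.map ((↑) : ℝ → ℂ))) (τ : ℕ) (hσ : 0 < σ) (hν : 0 < ν)
    (hν1 : ν ≤ 1) (hξ : 0 < ξ) (hξ1 : ξ ≤ 1 / 2) (hδ : 0 < δ) (hδ1 : δ ≤ 1 / 2) (hφ : 1 ≤ φ)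
    (hK : 1 ≤ ratioK A σ) (hτ : (τ : ℝ) ≤ a * logDim m n ^ a) (hε0 : 0 ≤ ε)
    (hε : ε ≤ ν * ξ / (48 * ratioK A σ ^ 2 * φ)) :
    ∃ Ahat : Matrix (Fin m) (Fin n) ℝ,
      ‖Ahat - svt (fun x => x * ramp σ ξ (x ^ 2)) A‖ ≤ ν * ‖A‖ ∧ Ahat i ≠ 0 ∧
      ∀ B : Matrix (Fin m) (Fin n) ℝ,
        ‖B - svt (fun x => x * ramp σ ξ (x ^ 2)) A‖ ≤ ν * ‖A‖ → B i ≠ 0 →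
        ε * (45 * ratioK A σ * φ ^ 2 * l2 (A i) ^ 2) ≤ δ * l2 (B i) ^ 2 →
        ∃ T : ℕ, EndsBy O τ mainProg (inputMem m n i σ ν ξ δ φ) T
            ((16000 * 10002 ^ 3 * (a + 1) : ℕ) * logDim m n ^ (16000 * 10002 ^ 3 * (a + 1)) *
              timeBound (ratioK A σ) φ ξ ν δ (l2 (A i)) (l2 (B i))) ∧
          tv (outDist O τ mainProg (inputMem m n i σ ν ξ δ φ) T) (sqDist (Ahat i)) ≤ δ := by
  have hφ0 : 0 < φ := by linarith
  set K := ratioK A σ with hKdef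
  have hK0 : 0 < K := by linarith
  have hσ2 : 0 < σ ^ 2 := by positivity
  have hKσ : K * σ ^ 2 = ‖A‖ ^ 2 := div_mul_cancel₀ _ hσ2.ne'
  have hA0 : 0 < ‖A‖ := by
    refine lt_of_le_of_ne (norm_nonneg _) fun h => ?_
    rw [← h] at hKσ
    nlinarith
  have : NeZero m := ⟨by rintro rfl; exact i.elim0⟩
  have : NeZero n := ⟨by
    rintro rfl
    refine hA0.ne' ?_
    rw [norm_eq_zero]
    ext _ j
    exact j.elim0⟩
  have hF : ‖A‖ ^ 2 = frobSq A := frobenius_norm_sq_real A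
  have hb2 : l2 (rowNorms O.bar) ^ 2 = φ * K * σ ^ 2 := by
    rw [l2_rowNorms_bar_sq, ← hF, ← hKσ, mul_assoc]
  set S := sampleSize (l2 (rowNorms O.bar)) σ ν ξ with hS
  have hspec := spec_mainProg O τ i S σ ν ξ δ hS
  have hrun : ∀ B : Matrix (Fin m) (Fin n) ℝ,
      EndsBy O τ mainProg (inputMem m n i σ ν ξ δ φ) (2000 * (S + 1) ^ 3)
        ((16000 * 10002 ^ 3 * (a + 1) : ℕ) * logDim m n ^ (16000 * 10002 ^ 3 * (a + 1)) *
          timeBound K φ ξ ν δ (l2 (A i)) (l2 (B i))) := fun B =>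
    hspec.endsBy (cost_le a _ _ τ hK hφ hσ hξ (by linarith) hν hν1 hδ hδ1 hb2 hτ)
  have hout : outDist O τ mainProg (inputMem m n i σ ν ξ δ φ) (2000 * (S + 1) ^ 3) =
      fun j => (outLaw O i S σ ξ j).toReal := funext fun j => hspec.outDist_eq j
  have hrow : svt (fun x => x * ramp σ ξ (x ^ 2)) A i =
      A i ᵥ* specFun (isHermitian_conjTranspose_mul_self A) (ramp σ ξ) := by
    rw [svt_eq_mul_specFun A (ramp σ ξ) (ramp_of_le hσ hξ hσ2.le), Matrix.mul_apply_eq_vecMul]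
  set X := svt (fun x => x * ramp σ ξ (x ^ 2)) A with hX
  -- Below this length the row `i` may be replaced by an arbitrary short vector; above it, every
  -- admissible `B` has a row `i` at most twice as long as that of `X`.
  rcases lt_or_ge (l2 (X i)) (ν * ‖A‖) with hlight | hheavy
  · -- every distribution is realized by a row close to a short row
    -- The largest length for which a vector in any direction stays within `ν‖A‖` of `X i`. It
    -- carries exactly the law of the output, so the distance is `0`.
    set r := ν * ‖A‖ - l2 (X i) with hr
    have hr0 : 0 < r := by linarith
    obtain ⟨hu1, hu2⟩ := sqDist_eq_of_sq_eq (u := fun j => r * √(outLaw O i S σ ξ j).toReal) hr0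
      (sum_toReal (outLaw O i S σ ξ)) fun j => by
        rw [mul_pow, Real.sq_sqrt ENNReal.toReal_nonneg]
    refine ⟨X.updateRow i fun j => r * √(outLaw O i S σ ξ j).toReal,
      norm_updateRow_sub_le X i _ (by positivity) ?_, by rwa [Matrix.updateRow_self], fun B _ _ _ =>
        ⟨_, hrun B, ?_⟩⟩
    · have h1 : l2 (fun j => r * √(outLaw O i S σ ξ j).toReal) = r := by
        rw [l2_eq_sqrt, sumSq]
        simp only [mul_pow, Real.sq_sqrt ENNReal.toReal_nonneg]
        rw [← Finset.mul_sum, sum_toReal, mul_one, Real.sqrt_sq hr0.le]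
      have h2 : l2 ((fun j => r * √(outLaw O i S σ ξ j).toReal) - X i) ≤ ν * ‖A‖ := by
        have := norm_sub_le (WithLp.toLp 2 fun j => r * √(outLaw O i S σ ξ j).toReal)
          (WithLp.toLp 2 (X i))
        change l2 ((fun j => r * √(outLaw O i S σ ξ j).toReal) - X i) ≤
          l2 (fun j => r * √(outLaw O i S σ ξ j).toReal) + l2 (X i) at this
        linarith
      rw [← l2_sq_real]
      exact pow_le_pow_left₀ (l2_nonneg _) h2 2
    · rw [Matrix.updateRow_self, hu1, hout]
      simp only [tv, sub_self, abs_zero, Finset.sum_const_zero, mul_zero]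
      exact hδ.le
  · have hl0 : 0 < l2 (X i) := lt_of_lt_of_le (by positivity) hheavy
    have hx0 : 0 < sumSq (X i) := by
      rw [← l2_sq_real]
      positivity
    -- The approximating matrix has to be fixed before `B` is given. It does not depend on which `B`
    -- satisfies the condition on `ε`, only on whether some `B` does.
    by_cases hB : ∃ B : Matrix (Fin m) (Fin n) ℝ, ‖B - X‖ ≤ ν * ‖A‖ ∧
        ε * (45 * K * φ ^ 2 * l2 (A i) ^ 2) ≤ δ * l2 (B i) ^ 2
    · obtain ⟨B, hB1, hB2⟩ := hB
      have hBx : l2 (B i) ^ 2 ≤ 4 * sumSq (X i) := by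
        have h1 := abs_le.1 (l2_sub_le (B i) (X i))
        have h2 := l2_row_sub_le B X i
        have h3 := pow_le_pow_left₀ (l2_nonneg (B i)) (by linarith : l2 (B i) ≤ 2 * l2 (X i)) 2
        rw [mul_pow, l2_sq_real (X i)] at h3
        linarith
      have hai : A i ≠ 0 := by
        intro h
        have := sq_row_vecMul_specFun_le A i σ ξ
        rw [← hrow, h] at this
        simp [sumSq] at this
        simp [sumSq] at hx0
        linarith
      have hε1 : ε * (48 * l2 (rowNorms O.bar) ^ 2) ≤ ν * ξ * σ ^ 2 := by
        rw [le_div_iff₀ (by positivity)] at hε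
        rw [hb2]
        have h1 : ε * (48 * (φ * K)) ≤ ε * (48 * K ^ 2 * φ) := by
          refine mul_le_mul_of_nonneg_left ?_ hε0
          nlinarith [mul_nonneg (by linarith : (0 : ℝ) ≤ φ) (by nlinarith : 0 ≤ K ^ 2 - K)]
        have h2 := mul_le_mul_of_nonneg_right (h1.trans hε) hσ2.le
        linarith
      -- Passing from `B i` to `X i` costs the factor `4`, and `45 / 4 ≥ 50 / 9`; one of the two
      -- factors `φ` is not needed.
      have hε2 : ε * (50 / 9 * (l2 (rowNorms O.bar) ^ 2 * sumSq (A i))) ≤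
          δ * (σ ^ 2 * sumSq (X i)) := by
        rw [hb2]
        rw [l2_sq_real] at hB2
        have h0 : 0 ≤ ε * (K * φ * sumSq (A i)) := mul_nonneg hε0
          (mul_nonneg (by positivity) (sumSq_nonneg _))
        have h1 : ε * (45 * (K * φ * sumSq (A i))) ≤ ε * (45 * K * φ ^ 2 * sumSq (A i)) := by
          nlinarith
        have h2 := h1.trans (hB2.trans (mul_le_mul_of_nonneg_left hBx hδ.le))
        have h3 := mul_le_mul_of_nonneg_right h2 hσ2.le
        have h4 : 0 ≤ δ * (σ ^ 2 * sumSq (X i)) := by positivity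
        linarith
      rw [hrow] at hx0 hε2
      obtain ⟨D, hD0, hD1, hDtv, hDx⟩ := exists_output_law O hai hσ hν hν1 hξ hξ1 hδ hδ1 hφ
        (by rw [← hF, ← hKσ]; nlinarith) hε0 hε1 hx0 hε2 hS
      rw [← hrow] at hDx
      -- With the signs of `X i`, the distance of `u` to `X i` is that of `‖X i‖ √D` to `|X i|`,
      -- while the squared entries of `u` are proportional to `D` exactly.
      set u : Fin n → ℝ := fun j => (if 0 ≤ X i j then 1 else -1) * (l2 (X i) * √(D j)) with hu
      obtain ⟨hu1, hu2⟩ := sqDist_eq_of_sq_eq (u := u) hl0 hD1 fun j => by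
        rw [hu]
        dsimp only
        rw [mul_pow, mul_pow, Real.sq_sqrt (hD0 j)]
        split_ifs <;> ring
      refine ⟨X.updateRow i u, norm_updateRow_sub_le X i u (by positivity) ?_,
        by rwa [Matrix.updateRow_self], fun B _ _ _ => ⟨_, hrun B, ?_⟩⟩
      · rw [mul_pow, hF]
        refine le_trans (le_of_eq (Finset.sum_congr rfl fun j _ => ?_)) hDx
        rw [Pi.sub_apply, hu]
        dsimp only
        split_ifs with h
        · rw [abs_of_nonneg h]
          ring
        · rw [abs_of_neg (not_le.1 h)]
          ring
      · rw [Matrix.updateRow_self, hu1, hout]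
        exact hDtv
    -- No `B` qualifies, so the claim about the output is vacuous and `X` itself serves; its row `i`
    -- is nonzero because it is long.
    · refine ⟨X, by rw [sub_self, norm_zero]; positivity, fun h => hl0.ne' (l2_eq_zero.2 h),
        fun B h1 _ h2 => (hB ⟨B, h1, h2⟩).elim⟩

end Final

end RecSys

end

theorem mainTheorem9 :
    ∃ (prog : RecSys.Prog) (f : ℝ → ℝ → ℝ → ℝ),
      (∀ σ ξ : ℝ, 0 < σ → σ ≤ 1 → 0 < ξ → ξ ≤ 1 / 2 → RecSys.IsSoftThreshold σ ξ (f σ ξ)) ∧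
      ∀ a : ℕ, ∃ C : ℕ, ∀ (m n : ℕ) (A : Matrix (Fin m) (Fin n) ℝ) (i : Fin m)
        (σ ν ξ δ φ ε : ℝ) (O : RecSys.OSQ ε φ (A.map ((↑) : ℝ → ℂ))) (τ : ℕ),
        0 < σ → σ ≤ 1 → 0 < ν → ν ≤ 1 → 0 < ξ → ξ ≤ 1 / 2 → 0 < δ → δ ≤ 1 / 2 → 1 ≤ φ →
        1 ≤ RecSys.ratioK A σ →
        (τ : ℝ) ≤ a * RecSys.logDim m n ^ a →
        0 ≤ ε → ε ≤ ν * ξ / (48 * RecSys.ratioK A σ ^ 2 * φ) →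
        ∃ Ahat : Matrix (Fin m) (Fin n) ℝ,
          ‖Ahat - RecSys.svt (f σ ξ) A‖ ≤ ν * ‖A‖ ∧ Ahat i ≠ 0 ∧
          ∀ B : Matrix (Fin m) (Fin n) ℝ,
            ‖B - RecSys.svt (f σ ξ) A‖ ≤ ν * ‖A‖ → B i ≠ 0 →
            ε * (45 * RecSys.ratioK A σ * φ ^ 2 * RecSys.l2 (A i) ^ 2) ≤
              δ * RecSys.l2 (B i) ^ 2 →
            ∃ T : ℕ,
              RecSys.EndsBy O τ prog (RecSys.inputMem m n i σ ν ξ δ φ) T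
                (C * RecSys.logDim m n ^ C *
                  RecSys.timeBound (RecSys.ratioK A σ) φ ξ ν δ
                    (RecSys.l2 (A i)) (RecSys.l2 (B i))) ∧
              RecSys.tv
                (RecSys.outDist O τ prog (RecSys.inputMem m n i σ ν ξ δ φ) T)
                (RecSys.sqDist (Ahat i)) ≤ δ := by
  refine ⟨RecSys.mainProg, fun σ ξ x => x * RecSys.ramp σ ξ (x ^ 2),
    fun σ ξ hσ _ hξ hξ1 => RecSys.isSoftThreshold_ramp hσ hξ hξ1,
    fun a => ⟨16000 * 10002 ^ 3 * (a + 1), ?_⟩⟩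
  intro m n A i σ ν ξ δ φ ε O τ hσ _ hν hν1 hξ hξ1 hδ hδ1 hφ hK hτ hε0 hε
  exact RecSys.exists_approximation a A i O τ hσ hν hν1 hξ hξ1 hδ hδ1 hφ hK hτ hε0 hε
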